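/- Let $0<\alpha<1$, let $f\in C^\infty(\mathbb R)$, and for $t>0$, $x\in\mathbb R$ let $$K(t,x)=\frac1{2\pi}\int_{\mathbb R}e^{i\xi x}\,e^{t(i\xi)^{\alpha+1}}\,d\xi$$ (principal branch of the power), the kernel, of unit mass in $x$, of the operator with Fourier symbol $(i\xi)^{\alpha+1}$. For $T\in(0,\infty)$ and $u_0\in L^\infty(\mathbb R)$, a mild solution on $(0,T)\times\mathbb R$ is a function $u\in L^\infty((0,T)\times\mathbb R)$ such that $$u(t,x)=\big(K(t,\cdot)*u_0\big)(x)-\int_0^t\big(\partial_xK(t-s,\cdot)*f(u(s,\cdot))\big)(x)\,ds\quad\text{for a.e. }(t,x)\in(0,T)\times\mathbb R.$$ Let $C_b^\infty((0,T)\times\mathbb R)$ be the set of bounded functions in $C^\infty((0,T)\times\mathbb R)$ all of whose derivatives in $(t,x)$, of every order, are bounded on $(t_0,T)\times\mathbb R$ for every $t_0\in(0,T)$. Let $R_0\ge 0$. Then there are $T>0$, depending only on $R_0$ (and on $\alpha$ and $f$), and constants $C_{m,t_0}>0$, depending only on $m$, $t_0$, $T$, $R_0$, $\alpha$ and $f$,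 such that for every $u_0\in L^\infty(\mathbb R)$ with $\|u_0\|_\infty=R_0$ there is a unique $u\in C_b^\infty((0,T)\times\mathbb R)$ that is a mild solution on $(0,T)\times\mathbb R$, and this $u$ satisfies the following. (i) $\sup_{(0,T)\times\mathbb R}|u|\le C_{0,0}$, and $\sup_{(t_0,T)\times\mathbb R}|\partial_x^m u|\le C_{m,t_0}$ for all integers $m\ge 0$ and all $t_0\in(0,T)$. (ii) For all integers $m\ge 0$, all $t_0\in(0,T)$ and $t\in(0,T-t_0)$, at every point of $\mathbb R$, $$\partial_x^m u(t_0+t,\cdot)=K(t,\cdot)*\partial_x^m u(t_0,\cdot)-\int_0^t\partial_xK(t-s,\cdot)*\partial_x^m\big(f(u(t_0+s,\cdot))\big)\,ds.$$ -/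

import Mathlib

open MeasureTheory Set
open scoped ContDiff

noncomputable section

/-- The convolution `(g * h)(x) = ∫ g(y) h(x - y) dy` of two real functions on `ℝ`. -/
def convR (g h : ℝ → ℝ) : ℝ → ℝ :=
  convolution g h (ContinuousLinearMap.mul ℝ ℝ) volume

/-- The semigroup kernel `K(t, x) = (1 / 2π) ∫ e^{iξx} e^{t (iξ)^{α+1}} dξ` generated by the nonlocal
operator with Fourier symbol `(iξ)^{α+1}` (principal branch). The integral is real, because the
symbol at `-ξ` is the complex conjugate of the symbol at `ξ`, so taking the real part only changes
the type. The factor `1 / 2π` is the one for which `K(t, ·)` has mass one. -/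
def mildKernel (α t x : ℝ) : ℝ :=
  (1 / (2 * Real.pi)) *
    (∫ ξ : ℝ, Complex.exp (Complex.I * ξ * x) *
      Complex.exp (t * (Complex.I * ξ) ^ ((α : ℂ) + 1))).re

/-- The strip `(a, b) × ℝ` in the `(t, x)`-plane. -/
def strip (a b : ℝ) : Set (ℝ × ℝ) := Ioo a b ×ˢ univ

/-- `u` is a mild solution on `(0, T) × ℝ` with flux `f` and initial datum `u₀`: it is in
`L^∞((0, T) × ℝ)` and satisfies Duhamel's formula almost everywhere. -/
def IsMildSolution (α : ℝ) (f u₀ : ℝ → ℝ) (T : ℝ) (u : ℝ → ℝ → ℝ) : Prop :=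
  MemLp (Function.uncurry u) ⊤ (volume.restrict (strip 0 T)) ∧
  ∀ᵐ p ∂(volume.restrict (strip 0 T)),
    u p.1 p.2 = convR (mildKernel α p.1) u₀ p.2
      - ∫ s in (0 : ℝ)..p.1, convR (deriv (mildKernel α (p.1 - s))) (fun y => f (u s y)) p.2

/-- The class `C_b^∞((0, T) × ℝ)`: `u` is jointly smooth and bounded on `(0, T) × ℝ`, and its
derivatives of every order in `(t, x)` are bounded on `(t₀, T) × ℝ` for every `t₀ ∈ (0, T)`. -/
def IsSmoothBounded (T : ℝ) (u : ℝ → ℝ → ℝ) : Prop :=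
  ContDiffOn ℝ ∞ (Function.uncurry u) (strip 0 T) ∧
  (∃ M : ℝ, ∀ p ∈ strip 0 T, |Function.uncurry u p| ≤ M) ∧
  ∀ t₀ ∈ Ioo 0 T, ∀ n : ℕ, ∃ M : ℝ, ∀ p ∈ strip t₀ T,
    ‖iteratedFDeriv ℝ n (Function.uncurry u) p‖ ≤ M

end

noncomputable section

open Filter Topology
open scoped BoundedContinuousFunction FourierTransform

/-! In the self-similar variable `z = x t^{-β}`, `β = 1/(1+α)`, the kernel and its derivatives are
smooth profiles of size `O(1/(1+z²))`. The Duhamel term then carries the time weight `s^{-β}`, which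
is integrable because `β < 1`, so for small `T` the equation is a contraction on bounded continuous
functions.

Smoothness is not obtained by bootstrapping derivatives but by a parameter trick. If `u` is a
solution, then `(t, x) ↦ u(λt, x + μt)` solves the same equation with the kernel profile replaced by
`G(λ, z + μ s^{1-β})` and the Duhamel term multiplied by `λ`. This profile depends smoothly on `(λ,
μ)` near `(1, 0)` in the weighted sup norm (`contDiffOn_paramKernel`), and `v ↦ f ∘ v` is smooth on
bounded continuous functions (`contDiff_nemytskii`). The implicit function theorem together with
uniqueness of the fixed point (`contDiffAt_of_fixedPoint`, `duhamel_fixedPoint_unique`) makes the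
rescaled solution smooth in `(λ, μ)` with values in a sup-norm space. For fixed `(t, x)` with `t >
0`, moving `(λ, μ)` near `(1, 0)` sweeps out a neighbourhood of `(t, x)`. Hence `u` is smooth, and
its derivatives of order `n` are bounded by a constant times `t^{-n}` (`contDiffAt_stripExt`).

Uniformity in the datum comes from solving for all data at once: the unknown lives on `U × (0, 2T) ×
ℝ`, where `U` is the discrete space of measurable data bounded by `R₀`. The sup norm includes the
supremum over `U`, so one fixed point yields one time and one set of constants.

The differentiated formula (ii) follows from the semigroup law of the kernel, proved by Fourier
inversion. The law allows a restart at `t₀ > 0`, after which all `x`-derivatives fall on `u` and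
`f(u)`, whose derivatives are bounded from `t₀` on. -/

/-- The integrand `ξ^a e^{iξx} e^{l c ξ^γ}` of `halfInt`. -/
def halfFun (γ : ℝ) (c : ℂ) (a l x ξ : ℝ) : ℂ :=
  ((ξ ^ a : ℝ) : ℂ) * Complex.exp ((ξ * x : ℝ) * Complex.I + (l * ξ ^ γ : ℝ) * c)

/-- The half-line oscillatory integral `∫_{ξ > 0} ξ^a e^{iξx} e^{l c ξ^γ} dξ`. -/
def halfInt (γ : ℝ) (c : ℂ) (a l x : ℝ) : ℂ :=
  ∫ ξ in Ioi (0 : ℝ), halfFun γ c a l x ξ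

/-- The value of the majorant `∫_{ξ > 0} ξ^a e^{l (Re c) ξ^γ} dξ` of `halfInt`. -/
def halfMajorant (γ : ℝ) (c : ℂ) (a l : ℝ) : ℝ :=
  ∫ ξ in Ioi (0 : ℝ), ξ ^ a * Real.exp (-(l * -c.re) * ξ ^ γ)

/-! ### Half-line oscillatory integrals: differentiation, integration by parts, scaling -/

section HalfInt

variable {γ : ℝ} {c : ℂ} (hγ : 1 < γ) (hc : c.re < 0)

theorem norm_halfFun {a l x ξ : ℝ} (hξ : 0 < ξ) :
    ‖halfFun γ c a l x ξ‖ = ξ ^ a * Real.exp (-(l * -c.re) * ξ ^ γ) := by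
  rw [halfFun, norm_mul, Complex.norm_exp, Complex.norm_real, Real.norm_eq_abs,
    abs_of_nonneg (by positivity)]
  congr 2
  simp [-Complex.ofReal_mul]
  ring

theorem measurable_halfFun {a l x : ℝ} : Measurable (halfFun γ c a l x) := by
  unfold halfFun
  fun_prop

include hγ hc

theorem integrableOn_halfMajorant {a l : ℝ} (ha : -1 < a) (hl : 0 < l) :
    IntegrableOn (fun ξ : ℝ => ξ ^ a * Real.exp (-(l * -c.re) * ξ ^ γ)) (Ioi 0) :=
  integrableOn_rpow_mul_exp_neg_mul_rpow ha (by linarith) (mul_pos hl (by linarith))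

theorem integrableOn_halfFun {a l x : ℝ} (ha : -1 < a) (hl : 0 < l) :
    IntegrableOn (halfFun γ c a l x) (Ioi 0) := by
  refine (integrableOn_halfMajorant hγ hc ha hl).mono' measurable_halfFun.aestronglyMeasurable ?_
  filter_upwards [ae_restrict_mem measurableSet_Ioi] with ξ hξ
  exact (norm_halfFun hξ).le

theorem norm_halfInt_le {a δ l x : ℝ} (ha : -1 < a) (hδ : 0 < δ) (hl : δ ≤ l) :
    ‖halfInt γ c a l x‖ ≤ halfMajorant γ c a δ := by
  refine norm_integral_le_of_norm_le (integrableOn_halfMajorant hγ hc ha hδ) ?_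
  filter_upwards [ae_restrict_mem measurableSet_Ioi] with ξ hξ
  have hξ' : (0 : ℝ) < ξ := hξ
  rw [norm_halfFun hξ]
  gcongr
  linarith

omit hγ hc in
theorem hasFDerivAt_halfFun {a ξ : ℝ} (hξ : 0 < ξ) (p : ℝ × ℝ) :
    HasFDerivAt (fun p : ℝ × ℝ => halfFun γ c a p.1 p.2 ξ)
      ((ContinuousLinearMap.fst ℝ ℝ ℝ).smulRight (c * halfFun γ c (a + γ) p.1 p.2 ξ)
        + (ContinuousLinearMap.snd ℝ ℝ ℝ).smulRight
          (Complex.I * halfFun γ c (a + 1) p.1 p.2 ξ)) p := by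
  have h1 : HasFDerivAt (fun p : ℝ × ℝ => ((ξ * p.2 : ℝ) : ℂ) * Complex.I
      + ((p.1 * ξ ^ γ : ℝ) : ℂ) * c)
      ((ContinuousLinearMap.snd ℝ ℝ ℝ).smulRight (ξ * Complex.I)
        + (ContinuousLinearMap.fst ℝ ℝ ℝ).smulRight (((ξ ^ γ : ℝ) : ℂ) * c)) p := by
    have := ((ContinuousLinearMap.snd ℝ ℝ ℝ).smulRight (ξ * Complex.I)
        + (ContinuousLinearMap.fst ℝ ℝ ℝ).smulRight (((ξ ^ γ : ℝ) : ℂ) * c)).hasFDerivAt (x := p)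
    refine this.congr_of_eventuallyEq (Eventually.of_forall fun q => ?_)
    simp
    ring
  have h2 := (h1.cexp).const_mul (((ξ ^ a : ℝ) : ℂ))
  unfold halfFun
  refine h2.congr_fderiv ?_
  ext
  · simp [Real.rpow_add hξ]
    ring
  · simp [Real.rpow_add hξ]
    ring

/-- Differentiating in `l` or `x` only raises the power of `ξ`. Near `p` one has `l > p.1 / 2`, and
the exponential decay at that value dominates every such power. -/
theorem hasFDerivAt_halfInt {a : ℝ} (ha : -1 < a) {p : ℝ × ℝ} (hp : 0 < p.1) :
    HasFDerivAt (fun p : ℝ × ℝ => halfInt γ c a p.1 p.2)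
      ((ContinuousLinearMap.fst ℝ ℝ ℝ).smulRight (c * halfInt γ c (a + γ) p.1 p.2)
        + (ContinuousLinearMap.snd ℝ ℝ ℝ).smulRight
          (Complex.I * halfInt γ c (a + 1) p.1 p.2)) p := by
  have hs : {q : ℝ × ℝ | p.1 / 2 < q.1} ∈ 𝓝 p :=
    (isOpen_lt continuous_const continuous_fst).mem_nhds (by simp; linarith)
  have key := hasFDerivAt_integral_of_dominated_of_fderiv_le (𝕜 := ℝ)
    (μ := volume.restrict (Ioi (0 : ℝ)))
    (F := fun p : ℝ × ℝ => halfFun γ c a p.1 p.2) (x₀ := p)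
    (F' := fun p ξ => (ContinuousLinearMap.fst ℝ ℝ ℝ).smulRight (c * halfFun γ c (a + γ) p.1 p.2 ξ)
        + (ContinuousLinearMap.snd ℝ ℝ ℝ).smulRight (Complex.I * halfFun γ c (a + 1) p.1 p.2 ξ))
    (bound := fun ξ => ‖c‖ * (ξ ^ (a + γ) * Real.exp (-(p.1 / 2 * -c.re) * ξ ^ γ))
      + (ξ ^ (a + 1) * Real.exp (-(p.1 / 2 * -c.re) * ξ ^ γ)))
    hs (Eventually.of_forall fun q => measurable_halfFun.aestronglyMeasurable)
    (integrableOn_halfFun hγ hc ha hp) ?_ ?_ ?_ ?_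
  · refine key.congr_fderiv ?_
    have i1 : Integrable (fun ξ => c * halfFun γ c (a + γ) p.1 p.2 ξ)
      (volume.restrict (Ioi (0 : ℝ))) :=
      (integrableOn_halfFun hγ hc (by linarith) hp).const_mul _
    have i2 : Integrable (fun ξ => Complex.I * halfFun γ c (a + 1) p.1 p.2 ξ)
      (volume.restrict (Ioi (0 : ℝ))) :=
      (integrableOn_halfFun hγ hc (by linarith) hp).const_mul _
    have e1 := ((ContinuousLinearMap.smulRightL ℝ (ℝ × ℝ) ℂ)
      (ContinuousLinearMap.fst ℝ ℝ ℝ)).integral_comp_comm i1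
    have e2 := ((ContinuousLinearMap.smulRightL ℝ (ℝ × ℝ) ℂ)
      (ContinuousLinearMap.snd ℝ ℝ ℝ)).integral_comp_comm i2
    have j1 := ((ContinuousLinearMap.smulRightL ℝ (ℝ × ℝ) ℂ)
      (ContinuousLinearMap.fst ℝ ℝ ℝ)).integrable_comp i1
    have j2 := ((ContinuousLinearMap.smulRightL ℝ (ℝ × ℝ) ℂ)
      (ContinuousLinearMap.snd ℝ ℝ ℝ)).integrable_comp i2
    simp only [ContinuousLinearMap.smulRightL_apply_apply] at e1 e2 j1 j2
    rw [integral_add j1 j2, e1, e2, integral_const_mul, integral_const_mul]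
    rfl
  · refine AEStronglyMeasurable.add ?_ ?_
    · exact ((ContinuousLinearMap.smulRightL ℝ (ℝ × ℝ) ℂ)
        (ContinuousLinearMap.fst ℝ ℝ ℝ)).continuous.comp_aestronglyMeasurable
        (measurable_halfFun.const_mul c).aestronglyMeasurable
    · exact ((ContinuousLinearMap.smulRightL ℝ (ℝ × ℝ) ℂ)
        (ContinuousLinearMap.snd ℝ ℝ ℝ)).continuous.comp_aestronglyMeasurable
        (measurable_halfFun.const_mul Complex.I).aestronglyMeasurable
  · filter_upwards [ae_restrict_mem measurableSet_Ioi] with ξ hξ q hq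
    have hξ' : (0 : ℝ) < ξ := hξ
    have hq' : p.1 / 2 < q.1 := hq
    refine (norm_add_le _ _).trans ?_
    rw [ContinuousLinearMap.norm_smulRight_apply, ContinuousLinearMap.norm_smulRight_apply,
      norm_mul, norm_mul, norm_halfFun hξ, norm_halfFun hξ, Complex.norm_I, one_mul]
    have hexp : Real.exp (-(q.1 * -c.re) * ξ ^ γ) ≤ Real.exp (-(p.1 / 2 * -c.re) * ξ ^ γ) := by
      gcongr
      linarith
    have n1 := ContinuousLinearMap.norm_fst_le ℝ ℝ ℝ
    have n2 := ContinuousLinearMap.norm_snd_le ℝ ℝ ℝ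
    refine add_le_add ?_ ?_
    · refine (mul_le_of_le_one_left (by positivity) n1).trans ?_
      gcongr
    · refine (mul_le_of_le_one_left (by positivity) n2).trans ?_
      gcongr
  · exact ((integrableOn_halfMajorant hγ hc (by linarith) (by linarith)).const_mul _).add
      (integrableOn_halfMajorant hγ hc (by linarith) (by linarith))
  · filter_upwards [ae_restrict_mem measurableSet_Ioi] with ξ hξ q hq
    exact hasFDerivAt_halfFun hξ q

/-- Integration by parts in `halfInt`. -/
theorem halfInt_integral_by_parts {b l x : ℝ} (hb : 0 ≤ b) (hl : 0 < l) :
    b * halfInt γ c (b - 1) l x + (l * γ : ℝ) * c * halfInt γ c (b + γ - 1) l x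
      + x * Complex.I * halfInt γ c b l x = -((0 : ℝ) ^ b : ℝ) := by
  have hder : ∀ ξ ∈ Ioi (0 : ℝ), HasDerivAt (halfFun γ c b l x)
      (b * halfFun γ c (b - 1) l x ξ + (l * γ : ℝ) * c * halfFun γ c (b + γ - 1) l x ξ
        + x * Complex.I * halfFun γ c b l x ξ) ξ := by
    intro ξ hξ
    have hξ' : (0 : ℝ) < ξ := hξ
    have h1 : HasDerivAt (fun ξ : ℝ => ((ξ ^ b : ℝ) : ℂ)) ((b * ξ ^ (b - 1) : ℝ) : ℂ) ξ :=
      (Real.hasDerivAt_rpow_const (Or.inl hξ'.ne')).ofReal_comp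
    have h2 : HasDerivAt (fun ξ : ℝ => ((l * ξ ^ γ : ℝ) : ℂ)) ((l * (γ * ξ ^ (γ - 1)) : ℝ) : ℂ) ξ :=
      ((Real.hasDerivAt_rpow_const (Or.inl hξ'.ne')).const_mul l).ofReal_comp
    have h3 : HasDerivAt (fun ξ : ℝ => ((ξ * x : ℝ) : ℂ)) ((x : ℝ) : ℂ) ξ := by
      simpa using ((hasDerivAt_id ξ).mul_const x).ofReal_comp
    have h4 := h1.mul (((h3.mul_const Complex.I).add (h2.mul_const c)).cexp)
    refine h4.congr_deriv ?_
    have e : ξ ^ (b + γ - 1) = ξ ^ b * ξ ^ (γ - 1) := by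
      rw [← Real.rpow_add hξ']; congr 1; ring
    simp only [halfFun, e]
    push_cast
    simp only [Pi.add_apply]
    ring
  -- For `b = 0` the power `ξ^{-1}` is not integrable at the origin, but its coefficient vanishes.
  have hint1 : IntegrableOn (fun ξ => (b : ℂ) * halfFun γ c (b - 1) l x ξ) (Ioi 0) := by
    rcases hb.eq_or_lt with rfl | hb'
    · simp
    · exact (integrableOn_halfFun hγ hc (by linarith) hl).const_mul _
  have hint2 : IntegrableOn
      (fun ξ => ((l * γ : ℝ) : ℂ) * c * halfFun γ c (b + γ - 1) l x ξ) (Ioi 0) :=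
    (integrableOn_halfFun hγ hc (by linarith) hl).const_mul _
  have hint3 : IntegrableOn (fun ξ => x * Complex.I * halfFun γ c b l x ξ) (Ioi 0) :=
    (integrableOn_halfFun hγ hc (by linarith) hl).const_mul _
  have hint := (hint1.add hint2).add hint3
  -- The boundary term at infinity vanishes, since the function and its derivative are integrable;
  -- the one at the origin is `0^b`, which is `1` exactly when `b = 0`.
  have hlim := tendsto_zero_of_hasDerivAt_of_integrableOn_Ioi hder hint
    (integrableOn_halfFun hγ hc (by linarith) hl)
  have hcont : ContinuousWithinAt (halfFun γ c b l x) (Ici 0) 0 := by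
    apply Continuous.continuousWithinAt
    unfold halfFun
    have := Real.continuous_rpow_const hb
    have := Real.continuous_rpow_const (show 0 ≤ γ by linarith)
    fun_prop
  have := integral_Ioi_of_hasDerivAt_of_tendsto hcont hder hint hlim
  have hint12 : IntegrableOn (fun ξ => (b : ℂ) * halfFun γ c (b - 1) l x ξ
      + ((l * γ : ℝ) : ℂ) * c * halfFun γ c (b + γ - 1) l x ξ) (Ioi 0) := hint1.add hint2
  rw [integral_add hint12 hint3, integral_add hint1 hint2, integral_const_mul,
    integral_const_mul, integral_const_mul] at this
  simp only [halfInt]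
  rw [this]
  simp [halfFun, Real.zero_rpow (show γ ≠ 0 by linarith)]

omit hγ hc in
-- The substitution `ξ ↦ rξ`. This homogeneity reduces all times to times near `1`.
theorem halfInt_scale {a l x r : ℝ} (hr : 0 < r) :
    halfInt γ c a (r ^ γ * l) (r * x) = ((r ^ (-(a + 1)) : ℝ) : ℂ) * halfInt γ c a l x := by
  have h := integral_comp_mul_left_Ioi (fun ξ => halfFun γ c a l x ξ) 0 hr
  have e : ∀ ξ ∈ Ioi (0 : ℝ), halfFun γ c a l x (r * ξ)
      = ((r ^ a : ℝ) : ℂ) * halfFun γ c a (r ^ γ * l) (r * x) ξ := by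
    intro ξ hξ
    have hξ' : (0 : ℝ) < ξ := hξ
    simp only [halfFun, Real.mul_rpow hr.le hξ'.le]
    push_cast
    rw [mul_assoc]
    congr 3
    ring
  rw [setIntegral_congr_fun measurableSet_Ioi e, integral_const_mul, mul_zero] at h
  have hra : ((r ^ a : ℝ) : ℂ) ≠ 0 := by exact_mod_cast (Real.rpow_pos_of_pos hr a).ne'
  apply mul_left_cancel₀ hra
  simp only [halfInt]
  rw [h, Complex.real_smul, ← mul_assoc]
  congr 1
  rw [← Complex.ofReal_mul, ← Real.rpow_add hr, ← Real.rpow_neg_one]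
  congr 2
  ring

end HalfInt

/-! ### Kernels with homogeneous symbols and their quadratic decay -/

/-- The real kernel with Fourier symbol `ψ^j (iξ)^m e^{l ψ}`, where `ψ(ξ) = c ξ^γ` for `ξ > 0` and
`ψ(-ξ)` is the conjugate of `ψ(ξ)`. -/
def symbolKernel (γ : ℝ) (c : ℂ) (j m : ℕ) (l x : ℝ) : ℝ :=
  (1 / Real.pi) * (c ^ j * Complex.I ^ m * halfInt γ c (γ * j + m) l x).re

section SymbolKernel

variable {γ : ℝ} {c : ℂ} (hγ : 1 < γ) (hc : c.re < 0)

theorem symbolKernel_scale {j m : ℕ} {l x r : ℝ} (hr : 0 < r) :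
    symbolKernel γ c j m (r ^ γ * l) (r * x)
      = r ^ (-(γ * j + m + 1)) * symbolKernel γ c j m l x := by
  simp only [symbolKernel]
  rw [halfInt_scale hr, mul_left_comm, Complex.re_ofReal_mul]
  ring

include hγ hc

theorem hasFDerivAt_symbolKernel {j m : ℕ} {p : ℝ × ℝ} (hp : 0 < p.1) :
    HasFDerivAt (fun p : ℝ × ℝ => symbolKernel γ c j m p.1 p.2)
      (symbolKernel γ c (j + 1) m p.1 p.2 • ContinuousLinearMap.fst ℝ ℝ ℝ
        + symbolKernel γ c j (m + 1) p.1 p.2 • ContinuousLinearMap.snd ℝ ℝ ℝ) p := by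
  have hb : -1 < γ * j + m := by
    have : 0 ≤ γ * j + m := by positivity
    linarith
  have h := (hasFDerivAt_halfInt hγ hc hb hp).const_mul (c ^ j * Complex.I ^ m)
  have h2 := (Complex.reCLM.hasFDerivAt.comp p h).const_mul (1 / Real.pi)
  refine h2.congr_fderiv ?_
  have e1 : γ * j + m + γ = γ * ((j + 1 : ℕ) : ℝ) + m := by push_cast; ring
  have e2 : γ * j + m + 1 = γ * j + ((m + 1 : ℕ) : ℝ) := by push_cast; ring
  simp only [symbolKernel]
  rw [← e1, ← e2]
  ext
  · simp only [ContinuousLinearMap.comp_apply, smul_apply,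
      add_apply, ContinuousLinearMap.smulRight_apply,
      ContinuousLinearMap.inl_apply, ContinuousLinearMap.coe_fst', ContinuousLinearMap.coe_snd',
      Complex.reCLM_apply, smul_eq_mul, one_smul, zero_smul, add_zero, mul_one, mul_zero, pow_succ]
    ring_nf
  · simp only [ContinuousLinearMap.comp_apply, smul_apply,
      add_apply, ContinuousLinearMap.smulRight_apply,
      ContinuousLinearMap.inr_apply, ContinuousLinearMap.coe_fst', ContinuousLinearMap.coe_snd',
      Complex.reCLM_apply, smul_eq_mul, one_smul, zero_smul, zero_add, mul_one, mul_zero, pow_succ]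
    ring_nf

theorem continuousOn_symbolKernel {j m : ℕ} :
    ContinuousOn (fun p : ℝ × ℝ => symbolKernel γ c j m p.1 p.2) (Ioi 0 ×ˢ univ) :=
  fun _ hp => (hasFDerivAt_symbolKernel hγ hc hp.1).continuousAt.continuousWithinAt

theorem hasDerivAt_symbolKernel {j m : ℕ} {l : ℝ} (hl : 0 < l) (x : ℝ) :
    HasDerivAt (symbolKernel γ c j m l) (symbolKernel γ c j (m + 1) l x) x := by
  have h := (hasFDerivAt_symbolKernel hγ hc (j := j) (m := m) (p := (l, x)) hl)
  have h2 : HasDerivAt (fun x : ℝ => (l, x)) (0, 1) x :=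
    (hasDerivAt_const x l).prodMk (hasDerivAt_id x)
  refine (h.comp_hasDerivAt x h2).congr_deriv ?_
  simp

/-- One integration by parts trades the factor `x` for a boundary term and two integrals, which are
dominated by their majorants at `l = 1/2`. -/
theorem exists_abs_mul_norm_halfInt_le {b : ℝ} (hb : 0 ≤ b) :
    ∃ D, ∀ l ∈ Icc (1 / 2 : ℝ) 2, ∀ x : ℝ, ‖x * Complex.I * halfInt γ c b l x‖ ≤ D := by
  refine ⟨1 + b * halfMajorant γ c (b - 1) (1 / 2)
    + (2 * γ) * ‖c‖ * halfMajorant γ c (b + γ - 1) (1 / 2), fun l hl x => ?_⟩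
  have hl0 : 0 < l := by linarith [hl.1]
  have h := halfInt_integral_by_parts hγ hc (x := x) hb hl0
  have h' : x * Complex.I * halfInt γ c b l x = -((0 : ℝ) ^ b : ℝ)
      - b * halfInt γ c (b - 1) l x - (l * γ : ℝ) * c * halfInt γ c (b + γ - 1) l x := by
    rw [← h]; ring
  have n1 : ‖(-((0 : ℝ) ^ b : ℝ) : ℂ)‖ ≤ 1 := by
    rw [norm_neg, Complex.norm_real, Real.norm_eq_abs, abs_of_nonneg (by positivity)]
    rcases hb.eq_or_lt with rfl | hb'
    · simp
    · rw [Real.zero_rpow hb'.ne']; exact zero_le_one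
  have n2 : ‖(b : ℂ) * halfInt γ c (b - 1) l x‖ ≤ b * halfMajorant γ c (b - 1) (1 / 2) := by
    rcases hb.eq_or_lt with rfl | hb'
    · simp
    · rw [norm_mul, Complex.norm_real, Real.norm_eq_abs, abs_of_nonneg hb]
      gcongr
      exact norm_halfInt_le hγ hc (by linarith) (by norm_num) hl.1
  have n3 : ‖((l * γ : ℝ) : ℂ) * c * halfInt γ c (b + γ - 1) l x‖
      ≤ (2 * γ) * ‖c‖ * halfMajorant γ c (b + γ - 1) (1 / 2) := by
    rw [norm_mul, norm_mul, Complex.norm_real, Real.norm_eq_abs, abs_of_nonneg (by positivity)]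
    have := norm_halfInt_le hγ hc (a := b + γ - 1) (x := x) (by linarith)
      (show (0 : ℝ) < 1 / 2 by norm_num) hl.1
    have := hl.2
    gcongr
  rw [h']
  exact (norm_sub_le _ _).trans (add_le_add ((norm_sub_le _ _).trans (add_le_add n1 n2)) n3)

/-- Integration by parts applies twice: for `b ≥ 1` the first boundary term vanishes and the
exponents `b - 1` and `b + γ - 1` that it leaves are nonnegative. -/
theorem exists_sq_mul_norm_halfInt_le {b : ℝ} (hb : 1 ≤ b) :
    ∃ D, ∀ l ∈ Icc (1 / 2 : ℝ) 2, ∀ x : ℝ, x ^ 2 * ‖halfInt γ c b l x‖ ≤ D := by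
  obtain ⟨D₁, h₁⟩ := exists_abs_mul_norm_halfInt_le hγ hc (b := b - 1) (by linarith)
  obtain ⟨D₂, h₂⟩ := exists_abs_mul_norm_halfInt_le hγ hc (b := b + γ - 1) (by linarith)
  refine ⟨b * D₁ + (2 * γ) * ‖c‖ * D₂, fun l hl x => ?_⟩
  have hl0 : 0 < l := by linarith [hl.1]
  have h := halfInt_integral_by_parts hγ hc (x := x) (show 0 ≤ b by linarith) hl0
  rw [Real.zero_rpow (by linarith), Complex.ofReal_zero, neg_zero] at h
  have h' : ((x ^ 2 : ℝ) : ℂ) * halfInt γ c b l x = b * (x * Complex.I * halfInt γ c (b - 1) l x)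
      + (l * γ : ℝ) * c * (x * Complex.I * halfInt γ c (b + γ - 1) l x) := by
    have := congrArg (fun z => x * Complex.I * z) h
    simp only [mul_zero] at this
    push_cast
    push_cast at this
    linear_combination (x : ℂ) ^ 2 * halfInt γ c b l x * Complex.I_sq - this
  have e : x ^ 2 * ‖halfInt γ c b l x‖ = ‖((x ^ 2 : ℝ) : ℂ) * halfInt γ c b l x‖ := by
    rw [norm_mul, Complex.norm_real, Real.norm_eq_abs, abs_of_nonneg (sq_nonneg x)]
  rw [e, h']
  refine (norm_add_le _ _).trans (add_le_add ?_ ?_)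
  · rw [norm_mul, Complex.norm_real, Real.norm_eq_abs, abs_of_nonneg (by linarith)]
    gcongr
    exact h₁ l hl x
  · rw [norm_mul, norm_mul ((l * γ : ℝ) : ℂ), Complex.norm_real, Real.norm_eq_abs,
      abs_of_nonneg (by positivity)]
    have := hl.2
    have := h₂ l hl x
    gcongr

/-- At exponent zero the half-line integral itself decays only like `1/x`, because of the jump at
the origin. That leading term is purely imaginary, so it is absent from the real part. -/
theorem exists_sq_mul_abs_re_halfInt_zero_le :
    ∃ D, ∀ l ∈ Icc (1 / 2 : ℝ) 2, ∀ x : ℝ, x ^ 2 * |(halfInt γ c 0 l x).re| ≤ D := by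
  obtain ⟨D₂, h₂⟩ := exists_abs_mul_norm_halfInt_le hγ hc (b := γ - 1) (by linarith)
  refine ⟨(2 * γ) * ‖c‖ * D₂, fun l hl x => ?_⟩
  have hl0 : 0 < l := by linarith [hl.1]
  have h := halfInt_integral_by_parts hγ hc (x := x) le_rfl hl0
  rw [Real.rpow_zero, Complex.ofReal_one, Complex.ofReal_zero, zero_mul, zero_add, zero_add] at h
  have h' : ((x ^ 2 : ℝ) : ℂ) * halfInt γ c 0 l x = x * Complex.I
      + (l * γ : ℝ) * c * (x * Complex.I * halfInt γ c (γ - 1) l x) := by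
    have := congrArg (fun z => x * Complex.I * z) h
    push_cast
    push_cast at this
    linear_combination (x : ℂ) ^ 2 * halfInt γ c 0 l x * Complex.I_sq - this
  have e : x ^ 2 * |(halfInt γ c 0 l x).re|
      = |((l * γ : ℝ) * c * (x * Complex.I * halfInt γ c (γ - 1) l x) : ℂ).re| := by
    rw [← abs_of_nonneg (sq_nonneg x), ← abs_mul, ← Complex.re_ofReal_mul, h', Complex.add_re]
    simp
  rw [e]
  refine (Complex.abs_re_le_norm _).trans ?_
  rw [norm_mul, norm_mul ((l * γ : ℝ) : ℂ), Complex.norm_real, Real.norm_eq_abs,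
    abs_of_nonneg (by positivity)]
  have := hl.2
  have := h₂ l hl x
  gcongr

/-- Only `j = m = 0` needs the cancellation in the real part; otherwise `γj + m ≥ 1` and two
integrations by parts suffice. The range of `l` contains the dilations allowed by `paramBall`. -/
theorem exists_symbolKernel_le (j m : ℕ) :
    ∃ C, 0 ≤ C ∧ ∀ l ∈ Icc (1 / 2 : ℝ) 2, ∀ x : ℝ, (1 + x ^ 2) * |symbolKernel γ c j m l x| ≤ C := by
  have key : ∃ D, ∀ l ∈ Icc (1 / 2 : ℝ) 2, ∀ x : ℝ,
      x ^ 2 * |(c ^ j * Complex.I ^ m * halfInt γ c (γ * j + m) l x).re| ≤ D := by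
    by_cases h0 : j = 0 ∧ m = 0
    · obtain ⟨rfl, rfl⟩ := h0
      simpa using exists_sq_mul_abs_re_halfInt_zero_le hγ hc
    · have hb : 1 ≤ γ * j + m := by
        rcases Nat.eq_zero_or_pos j with rfl | hj
        · have hm : 1 ≤ m := by omega
          have : (1 : ℝ) ≤ m := by exact_mod_cast hm
          simpa using this
        · have : (1 : ℝ) ≤ j := by exact_mod_cast hj
          have : (0 : ℝ) ≤ m := by positivity
          nlinarith
      obtain ⟨D, hD⟩ := exists_sq_mul_norm_halfInt_le hγ hc hb
      refine ⟨‖c‖ ^ j * D, fun l hl x => ?_⟩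
      have h1 := Complex.abs_re_le_norm (c ^ j * Complex.I ^ m * halfInt γ c (γ * j + m) l x)
      rw [norm_mul, norm_mul, norm_pow, norm_pow, Complex.norm_I, one_pow, mul_one] at h1
      calc _ ≤ x ^ 2 * (‖c‖ ^ j * ‖halfInt γ c (γ * j + m) l x‖) := by gcongr
        _ = ‖c‖ ^ j * (x ^ 2 * ‖halfInt γ c (γ * j + m) l x‖) := by ring
        _ ≤ _ := by
          have := hD l hl x
          gcongr
  obtain ⟨D, hD⟩ := key
  have hb : -1 < γ * j + m := by
    have : 0 ≤ γ * j + m := by positivity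
    linarith
  have hmain : ∀ l ∈ Icc (1 / 2 : ℝ) 2, ∀ x : ℝ, (1 + x ^ 2) * |symbolKernel γ c j m l x|
      ≤ (1 / Real.pi) * (‖c‖ ^ j * halfMajorant γ c (γ * j + m) (1 / 2) + D) := by
    intro l hl x
    have h1 := Complex.abs_re_le_norm (c ^ j * Complex.I ^ m * halfInt γ c (γ * j + m) l x)
    rw [norm_mul, norm_mul, norm_pow, norm_pow, Complex.norm_I, one_pow, mul_one] at h1
    have h2 := norm_halfInt_le hγ hc (x := x) hb (show (0 : ℝ) < 1 / 2 by norm_num) hl.1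
    have h3 : |(c ^ j * Complex.I ^ m * halfInt γ c (γ * j + m) l x).re|
        ≤ ‖c‖ ^ j * halfMajorant γ c (γ * j + m) (1 / 2) := h1.trans (by gcongr)
    have h4 := hD l hl x
    rw [symbolKernel, abs_mul, abs_of_nonneg (by positivity), mul_left_comm]
    gcongr
    linarith
  refine ⟨_, ?_, hmain⟩
  refine le_trans ?_ (hmain 1 ⟨by norm_num, by norm_num⟩ 0)
  positivity

end SymbolKernel

/-! ### Differentiability in the sup norm from uniform Taylor estimates -/

/-- A quadratic Taylor estimate from a Lipschitz bound on the derivative. -/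
theorem Convex.norm_image_sub_sub_le_sq {E F : Type*} [NormedAddCommGroup E] [NormedSpace ℝ E]
    [NormedAddCommGroup F] [NormedSpace ℝ F] {s : Set E} (hs : Convex ℝ s) {f : E → F}
    {f' : E → E →L[ℝ] F} (hf : ∀ x ∈ s, HasFDerivAt f (f' x) x) {K : ℝ} (hK : 0 ≤ K)
    (hL : ∀ x ∈ s, ∀ y ∈ s, ‖f' y - f' x‖ ≤ K * ‖y - x‖) {a b : E} (ha : a ∈ s) (hb : b ∈ s) :
    ‖f b - f a - f' a (b - a)‖ ≤ K * ‖b - a‖ ^ 2 := by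
  have hsub : segment ℝ a b ⊆ s := hs.segment_subset ha hb
  have := (convex_segment a b).norm_image_sub_le_of_norm_hasFDerivWithin_le' (f := f) (f' := f')
    (φ := f' a) (C := K * ‖b - a‖) (fun x hx => (hf x (hsub hx)).hasFDerivWithinAt)
    (fun x hx => (hL a ha x (hsub hx)).trans (by gcongr; exact norm_sub_le_of_mem_segment hx))
    (left_mem_segment ℝ a b) (right_mem_segment ℝ a b)
  rwa [sq, ← mul_assoc]

theorem hasFDerivAt_of_eventually_le_sq {E F : Type*} [NormedAddCommGroup E] [NormedSpace ℝ E]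
    [NormedAddCommGroup F] [NormedSpace ℝ F] {f : E → F} {L : E →L[ℝ] F} {a : E} {K : ℝ}
    (h : ∀ᶠ b in 𝓝 a, ‖f b - f a - L (b - a)‖ ≤ K * ‖b - a‖ ^ 2) : HasFDerivAt f L a := by
  rw [hasFDerivAt_iff_isLittleO]
  refine Asymptotics.IsBigO.trans_isLittleO ?_ (Asymptotics.isLittleO_pow_sub_sub a one_lt_two)
  refine Asymptotics.IsBigO.of_bound K ?_
  filter_upwards [h] with b hb
  simpa using hb

theorem contDiffOn_nat_succ_of_hasFDerivAt {E F : Type*} [NormedAddCommGroup E] [NormedSpace ℝ E]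
    [NormedAddCommGroup F] [NormedSpace ℝ F] {f : E → F} {f' : E → E →L[ℝ] F} {s : Set E}
    (hs : IsOpen s) {n : ℕ} (hf : ∀ x ∈ s, HasFDerivAt f (f' x) x) (hf' : ContDiffOn ℝ n f' s) :
    ContDiffOn ℝ (n + 1 : ℕ) f s := by
  push_cast
  exact (contDiffOn_succ_iff_hasFDerivWithinAt_of_uniqueDiffOn hs.uniqueDiffOn).2
    ⟨fun h => absurd h (by simp), f', hf', fun x hx => (hf x hx).hasFDerivWithinAt⟩

section Family

variable {ι Z : Type*} [TopologicalSpace Z] {P : Set (ℝ × ℝ)} {F : ι → ℝ × ℝ → (Z →ᵇ ℝ)}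
  {d₁ d₂ : ι → ι}

/-- A uniformly bounded family of functions that is closed under the two pointwise partial
derivatives is smooth as a family of maps into the space of bounded continuous functions. -/
theorem contDiffOn_boundedContinuousFunction_of_family (hPo : IsOpen P) (hPc : Convex ℝ P)
    (hb : ∀ i, ∃ C, ∀ p ∈ P, ‖F i p‖ ≤ C)
    (hd : ∀ i, ∀ p ∈ P, ∀ z, HasFDerivAt (fun q => F i q z)
      (F (d₁ i) p z • ContinuousLinearMap.fst ℝ ℝ ℝ
        + F (d₂ i) p z • ContinuousLinearMap.snd ℝ ℝ ℝ) p) (i : ι) :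
    ContDiffOn ℝ ∞ (F i) P := by
  have n1 := ContinuousLinearMap.norm_fst_le ℝ ℝ ℝ
  have n2 := ContinuousLinearMap.norm_snd_le ℝ ℝ ℝ
  have hcomb : ∀ a b : ℝ, ‖a • ContinuousLinearMap.fst ℝ ℝ ℝ
      + b • ContinuousLinearMap.snd ℝ ℝ ℝ‖ ≤ ‖a‖ + ‖b‖ := fun a b => by
    refine (norm_add_le _ _).trans (add_le_add ?_ ?_)
    · rw [norm_smul]; exact mul_le_of_le_one_right (norm_nonneg _) n1
    · rw [norm_smul]; exact mul_le_of_le_one_right (norm_nonneg _) n2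
  have hlip : ∀ i, ∃ K, 0 ≤ K ∧ ∀ p ∈ P, ∀ q ∈ P, ∀ z, ‖F i q z - F i p z‖ ≤ K * ‖q - p‖ := by
    intro i
    obtain ⟨C₁, h₁⟩ := hb (d₁ i)
    obtain ⟨C₂, h₂⟩ := hb (d₂ i)
    refine ⟨max (C₁ + C₂) 0, le_max_right _ _, fun p hp q hq z => ?_⟩
    refine hPc.norm_image_sub_le_of_norm_hasFDerivWithin_le
      (fun x hx => (hd i x hx z).hasFDerivWithinAt) (fun x hx => ?_) hp hq
    refine ((hcomb _ _).trans (add_le_add ?_ ?_)).trans (le_max_left _ _)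
    · exact ((F (d₁ i) x).norm_coe_le_norm z).trans (h₁ x hx)
    · exact ((F (d₂ i) x).norm_coe_le_norm z).trans (h₂ x hx)
  -- The first derivatives are Lipschitz with constants independent of `z`, so the Taylor remainder
  -- is quadratic uniformly in `z`. This turns pointwise derivatives into a Fréchet derivative in
  -- the sup norm.
  have hder : ∀ i, ∀ p ∈ P, HasFDerivAt (F i)
      ((ContinuousLinearMap.fst ℝ ℝ ℝ).smulRight (F (d₁ i) p)
        + (ContinuousLinearMap.snd ℝ ℝ ℝ).smulRight (F (d₂ i) p)) p := by
    intro i p hp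
    obtain ⟨K₁, hK₁, h₁⟩ := hlip (d₁ i)
    obtain ⟨K₂, hK₂, h₂⟩ := hlip (d₂ i)
    refine hasFDerivAt_of_eventually_le_sq (K := K₁ + K₂) ?_
    filter_upwards [hPo.mem_nhds hp] with q hq
    refine (BoundedContinuousFunction.norm_le (by positivity)).2 fun z => ?_
    have := hPc.norm_image_sub_sub_le_sq (fun x hx => hd i x hx z) (add_nonneg hK₁ hK₂)
      (fun x hx y hy => ?_) hp hq
    · convert! this using 2
      simp [mul_comm]
    · have e : ∀ a b a' b' : ℝ, (a • ContinuousLinearMap.fst ℝ ℝ ℝ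
          + b • ContinuousLinearMap.snd ℝ ℝ ℝ) - (a' • ContinuousLinearMap.fst ℝ ℝ ℝ
          + b' • ContinuousLinearMap.snd ℝ ℝ ℝ) = (a - a') • ContinuousLinearMap.fst ℝ ℝ ℝ
          + (b - b') • ContinuousLinearMap.snd ℝ ℝ ℝ := fun a b a' b' => by module
      rw [e, add_mul]
      exact (hcomb _ _).trans (add_le_add (h₁ x hx y hy z) (h₂ x hx y hy z))
  rw [contDiffOn_infty]
  intro n
  induction n generalizing i with
  | zero =>
    exact contDiffOn_zero.2 fun p hp => (hder i p hp).continuousAt.continuousWithinAt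
  | succ n ih =>
    refine contDiffOn_nat_succ_of_hasFDerivAt hPo (hder i) ?_
    exact (contDiffOn_const.smulRight (ih (d₁ i))).add (contDiffOn_const.smulRight (ih (d₂ i)))

end Family

/-! ### Superposition operators on bounded continuous functions -/

section Nemytskii

variable {Z : Type*} [TopologicalSpace Z]

theorem exists_abs_le_of_continuous {g : ℝ → ℝ} (hg : Continuous g) (M : ℝ) :
    ∃ C, 0 ≤ C ∧ ∀ r, |r| ≤ M → |g r| ≤ C := by
  obtain ⟨C, hC⟩ := (isCompact_Icc (a := -M) (b := M)).exists_bound_of_continuousOn hg.continuousOn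
  exact ⟨max C 0, le_max_right _ _, fun r hr => (hC r (abs_le.1 hr)).trans (le_max_left _ _)⟩

/-- The superposition operator `v ↦ g ∘ v` on bounded continuous functions. -/
def nemytskii (g : ℝ → ℝ) (hg : Continuous g) (v : Z →ᵇ ℝ) : Z →ᵇ ℝ :=
  BoundedContinuousFunction.ofNormedAddCommGroup (fun z => g (v z)) (hg.comp v.continuous)
    (exists_abs_le_of_continuous hg ‖v‖).choose
    (fun z => (exists_abs_le_of_continuous hg ‖v‖).choose_spec.2 _ (v.norm_coe_le_norm z))

@[simp]
theorem nemytskii_apply (g : ℝ → ℝ) (hg : Continuous g) (v : Z →ᵇ ℝ) (z : Z) :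
    nemytskii g hg v z = g (v z) := rfl

theorem exists_taylor_le {g : ℝ → ℝ} (hg : ContDiff ℝ ∞ g) (M : ℝ) :
    ∃ K, 0 ≤ K ∧ ∀ a b, |a| ≤ M → |b| ≤ M →
      |g b - g a - deriv g a * (b - a)| ≤ K * |b - a| ^ 2 := by
  have hg' : ContDiff ℝ ∞ (deriv g) := (contDiff_infty_iff_deriv.1 hg).2
  have hg'' : ContDiff ℝ ∞ (deriv (deriv g)) := (contDiff_infty_iff_deriv.1 hg').2
  obtain ⟨K, hK, h⟩ := exists_abs_le_of_continuous hg''.continuous M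
  have hmem : ∀ {r : ℝ}, |r| ≤ M ↔ r ∈ Icc (-M) M := abs_le
  refine ⟨K, hK, fun a b ha hb => ?_⟩
  have hd : ∀ x, HasFDerivAt g (ContinuousLinearMap.toSpanSingleton ℝ (deriv g x)) x := fun x =>
    (hg.differentiable (by simp) x).hasDerivAt.hasFDerivAt
  have := (convex_Icc (-M) M).norm_image_sub_sub_le_sq (fun x _ => hd x) hK (fun x hx y hy => ?_)
    (hmem.1 ha) (hmem.1 hb)
  · simpa [mul_comm] using this
  · have e : ContinuousLinearMap.toSpanSingleton ℝ (deriv g y)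
        - ContinuousLinearMap.toSpanSingleton ℝ (deriv g x)
        = ContinuousLinearMap.toSpanSingleton ℝ (deriv g y - deriv g x) := by
      ext; simp
    rw [e, ContinuousLinearMap.norm_toSpanSingleton]
    exact (convex_Icc (-M) M).norm_image_sub_le_of_norm_hasDerivWithin_le
      (fun z _ => (hg'.differentiable (by simp) z).hasDerivAt.hasDerivWithinAt)
      (fun z hz => h z (hmem.2 hz)) hx hy

/-- On the unit ball around `v` all values stay in a fixed compact interval, where the scalar Taylor
remainder is uniformly quadratic. -/
theorem hasFDerivAt_nemytskii {g : ℝ → ℝ} (hg : ContDiff ℝ ∞ g) (v : Z →ᵇ ℝ) :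
    HasFDerivAt (nemytskii (Z := Z) g hg.continuous)
      (ContinuousLinearMap.mul ℝ (Z →ᵇ ℝ)
        (nemytskii (deriv g) (contDiff_infty_iff_deriv.1 hg).2.continuous v)) v := by
  obtain ⟨K, hK, h⟩ := exists_taylor_le hg (‖v‖ + 1)
  refine hasFDerivAt_of_eventually_le_sq (K := K) ?_
  filter_upwards [Metric.ball_mem_nhds v one_pos] with w hw
  have hw' : ‖w - v‖ ≤ 1 := by simpa [dist_eq_norm] using (Metric.mem_ball.1 hw).le
  have hwn : ‖w‖ ≤ ‖v‖ + 1 := by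
    have := norm_add_le v (w - v)
    rw [add_sub_cancel] at this
    linarith
  refine (BoundedContinuousFunction.norm_le (by positivity)).2 fun z => ?_
  have hz := h (v z) (w z) ((v.norm_coe_le_norm z).trans (by linarith))
    ((w.norm_coe_le_norm z).trans hwn)
  refine le_trans (le_of_eq ?_) (hz.trans ?_)
  · simp
  · gcongr
    exact (w - v).norm_coe_le_norm z

/-- The derivative is multiplication by the superposition operator of `g'`, so induction on the
order applies to `g'`. -/
theorem contDiff_nemytskii {g : ℝ → ℝ} (hg : ContDiff ℝ ∞ g) :
    ContDiff ℝ ∞ (nemytskii (Z := Z) g hg.continuous) := by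
  rw [contDiff_infty]
  intro n
  induction n generalizing g with
  | zero =>
    exact contDiff_zero.2 (continuous_iff_continuousAt.2
      fun v => (hasFDerivAt_nemytskii hg v).continuousAt)
  | succ n ih =>
    rw [← contDiffOn_univ]
    refine contDiffOn_nat_succ_of_hasFDerivAt isOpen_univ
      (fun v _ => hasFDerivAt_nemytskii hg v) ?_
    exact ((ContinuousLinearMap.isBoundedLinearMap _).contDiff.comp
      (ih (contDiff_infty_iff_deriv.1 hg).2)).contDiffOn

end Nemytskii

/-! ### The strip and the singular time weight -/

theorem isOpen_strip (a b : ℝ) : IsOpen (strip a b) := isOpen_Ioo.prod isOpen_univ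

theorem mem_strip {a b : ℝ} {q : ℝ × ℝ} : q ∈ strip a b ↔ a < q.1 ∧ q.1 < b := by
  simp [strip]

theorem inv_one_add_sq_add_le (a b : ℝ) :
    (1 + (a + b) ^ 2)⁻¹ ≤ 2 * (1 + b ^ 2) * (1 + a ^ 2)⁻¹ := by
  rw [← div_eq_mul_inv, le_div_iff₀ (by positivity), inv_mul_le_iff₀ (by positivity)]
  nlinarith [sq_nonneg (a + 2 * b), sq_nonneg ((a + b) * b), sq_nonneg a, sq_nonneg b]

theorem one_add_sq_add_le (a b : ℝ) : 1 + (a + b) ^ 2 ≤ 2 * (1 + b ^ 2) * (1 + a ^ 2) := by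
  nlinarith [sq_nonneg (a - b), sq_nonneg (a * b)]

theorem volume_restrict_strip (a b : ℝ) : (volume : Measure (ℝ × ℝ)).restrict (strip a b)
    = (volume.restrict (Ioo a b)).prod volume := by
  rw [strip, Measure.volume_eq_prod, ← Measure.prod_restrict, Measure.restrict_univ]

/-- The singular weight `s^{-β} / (1 + z²)` dominating the Duhamel kernel in rescaled variables. -/
def duhamelWeight (β : ℝ) (q : ℝ × ℝ) : ℝ := q.1 ^ (-β) * (1 + q.2 ^ 2)⁻¹

theorem measurable_duhamelWeight {β : ℝ} : Measurable (duhamelWeight β) := by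
  unfold duhamelWeight
  fun_prop

theorem duhamelWeight_nonneg {β a b : ℝ} (ha : 0 ≤ a) {q : ℝ × ℝ} (hq : q ∈ strip a b) :
    0 ≤ duhamelWeight β q := by
  have := (mem_strip.1 hq).1
  unfold duhamelWeight
  have : 0 ≤ q.1 := by linarith
  positivity

theorem integrableOn_rpow_neg {β T : ℝ} (hβ : β < 1) :
    IntegrableOn (fun s : ℝ => s ^ (-β)) (Ioo 0 T) := by
  rcases le_or_gt T 0 with hT | hT
  · simp [Ioo_eq_empty_of_le hT]
  · rw [← integrableOn_Ioc_iff_integrableOn_Ioo, ← intervalIntegrable_iff_integrableOn_Ioc_of_le hT.le]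
    exact intervalIntegral.intervalIntegrable_rpow' (by linarith)

theorem integrableOn_duhamelWeight {β T : ℝ} (hβ : β < 1) :
    IntegrableOn (duhamelWeight β) (strip 0 T) := by
  rw [IntegrableOn, volume_restrict_strip]
  exact (integrableOn_rpow_neg hβ).mul_prod integrable_inv_one_add_sq

/-- The value tends to zero with `T`; this is the source of smallness in the contraction. -/
theorem integral_duhamelWeight {β T : ℝ} (hβ : β < 1) (hT : 0 ≤ T) :
    ∫ q in strip 0 T, duhamelWeight β q = T ^ (1 - β) / (1 - β) * Real.pi := by
  rw [volume_restrict_strip]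
  simp only [duhamelWeight]
  rw [integral_prod_mul (fun s : ℝ => s ^ (-β)) (fun z : ℝ => (1 + z ^ 2)⁻¹),
    integral_univ_inv_one_add_sq, ← integral_Ioc_eq_integral_Ioo,
    ← intervalIntegral.integral_of_le hT, integral_rpow (Or.inl (by linarith))]
  rw [show -β + 1 = 1 - β by ring, Real.zero_rpow (by linarith), sub_zero]

/-! ### The Duhamel operator in self-similar variables -/

section StripExt

variable {U : Type*} {T : ℝ}

/-- The extension by zero of a function on `U × strip 0 T` to `U × ℝ × ℝ`. -/
def stripExt (v : U × strip 0 T → ℝ) (u : U) (q : ℝ × ℝ) : ℝ :=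
  open Classical in if h : q ∈ strip 0 T then v (u, ⟨q, h⟩) else 0

theorem stripExt_of_mem (v : U × strip 0 T → ℝ) (u : U) {q : ℝ × ℝ} (h : q ∈ strip 0 T) :
    stripExt v u q = v (u, ⟨q, h⟩) := by simp [stripExt, h]

theorem stripExt_of_notMem (v : U × strip 0 T → ℝ) (u : U) {q : ℝ × ℝ} (h : q ∉ strip 0 T) :
    stripExt v u q = 0 := by simp [stripExt, h]

variable [TopologicalSpace U]

theorem abs_stripExt_le (v : U × strip 0 T →ᵇ ℝ) (u : U) (q : ℝ × ℝ) :
    |stripExt v u q| ≤ ‖v‖ := by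
  by_cases h : q ∈ strip 0 T
  · rw [stripExt_of_mem _ _ h]; exact v.norm_coe_le_norm _
  · rw [stripExt_of_notMem _ _ h]; simp

theorem continuousOn_stripExt (v : U × strip 0 T →ᵇ ℝ) (u : U) :
    ContinuousOn (stripExt v u) (strip 0 T) := by
  rw [continuousOn_iff_continuous_domRestrict]
  have : (strip 0 T).domRestrict (stripExt v u) = fun q : strip 0 T => v (u, q) := by
    ext q
    exact stripExt_of_mem v u q.2
  rw [this]
  fun_prop

theorem measurable_stripExt (v : U × strip 0 T →ᵇ ℝ) (u : U) : Measurable (stripExt v u) := by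
  classical
  have h : stripExt v u = (strip 0 T).piecewise (stripExt v u) (fun _ => 0) := by
    ext q
    by_cases h : q ∈ strip 0 T
    · rw [piecewise_eq_of_mem _ _ _ h]
    · rw [piecewise_eq_of_notMem _ _ _ h, stripExt_of_notMem _ _ h]
  rw [h]
  exact (continuousOn_stripExt v u).measurable_piecewise continuousOn_const
    (isOpen_strip 0 T).measurableSet

theorem stripExt_add (v w : U × strip 0 T →ᵇ ℝ) (u : U) (q : ℝ × ℝ) :
    stripExt (v + w) u q = stripExt v u q + stripExt w u q := by
  by_cases h : q ∈ strip 0 T <;> simp [stripExt, h]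

theorem stripExt_smul (a : ℝ) (v : U × strip 0 T →ᵇ ℝ) (u : U) (q : ℝ × ℝ) :
    stripExt (a • v) u q = a * stripExt v u q := by
  by_cases h : q ∈ strip 0 T <;> simp [stripExt, h]

end StripExt

section Duhamel

variable {U : Type*} [TopologicalSpace U] {T β : ℝ}

/-- The integrand of the rescaled Duhamel operator. -/
def duhamelFun (β : ℝ) (y : ℝ × ℝ →ᵇ ℝ) (v : U × strip 0 T → ℝ) (u : U) (p q : ℝ × ℝ) : ℝ :=
  duhamelWeight β q * y q * stripExt v u (p.1 - q.1, p.2 - q.1 ^ β * q.2)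

theorem measurable_duhamelFun (y : ℝ × ℝ →ᵇ ℝ) (v : U × strip 0 T →ᵇ ℝ) (u : U) (p : ℝ × ℝ) :
    Measurable (duhamelFun β y v u p) := by
  unfold duhamelFun
  have h1 := measurable_stripExt v u
  have h2 := y.continuous.measurable
  have h3 := measurable_duhamelWeight (β := β)
  fun_prop

theorem abs_duhamelFun_le (y : ℝ × ℝ →ᵇ ℝ) (v : U × strip 0 T →ᵇ ℝ) (u : U) (p : ℝ × ℝ)
    {q : ℝ × ℝ} (hq : q ∈ strip 0 T) :
    |duhamelFun β y v u p q| ≤ duhamelWeight β q * (‖y‖ * ‖v‖) := by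
  rw [duhamelFun, abs_mul, abs_mul, abs_of_nonneg (duhamelWeight_nonneg le_rfl hq), mul_assoc]
  have h1 := duhamelWeight_nonneg (β := β) le_rfl hq
  have h2 := y.norm_coe_le_norm q
  have h3 := abs_stripExt_le v u (p.1 - q.1, p.2 - q.1 ^ β * q.2)
  rw [Real.norm_eq_abs] at h2
  gcongr

theorem integrableOn_duhamelFun (hβ : β < 1) (y : ℝ × ℝ →ᵇ ℝ) (v : U × strip 0 T →ᵇ ℝ) (u : U)
    (p : ℝ × ℝ) : IntegrableOn (duhamelFun β y v u p) (strip 0 T) := by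
  refine Integrable.mono' ((integrableOn_duhamelWeight hβ).mul_const (‖y‖ * ‖v‖))
    (measurable_duhamelFun y v u p).aestronglyMeasurable ?_
  filter_upwards [ae_restrict_mem (isOpen_strip 0 T).measurableSet] with q hq
  exact abs_duhamelFun_le y v u p hq

theorem abs_integral_duhamelFun_le (hβ : β < 1) (hT : 0 ≤ T) (y : ℝ × ℝ →ᵇ ℝ)
    (v : U × strip 0 T →ᵇ ℝ) (u : U) (p : ℝ × ℝ) :
    |∫ q in strip 0 T, duhamelFun β y v u p q|
      ≤ T ^ (1 - β) / (1 - β) * Real.pi * ‖y‖ * ‖v‖ := by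
  have := norm_integral_le_of_norm_le (f := duhamelFun β y v u p)
    (μ := volume.restrict (strip 0 T))
    ((integrableOn_duhamelWeight (T := T) hβ).mul_const (‖y‖ * ‖v‖))
    (by filter_upwards [ae_restrict_mem (isOpen_strip 0 T).measurableSet] with q hq
        exact abs_duhamelFun_le y v u p hq)
  rw [integral_mul_const, integral_duhamelWeight hβ hT] at this
  rw [Real.norm_eq_abs] at this
  linarith

theorem ae_strip_fst_ne (t : ℝ) : ∀ᵐ q : ℝ × ℝ ∂(volume.restrict (strip 0 T)), q.1 ≠ t := by
  apply ae_restrict_of_ae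
  have : (volume : Measure (ℝ × ℝ)) ({t} ×ˢ univ) = 0 := by
    rw [Measure.volume_eq_prod, Measure.prod_prod]; simp
  refine measure_mono_null (fun q hq => ?_) this
  simpa using hq

/-- Dominated convergence with the integrable weight. For fixed `q` the zero extension can only
break continuity at `p.1 = q.1`, and those `q` form a null set. -/
theorem continuousOn_integral_duhamelFun (hβ : β < 1) (y : ℝ × ℝ →ᵇ ℝ) (v : U × strip 0 T →ᵇ ℝ)
    (u : U) : ContinuousOn (fun p => ∫ q in strip 0 T, duhamelFun β y v u p q) (strip 0 T) := by
  intro p hp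
  refine ContinuousAt.continuousWithinAt ?_
  refine continuousAt_of_dominated (bound := fun q => duhamelWeight β q * (‖y‖ * ‖v‖))
    (Eventually.of_forall fun p => (measurable_duhamelFun y v u p).aestronglyMeasurable) ?_
    ((integrableOn_duhamelWeight hβ).mul_const _) ?_
  · refine Eventually.of_forall fun p => ?_
    filter_upwards [ae_restrict_mem (isOpen_strip 0 T).measurableSet] with q hq
    exact abs_duhamelFun_le y v u p hq
  · filter_upwards [ae_restrict_mem (isOpen_strip 0 T).measurableSet, ae_strip_fst_ne p.1]
      with q hq hne
    have hq' := mem_strip.1 hq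
    have hp' := mem_strip.1 hp
    unfold duhamelFun
    refine continuousAt_const.mul ?_
    have hc : Continuous fun p : ℝ × ℝ => (p.1 - q.1, p.2 - q.1 ^ β * q.2) := by fun_prop
    rcases lt_or_gt_of_ne hne with h | h
    · have hmem : (p.1 - q.1, p.2 - q.1 ^ β * q.2) ∈ strip 0 T :=
        mem_strip.2 ⟨by simp only; linarith, by simp only; linarith⟩
      exact ContinuousAt.comp (f := fun p : ℝ × ℝ => (p.1 - q.1, p.2 - q.1 ^ β * q.2)) (x := p)
        ((continuousOn_stripExt v u).continuousAt ((isOpen_strip 0 T).mem_nhds hmem))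
        hc.continuousAt
    · refine (continuousAt_const (y := (0 : ℝ))).congr ?_
      filter_upwards [(isOpen_lt continuous_fst continuous_const).mem_nhds h] with r hr
      rw [stripExt_of_notMem]
      intro hmem
      have h1 := (mem_strip.1 hmem).1
      have h2 : r.1 < q.1 := hr
      simp only at h1
      linarith

/-- The rescaled Duhamel operator
`(y, v) ↦ ((u, t, x) ↦ ∫₀ᵗ ∫ s^{-β} y(s, z) (1 + z²)⁻¹ v(u, t - s, x - s^β z) dz ds)`. -/
def duhamelOp (U : Type*) [TopologicalSpace U] [DiscreteTopology U] {T β : ℝ} (hβ : β < 1)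
    (hT : 0 ≤ T) :
    (ℝ × ℝ →ᵇ ℝ) →L[ℝ] (U × strip 0 T →ᵇ ℝ) →L[ℝ] (U × strip 0 T →ᵇ ℝ) :=
  LinearMap.mkContinuous₂
    (LinearMap.mk₂ ℝ
      (fun y v => BoundedContinuousFunction.ofNormedAddCommGroup
        (fun p : U × strip 0 T => ∫ q in strip 0 T, duhamelFun β y v p.1 p.2 q)
        -- Since `U` is discrete, continuity is needed only for each datum separately.
        (continuous_prod_of_discrete_left.2 fun u =>
          continuousOn_iff_continuous_domRestrict.1 (continuousOn_integral_duhamelFun hβ y v u))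
        (T ^ (1 - β) / (1 - β) * Real.pi * ‖y‖ * ‖v‖)
        (fun p => abs_integral_duhamelFun_le hβ hT y v p.1 p.2))
      (fun y₁ y₂ v => by
        ext p
        simp only [BoundedContinuousFunction.coe_ofNormedAddCommGroup,
          BoundedContinuousFunction.add_apply]
        rw [← integral_add (integrableOn_duhamelFun hβ _ _ _ _)
          (integrableOn_duhamelFun hβ _ _ _ _)]
        congr 1 with q
        simp only [duhamelFun, BoundedContinuousFunction.add_apply]
        ring)
      (fun a y v => by
        ext p
        simp only [BoundedContinuousFunction.coe_ofNormedAddCommGroup,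
          BoundedContinuousFunction.smul_apply, smul_eq_mul]
        rw [← integral_const_mul]
        congr 1 with q
        simp only [duhamelFun, BoundedContinuousFunction.smul_apply, smul_eq_mul]
        ring)
      (fun y v₁ v₂ => by
        ext p
        simp only [BoundedContinuousFunction.coe_ofNormedAddCommGroup,
          BoundedContinuousFunction.add_apply]
        rw [← integral_add (integrableOn_duhamelFun hβ _ _ _ _)
          (integrableOn_duhamelFun hβ _ _ _ _)]
        congr 1 with q
        simp only [duhamelFun, stripExt_add]
        ring)
      (fun a y v => by
        ext p
        simp only [BoundedContinuousFunction.coe_ofNormedAddCommGroup,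
          BoundedContinuousFunction.smul_apply, smul_eq_mul]
        rw [← integral_const_mul]
        congr 1 with q
        simp only [duhamelFun, stripExt_smul]
        ring))
    (T ^ (1 - β) / (1 - β) * Real.pi)
    (fun y v => by
      have h : 0 < 1 - β := by linarith
      exact BoundedContinuousFunction.norm_ofNormedAddCommGroup_le _ (by positivity)
        (fun p => abs_integral_duhamelFun_le hβ hT y v p.1 p.2))

variable [DiscreteTopology U]

theorem duhamelOp_apply (hβ : β < 1) (hT : 0 ≤ T) (y : ℝ × ℝ →ᵇ ℝ) (v : U × strip 0 T →ᵇ ℝ)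
    (p : U × strip 0 T) :
    duhamelOp U hβ hT y v p = ∫ q in strip 0 T, duhamelFun β y v p.1 p.2 q := rfl

theorem norm_duhamelOp_le (hβ : β < 1) (hT : 0 ≤ T) (y : ℝ × ℝ →ᵇ ℝ) :
    ‖duhamelOp U (T := T) hβ hT y‖ ≤ T ^ (1 - β) / (1 - β) * Real.pi * ‖y‖ := by
  have h : 0 < 1 - β := by linarith
  refine ContinuousLinearMap.opNorm_le_bound _ (by positivity) fun v => ?_
  exact BoundedContinuousFunction.norm_ofNormedAddCommGroup_le _ (by positivity)
    (fun p => abs_integral_duhamelFun_le hβ hT y v p.1 p.2)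

end Duhamel

/-! ### Evolution of the initial data in self-similar variables -/

section Free

variable {β T R : ℝ} {g : ℝ → ℝ}

/-- The integrand of the rescaled evolution of an initial datum. -/
def freeFun (β : ℝ) (y : ℝ × ℝ →ᵇ ℝ) (g : ℝ → ℝ) (p : ℝ × ℝ) (z : ℝ) : ℝ :=
  (1 + z ^ 2)⁻¹ * y (p.1, z) * g (p.2 - p.1 ^ β * z)

theorem measurable_freeFun (hg : Measurable g) (y : ℝ × ℝ →ᵇ ℝ) (p : ℝ × ℝ) :
    Measurable (freeFun β y g p) := by
  unfold freeFun
  have := y.continuous.measurable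
  fun_prop

theorem abs_freeFun_le (hgR : ∀ x, |g x| ≤ R) (y : ℝ × ℝ →ᵇ ℝ) (p : ℝ × ℝ) (z : ℝ) :
    |freeFun β y g p z| ≤ (1 + z ^ 2)⁻¹ * (‖y‖ * R) := by
  rw [freeFun, abs_mul, abs_mul, abs_of_nonneg (by positivity), mul_assoc]
  have h2 := y.norm_coe_le_norm (p.1, z)
  rw [Real.norm_eq_abs] at h2
  have := hgR (p.2 - p.1 ^ β * z)
  gcongr

theorem integrable_freeFun (hg : Measurable g) (hgR : ∀ x, |g x| ≤ R) (y : ℝ × ℝ →ᵇ ℝ)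
    (p : ℝ × ℝ) : Integrable (freeFun β y g p) :=
  (integrable_inv_one_add_sq.mul_const (‖y‖ * R)).mono'
    (measurable_freeFun hg y p).aestronglyMeasurable
    (Eventually.of_forall fun z => abs_freeFun_le hgR y p z)

theorem abs_integral_freeFun_le (hgR : ∀ x, |g x| ≤ R) (y : ℝ × ℝ →ᵇ ℝ) (p : ℝ × ℝ) :
    |∫ z, freeFun β y g p z| ≤ Real.pi * R * ‖y‖ := by
  have := norm_integral_le_of_norm_le (f := freeFun β y g p)
    (integrable_inv_one_add_sq.mul_const (‖y‖ * R))
    (Eventually.of_forall fun z => abs_freeFun_le hgR y p z)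
  rw [integral_mul_const, integral_univ_inv_one_add_sq, Real.norm_eq_abs] at this
  linarith

/-- The substitution `w = x - t^β z` moves the dependence on `(t, x)` from the datum, which is only
measurable, to the continuous kernel. -/
theorem integral_freeFun_eq {p : ℝ × ℝ} (hp : 0 < p.1) (y : ℝ × ℝ →ᵇ ℝ) :
    ∫ z, freeFun β y g p z = ∫ w, p.1 ^ (-β) * ((1 + ((p.2 - w) * p.1 ^ (-β)) ^ 2)⁻¹
      * y (p.1, (p.2 - w) * p.1 ^ (-β)) * g w) := by
  have ha : 0 < p.1 ^ β := Real.rpow_pos_of_pos hp β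
  have h := Measure.integral_comp_mul_left (fun w => (1 + (w * p.1 ^ (-β)) ^ 2)⁻¹
      * y (p.1, w * p.1 ^ (-β)) * g (p.2 - w)) (p.1 ^ β)
  rw [abs_of_pos (inv_pos.2 ha), smul_eq_mul, ← Real.rpow_neg hp.le] at h
  rw [integral_const_mul]
  have h2 := integral_sub_left_eq_self (fun w => (1 + (w * p.1 ^ (-β)) ^ 2)⁻¹
      * y (p.1, w * p.1 ^ (-β)) * g (p.2 - w)) volume p.2
  simp only [sub_sub_cancel] at h2
  rw [h2, ← h]
  congr 1 with z
  have e : p.1 ^ β * z * p.1 ^ (-β) = z := by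
    rw [Real.rpow_neg hp.le]; field_simp
  simp only [freeFun, e]

theorem continuousOn_integral_freeFun (hβ : 0 < β) (hT : T ≤ 1) (hg : Measurable g)
    (hgR : ∀ x, |g x| ≤ R) (y : ℝ × ℝ →ᵇ ℝ) :
    ContinuousOn (fun p => ∫ z, freeFun β y g p z) (strip 0 T) := by
  intro p₀ hp₀
  have hp₀' := mem_strip.1 hp₀
  have hR : 0 ≤ R := (abs_nonneg _).trans (hgR 0)
  refine ContinuousAt.continuousWithinAt ?_
  have key : ContinuousAt (fun p : ℝ × ℝ => ∫ w, p.1 ^ (-β) *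
      ((1 + ((p.2 - w) * p.1 ^ (-β)) ^ 2)⁻¹ * y (p.1, (p.2 - w) * p.1 ^ (-β)) * g w)) p₀ := by
    have hnhds : {p : ℝ × ℝ | p₀.1 / 2 < p.1 ∧ p.1 < 1 ∧ |p.2 - p₀.2| < 1} ∈ 𝓝 p₀ := by
      refine IsOpen.mem_nhds ?_ ⟨by linarith, by linarith, by simp⟩
      exact (isOpen_lt continuous_const continuous_fst).inter
        ((isOpen_lt continuous_fst continuous_const).inter
          (isOpen_lt (f := fun p : ℝ × ℝ => |p.2 - p₀.2|) (by fun_prop) continuous_const))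
    refine continuousAt_of_dominated
      (bound := fun w => (p₀.1 / 2) ^ (-β) * (4 * (1 + (w - p₀.2) ^ 2)⁻¹ * (‖y‖ * R))) ?_ ?_ ?_ ?_
    · refine Eventually.of_forall fun p => Measurable.aestronglyMeasurable ?_
      have := y.continuous.measurable
      fun_prop
    · filter_upwards [hnhds] with p hp
      refine Eventually.of_forall fun w => ?_
      obtain ⟨h1, h2, h3⟩ := hp
      have hp0 : 0 < p.1 := by linarith
      have hle : p.1 ^ (-β) ≤ (p₀.1 / 2) ^ (-β) :=
        Real.rpow_le_rpow_of_nonpos (by linarith) h1.le (by linarith)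
      -- As times are below `1`, the dilation by `t^{-β}` only improves the decay; this gives a
      -- dominating function that does not move with `p`.
      have hge : 1 ≤ p.1 ^ (-β) :=
        Real.one_le_rpow_of_pos_of_le_one_of_nonpos hp0 h2.le (by linarith)
      have hw : (1 + ((p.2 - w) * p.1 ^ (-β)) ^ 2)⁻¹ ≤ 4 * (1 + (w - p₀.2) ^ 2)⁻¹ := by
        calc (1 + ((p.2 - w) * p.1 ^ (-β)) ^ 2)⁻¹ ≤ (1 + (p.2 - w) ^ 2)⁻¹ := by
              gcongr (1 + ?_)⁻¹
              rw [mul_pow]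
              exact le_mul_of_one_le_right (sq_nonneg _) (one_le_pow₀ hge)
          _ = (1 + ((w - p₀.2) + (p₀.2 - p.2)) ^ 2)⁻¹ := by congr 2; ring
          _ ≤ 2 * (1 + (p₀.2 - p.2) ^ 2) * (1 + (w - p₀.2) ^ 2)⁻¹ := inv_one_add_sq_add_le _ _
          _ ≤ _ := by
              have : (p₀.2 - p.2) ^ 2 ≤ 1 := by
                rw [← sq_abs, abs_sub_comm]; exact pow_le_one₀ (abs_nonneg _) h3.le
              gcongr
              linarith
      have hy := y.norm_coe_le_norm (p.1, (p.2 - w) * p.1 ^ (-β))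
      rw [Real.norm_eq_abs] at hy
      rw [Real.norm_eq_abs, abs_mul, abs_mul, abs_mul, abs_of_nonneg (by positivity),
        abs_of_nonneg (inv_nonneg.2 (by positivity)), mul_assoc _ |y _|]
      have := hgR w
      have := Real.rpow_nonneg (show 0 ≤ p₀.1 / 2 by linarith) (-β)
      gcongr
    · exact (((integrable_inv_one_add_sq.comp_sub_right p₀.2).const_mul 4).mul_const _).const_mul _
    · refine Eventually.of_forall fun w => ?_
      have h1 : ContinuousAt (fun p : ℝ × ℝ => p.1 ^ (-β)) p₀ :=
        ContinuousAt.rpow_const continuousAt_fst (Or.inl hp₀'.1.ne')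
      have h2 : ContinuousAt (fun p : ℝ × ℝ => (p.2 - w) * p.1 ^ (-β)) p₀ :=
        (continuousAt_snd.sub continuousAt_const).mul h1
      have h3 : ContinuousAt (fun p : ℝ × ℝ => y (p.1, (p.2 - w) * p.1 ^ (-β))) p₀ :=
        y.continuous.continuousAt.comp (continuousAt_fst.prodMk h2)
      have h4 : ContinuousAt (fun p : ℝ × ℝ => (1 + ((p.2 - w) * p.1 ^ (-β)) ^ 2)⁻¹) p₀ :=
        ContinuousAt.inv₀ (continuousAt_const.add (h2.pow 2)) (by positivity)
      exact h1.mul ((h4.mul h3).mul continuousAt_const)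
  refine key.congr ?_
  filter_upwards [(isOpen_strip 0 T).mem_nhds hp₀] with p hp
  exact (integral_freeFun_eq (mem_strip.1 hp).1 y).symm

variable {U : Type*} [TopologicalSpace U] [DiscreteTopology U] {d : U → ℝ → ℝ}

/-- The rescaled evolution operator
`y ↦ ((u, t, x) ↦ ∫ y(t, z) (1 + z²)⁻¹ d_u(x - t^β z) dz)` of the data `d_u`. -/
def freeOp (hβ : 0 < β) (hT : T ≤ 1) (hd : ∀ u, Measurable (d u))
    (hdR : ∀ u x, |d u x| ≤ R) (hR : 0 ≤ R) : (ℝ × ℝ →ᵇ ℝ) →L[ℝ] (U × strip 0 T →ᵇ ℝ) :=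
  LinearMap.mkContinuous
    { toFun := fun y => BoundedContinuousFunction.ofNormedAddCommGroup
        (fun p : U × strip 0 T => ∫ z, freeFun β y (d p.1) p.2 z)
        (continuous_prod_of_discrete_left.2 fun u =>
          continuousOn_iff_continuous_domRestrict.1
            (continuousOn_integral_freeFun hβ hT (hd u) (hdR u) y))
        (Real.pi * R * ‖y‖) (fun p => abs_integral_freeFun_le (hdR p.1) y p.2)
      map_add' := fun y₁ y₂ => by
        ext p
        simp only [BoundedContinuousFunction.coe_ofNormedAddCommGroup,
          BoundedContinuousFunction.add_apply]
        rw [← integral_add (integrable_freeFun (hd _) (hdR _) _ _)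
          (integrable_freeFun (hd _) (hdR _) _ _)]
        congr 1 with q
        simp only [freeFun, BoundedContinuousFunction.add_apply]
        ring
      map_smul' := fun a y => by
        ext p
        simp only [BoundedContinuousFunction.coe_ofNormedAddCommGroup,
          BoundedContinuousFunction.smul_apply, smul_eq_mul, RingHom.id_apply]
        rw [← integral_const_mul]
        congr 1 with q
        simp only [freeFun, BoundedContinuousFunction.smul_apply, smul_eq_mul]
        ring }
    (Real.pi * R)
    (fun y => BoundedContinuousFunction.norm_ofNormedAddCommGroup_le _ (by positivity)
        (fun p => abs_integral_freeFun_le (hdR p.1) y p.2))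

theorem freeOp_apply (hβ : 0 < β) (hT : T ≤ 1) (hd : ∀ u, Measurable (d u))
    (hdR : ∀ u x, |d u x| ≤ R) (hR : 0 ≤ R) (y : ℝ × ℝ →ᵇ ℝ) (p : U × strip 0 T) :
    freeOp hβ hT hd hdR hR y p = ∫ z, freeFun β y (d p.1) p.2 z := rfl

theorem norm_freeOp_apply_le (hβ : 0 < β) (hT : T ≤ 1) (hd : ∀ u, Measurable (d u))
    (hdR : ∀ u x, |d u x| ≤ R) (hR : 0 ≤ R) (y : ℝ × ℝ →ᵇ ℝ) :
    ‖freeOp hβ hT hd hdR hR y‖ ≤ Real.pi * R * ‖y‖ :=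
  BoundedContinuousFunction.norm_ofNormedAddCommGroup_le _ (by positivity)
    (fun p => abs_integral_freeFun_le (hdR p.1) y p.2)

end Free

/-! ### Kernel profiles depending on dilation and shear parameters -/

/-- The bounded continuous function given by `f`, or zero if `f` is not bounded and continuous. -/
def bcfOf {Z : Type*} [TopologicalSpace Z] (f : Z → ℝ) : Z →ᵇ ℝ :=
  open Classical in
  if h : Continuous f ∧ ∃ C, ∀ z, ‖f z‖ ≤ C then
    BoundedContinuousFunction.ofNormedAddCommGroup f h.1 h.2.choose h.2.choose_spec else 0

theorem bcfOf_apply {Z : Type*} [TopologicalSpace Z] {f : Z → ℝ} (hf : Continuous f) {C : ℝ}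
    (hC : ∀ z, |f z| ≤ C) (z : Z) : bcfOf f z = f z := by
  have h : Continuous f ∧ ∃ C, ∀ z, ‖f z‖ ≤ C := ⟨hf, C, hC⟩
  rw [bcfOf, dif_pos h]
  rfl

theorem norm_bcfOf_le {Z : Type*} [TopologicalSpace Z] {f : Z → ℝ} (hf : Continuous f) {C : ℝ}
    (hC0 : 0 ≤ C) (hC : ∀ z, |f z| ≤ C) : ‖bcfOf f‖ ≤ C :=
  (BoundedContinuousFunction.norm_le hC0).2 fun z => by
    rw [bcfOf_apply hf hC, Real.norm_eq_abs]; exact hC z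

/-- The power `s^{1-β}`, frozen outside of `[0, 1]`. -/
def clampPow (β s : ℝ) : ℝ := (max 0 (min s 1)) ^ (1 - β)

theorem continuous_clampPow {β : ℝ} (hβ : β < 1) : Continuous (clampPow β) :=
  (Real.continuous_rpow_const (by linarith)).comp (by fun_prop)

theorem clampPow_nonneg (β s : ℝ) : 0 ≤ clampPow β s := Real.rpow_nonneg (le_max_left _ _) _

theorem clampPow_le_one {β : ℝ} (hβ : β < 1) (s : ℝ) : clampPow β s ≤ 1 :=
  Real.rpow_le_one (le_max_left _ _) (by simp) (by linarith)

theorem clampPow_eq {β s : ℝ} (h0 : 0 ≤ s) (h1 : s ≤ 1) : clampPow β s = s ^ (1 - β) := by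
  simp [clampPow, h0, h1]

section ParamKernel

variable {γ : ℝ} {c : ℂ} {β : ℝ}

/-- The function `(s, z) ↦ (1 + z²) θ(s)^n G_{j,m}(λ, z + μ θ(s))` with `θ(s) = s^{1-β}` and
`G_{j,m}` the kernel `symbolKernel`, at the parameter `(λ, μ)`. -/
def paramKernelFun (γ : ℝ) (c : ℂ) (β : ℝ) (i : ℕ × ℕ × ℕ) (p q : ℝ × ℝ) : ℝ :=
  (1 + q.2 ^ 2) * clampPow β q.1 ^ i.2.2
    * symbolKernel γ c i.1 i.2.1 p.1 (q.2 + p.2 * clampPow β q.1)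

/-- `paramKernelFun` as a bounded continuous function. -/
def paramKernel (γ : ℝ) (c : ℂ) (β : ℝ) (i : ℕ × ℕ × ℕ) (p : ℝ × ℝ) : ℝ × ℝ →ᵇ ℝ :=
  bcfOf (paramKernelFun γ c β i p)

/-- The parameters at which the rescaled kernels are controlled. -/
def paramBall : Set (ℝ × ℝ) := Metric.ball (1, 0) (1 / 2)

theorem mem_paramBall {p : ℝ × ℝ} (hp : p ∈ paramBall) :
    p.1 ∈ Icc (1 / 2 : ℝ) 2 ∧ |p.2| ≤ 1 := by
  rw [paramBall, Metric.mem_ball, Prod.dist_eq, max_lt_iff, Real.dist_eq, Real.dist_eq] at hp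
  obtain ⟨h1, h2⟩ := hp
  rw [abs_lt] at h1
  simp only [sub_zero] at h1 h2
  exact ⟨⟨by linarith, by linarith⟩, by linarith⟩

variable (hγ : 1 < γ) (hc : c.re < 0) (hβ : β < 1)
include hγ hc hβ

theorem continuous_paramKernelFun (i : ℕ × ℕ × ℕ) {p : ℝ × ℝ} (hp : p ∈ paramBall) :
    Continuous (paramKernelFun γ c β i p) := by
  have hp0 : 0 < p.1 := by linarith [(mem_paramBall hp).1.1]
  have h1 := continuous_clampPow hβ
  have h2 : Continuous (symbolKernel γ c i.1 i.2.1 p.1) := continuous_iff_continuousAt.2 fun x =>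
    (hasDerivAt_symbolKernel hγ hc hp0 x).continuousAt
  unfold paramKernelFun
  fun_prop

/-- The shift `μθ(s)` has absolute value at most `1`, so it changes the weight `1 + z²` by a factor
of at most `4`. -/
theorem exists_paramKernelFun_le (i : ℕ × ℕ × ℕ) :
    ∃ C, 0 ≤ C ∧ ∀ p ∈ paramBall, ∀ q, |paramKernelFun γ c β i p q| ≤ C := by
  obtain ⟨C, hC0, hC⟩ := exists_symbolKernel_le hγ hc i.1 i.2.1
  refine ⟨4 * C, by positivity, fun p hp q => ?_⟩
  obtain ⟨h1, h2⟩ := mem_paramBall hp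
  set h := p.2 * clampPow β q.1 with hh
  have hb0 := clampPow_nonneg β q.1
  have hb1 := clampPow_le_one hβ q.1
  have habs : |h| ≤ 1 := by
    rw [hh, abs_mul, abs_of_nonneg hb0]
    exact mul_le_one₀ h2 hb0 hb1
  have hsq : h ^ 2 ≤ 1 := by rw [← sq_abs]; exact pow_le_one₀ (abs_nonneg _) habs
  have key := hC p.1 h1 (q.2 + h)
  have hpow : clampPow β q.1 ^ i.2.2 ≤ 1 := pow_le_one₀ hb0 hb1
  have hw : 1 + q.2 ^ 2 ≤ 4 * (1 + (q.2 + h) ^ 2) := by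
    have := one_add_sq_add_le (q.2 + h) (-h)
    rw [add_neg_cancel_right, neg_sq] at this
    nlinarith [sq_nonneg (q.2 + h)]
  have hk := abs_nonneg (symbolKernel γ c i.1 i.2.1 p.1 (q.2 + h))
  rw [paramKernelFun, abs_mul, abs_mul, abs_of_nonneg (by positivity), abs_of_nonneg (by positivity)]
  calc (1 + q.2 ^ 2) * clampPow β q.1 ^ i.2.2 * |symbolKernel γ c i.1 i.2.1 p.1 (q.2 + h)|
      ≤ 4 * (1 + (q.2 + h) ^ 2) * 1 * |symbolKernel γ c i.1 i.2.1 p.1 (q.2 + h)| := by gcongr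
    _ ≤ 4 * C := by linarith

theorem paramKernel_apply (i : ℕ × ℕ × ℕ) {p : ℝ × ℝ} (hp : p ∈ paramBall) (q : ℝ × ℝ) :
    paramKernel γ c β i p q = paramKernelFun γ c β i p q := by
  obtain ⟨C, -, hC⟩ := exists_paramKernelFun_le hγ hc hβ i
  exact bcfOf_apply (continuous_paramKernelFun hγ hc hβ i hp) (hC p hp) q

/-- The family is closed under both parameter derivatives: `∂_λ` raises `j`, while `∂_μ` raises `m`
and contributes a factor `θ(s) = s^{1-β}`. This is why the index records the power of `θ`. -/
theorem contDiffOn_paramKernel (i : ℕ × ℕ × ℕ) :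
    ContDiffOn ℝ ∞ (paramKernel γ c β i) paramBall := by
  have hopen : IsOpen paramBall := Metric.isOpen_ball
  refine contDiffOn_boundedContinuousFunction_of_family
    (d₁ := fun i => (i.1 + 1, i.2.1, i.2.2)) (d₂ := fun i => (i.1, i.2.1 + 1, i.2.2 + 1))
    hopen (convex_ball _ _) (fun i => ?_) (fun i p hp q => ?_) i
  · obtain ⟨C, hC0, hC⟩ := exists_paramKernelFun_le hγ hc hβ i
    exact ⟨C, fun p hp => norm_bcfOf_le (continuous_paramKernelFun hγ hc hβ i hp) hC0 (hC p hp)⟩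
  · rw [paramKernel_apply hγ hc hβ _ hp, paramKernel_apply hγ hc hβ _ hp]
    have hp0 : 0 < p.1 := by linarith [(mem_paramBall hp).1.1]
    have h := hasFDerivAt_symbolKernel hγ hc (j := i.1) (m := i.2.1)
      (p := (p.1, q.2 + p.2 * clampPow β q.1)) hp0
    have hin : HasFDerivAt (fun p : ℝ × ℝ => (p.1, q.2 + p.2 * clampPow β q.1))
        ((ContinuousLinearMap.fst ℝ ℝ ℝ).prod (clampPow β q.1 • ContinuousLinearMap.snd ℝ ℝ ℝ))
        p :=
      hasFDerivAt_fst.prodMk ((hasFDerivAt_snd.mul_const _).const_add _)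
    have h2 := (h.comp p hin).const_mul ((1 + q.2 ^ 2) * clampPow β q.1 ^ i.2.2)
    have h3 : HasFDerivAt (fun p => paramKernelFun γ c β i p q)
        (paramKernelFun γ c β (i.1 + 1, i.2.1, i.2.2) p q • ContinuousLinearMap.fst ℝ ℝ ℝ
        + paramKernelFun γ c β (i.1, i.2.1 + 1, i.2.2 + 1) p q
          • ContinuousLinearMap.snd ℝ ℝ ℝ) p := by
      refine h2.congr_fderiv ?_
      ext
      · simp [paramKernelFun]
      · simp [paramKernelFun, pow_succ]
        ring
    refine h3.congr_of_eventuallyEq ?_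
    filter_upwards [hopen.mem_nhds hp] with r hr
    exact paramKernel_apply hγ hc hβ _ hr q

end ParamKernel

/-! ### Fixed points: smooth dependence, uniqueness, existence -/

/-- Smooth dependence of a locally unique fixed point on a parameter. -/
theorem contDiffAt_of_fixedPoint {E X : Type*} [NormedAddCommGroup E] [NormedSpace ℝ E]
    [CompleteSpace E] [NormedAddCommGroup X] [NormedSpace ℝ X] [CompleteSpace X]
    {a : E → X} {b : E → X →L[ℝ] X} {N : X → X} {p₀ : E} {w : E → X}
    (ha : ContDiffAt ℝ ∞ a p₀) (hb : ContDiffAt ℝ ∞ b p₀) (hN : ContDiff ℝ ∞ N)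
    (hsmall : ‖(b p₀).comp (fderiv ℝ N (w p₀))‖ < 1)
    (hfix : ∀ᶠ p in 𝓝 p₀, w p = a p - b p (N (w p)))
    (huniq : ∀ᶠ p in 𝓝 p₀, ∀ v, v = a p - b p (N v) → v = w p) : ContDiffAt ℝ ∞ w p₀ := by
  set g : E × X → X := fun q => q.2 - a q.1 + b q.1 (N q.2) with hg
  have hgc : ContDiffAt ℝ ∞ g (p₀, w p₀) := by
    have h1 : ContDiffAt ℝ ∞ (fun q : E × X => a q.1) (p₀, w p₀) :=
      ContDiffAt.comp (p₀, w p₀) ha contDiffAt_fst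
    have h2 : ContDiffAt ℝ ∞ (fun q : E × X => b q.1) (p₀, w p₀) :=
      ContDiffAt.comp (p₀, w p₀) hb contDiffAt_fst
    have h3 : ContDiffAt ℝ ∞ (fun q : E × X => N q.2) (p₀, w p₀) :=
      hN.contDiffAt.comp (p₀, w p₀) contDiffAt_snd
    exact (contDiffAt_snd.sub h1).add (h2.clm_apply h3)
  have hpart : fderiv ℝ g (p₀, w p₀) ∘L .inr ℝ E X
      = 1 + (b p₀).comp (fderiv ℝ N (w p₀)) := by
    have h1 : HasFDerivAt (fun x => g (p₀, x)) (fderiv ℝ g (p₀, w p₀) ∘L .inr ℝ E X) (w p₀) :=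
      (hgc.differentiableAt (by simp)).hasFDerivAt.comp (w p₀) (hasFDerivAt_prodMk_right p₀ (w p₀))
    have h2 : HasFDerivAt (fun x => g (p₀, x))
        (1 + (b p₀).comp (fderiv ℝ N (w p₀))) (w p₀) := by
      have := ((hasFDerivAt_id (w p₀)).sub_const (a p₀)).add
        ((b p₀).hasFDerivAt.comp (w p₀) (hN.differentiable (by simp) (w p₀)).hasFDerivAt)
      exact this
    exact h1.unique h2
  -- The partial derivative in `X` is a perturbation of the identity of norm less than `1`, hence
  -- invertible by a Neumann series.
  have hinv : (fderiv ℝ g (p₀, w p₀) ∘L .inr ℝ E X).IsInvertible := by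
    rw [hpart]
    have hu : IsUnit (1 + (b p₀).comp (fderiv ℝ N (w p₀))) := by
      have := (Units.oneSub (-((b p₀).comp (fderiv ℝ N (w p₀)))) (by rwa [norm_neg])).isUnit
      rwa [Units.val_oneSub, sub_neg_eq_add] at this
    obtain ⟨e, he⟩ := hu
    exact ⟨ContinuousLinearEquiv.ofUnit e, by rw [← he]; rfl⟩
  have hne : (∞ : WithTop ℕ∞) ≠ 0 := by simp
  have hφ := hgc.contDiffAt_implicitFunction hne hinv
  have hev := hgc.eventually_apply_implicitFunction hne hinv
  have hg0 : g (p₀, w p₀) = 0 := by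
    have := hfix.self_of_nhds
    simp only [hg]
    nth_rw 1 [this]
    abel
  refine hφ.congr_of_eventuallyEq ?_
  -- Uniqueness holds among all `v`, not only those near `w p₀`, so the implicit function coincides
  -- with `w` although `w` is not assumed continuous.
  filter_upwards [hev, huniq] with p hp hu
  rw [hg0] at hp
  refine (hu _ ?_).symm
  simp only [hg] at hp
  rw [← sub_eq_zero, ← hp]
  abel

section FixedPoint

variable {U : Type*} [TopologicalSpace U] [DiscreteTopology U] {T β : ℝ}

/-- In a sup norm weighted by `e^{-nt}` the Duhamel operator becomes as small as desired for large
`n`, without shrinking `T`. -/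
theorem tendsto_integral_duhamelWeight_mul_exp (hβ : β < 1) :
    Tendsto (fun n : ℕ => ∫ q in strip 0 T, duhamelWeight β q * Real.exp (-(n * q.1))) atTop
      (𝓝 0) := by
  have := tendsto_integral_of_dominated_convergence (μ := volume.restrict (strip 0 T))
    (F := fun (n : ℕ) q => duhamelWeight β q * Real.exp (-(n * q.1))) (f := fun _ => (0 : ℝ))
    (duhamelWeight β) (fun n => ?_) (integrableOn_duhamelWeight hβ) (fun n => ?_) ?_
  · simpa using this
  · have := measurable_duhamelWeight (β := β)
    exact Measurable.aestronglyMeasurable (by fun_prop)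
  · filter_upwards [ae_restrict_mem (isOpen_strip 0 T).measurableSet] with q hq
    have h := duhamelWeight_nonneg (β := β) le_rfl hq
    rw [Real.norm_eq_abs, abs_mul, abs_of_nonneg h, Real.abs_exp]
    refine mul_le_of_le_one_right h (Real.exp_le_one_iff.2 ?_)
    have := (mem_strip.1 hq).1
    have : (0 : ℝ) ≤ n * q.1 := by positivity
    linarith
  · filter_upwards [ae_restrict_mem (isOpen_strip 0 T).measurableSet] with q hq
    have h1 : Tendsto (fun n : ℕ => Real.exp (-(n * q.1))) atTop (𝓝 0) :=
      Real.tendsto_exp_neg_atTop_nhds_zero.comp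
        (tendsto_natCast_atTop_atTop.atTop_mul_const (mem_strip.1 hq).1)
    simpa using h1.const_mul (duhamelWeight β q)

theorem exists_lipschitz_of_contDiff {f : ℝ → ℝ} (hf : ContDiff ℝ ∞ f) (M : ℝ) :
    ∃ L, 0 ≤ L ∧ (∀ r, |r| ≤ M → |deriv f r| ≤ L) ∧
      ∀ a b, |a| ≤ M → |b| ≤ M → |f b - f a| ≤ L * |b - a| := by
  obtain ⟨L, hL, h⟩ := exists_abs_le_of_continuous (contDiff_infty_iff_deriv.1 hf).2.continuous M
  refine ⟨L, hL, h, fun a b ha hb => ?_⟩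
  exact (convex_Icc (-M) M).norm_image_sub_le_of_norm_hasDerivWithin_le
      (fun z _ => (hf.differentiable (by simp) z).hasDerivAt.hasDerivWithinAt)
      (fun z hz => h z (abs_le.2 hz)) (abs_le.1 ha) (abs_le.1 hb)

/-- Uniqueness of bounded continuous solutions of the Duhamel equation. -/
theorem duhamel_fixedPoint_unique (hβ : β < 1) (hT : 0 ≤ T) {f : ℝ → ℝ} (hf : ContDiff ℝ ∞ f)
    {a v w : U × strip 0 T →ᵇ ℝ} {y : ℝ × ℝ →ᵇ ℝ}
    (hv : v = a - duhamelOp U hβ hT y (nemytskii f hf.continuous v))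
    (hw : w = a - duhamelOp U hβ hT y (nemytskii f hf.continuous w)) : v = w := by
  obtain ⟨L, hL, -, hlip⟩ := exists_lipschitz_of_contDiff hf (max ‖v‖ ‖w‖)
  obtain ⟨n, hn⟩ : ∃ n : ℕ, (∫ q in strip 0 T, duhamelWeight β q * Real.exp (-(n * q.1)))
      * (‖y‖ * L) ≤ 1 / 2 := by
    have h := (tendsto_integral_duhamelWeight_mul_exp (T := T) hβ).mul_const (‖y‖ * L)
    rw [zero_mul] at h
    exact (h.eventually (ge_mem_nhds (by norm_num : (0 : ℝ) < 1 / 2))).exists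
  -- A bound `D e^{nt}` on the difference improves to half of itself: at time `t - s` it reads `D
  -- e^{nt} e^{-ns}`, and the choice of `n` absorbs the integral of the factor `e^{-ns}` against the
  -- weight.
  have step : ∀ D : ℝ, 0 ≤ D →
      (∀ p : U × strip 0 T, |v p - w p| ≤ D * Real.exp (n * p.2.1.1)) →
      ∀ p : U × strip 0 T, |v p - w p| ≤ D / 2 * Real.exp (n * p.2.1.1) := by
    intro D hD h p
    have hext : ∀ q : ℝ × ℝ, |stripExt (nemytskii f hf.continuous v) p.1 q
        - stripExt (nemytskii f hf.continuous w) p.1 q| ≤ L * (D * Real.exp (n * q.1)) := by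
      intro q
      by_cases hq : q ∈ strip 0 T
      · rw [stripExt_of_mem _ _ hq, stripExt_of_mem _ _ hq]
        refine (hlip _ _ ?_ ?_).trans ?_
        · exact (w.norm_coe_le_norm _).trans (le_max_right _ _)
        · exact (v.norm_coe_le_norm _).trans (le_max_left _ _)
        · have := h (p.1, ⟨q, hq⟩)
          gcongr
      · rw [stripExt_of_notMem _ _ hq, stripExt_of_notMem _ _ hq, sub_zero, abs_zero]
        positivity
    have e : w p - v p = ∫ q in strip 0 T,
        (duhamelFun β y (nemytskii f hf.continuous v) p.1 p.2 q
          - duhamelFun β y (nemytskii f hf.continuous w) p.1 p.2 q) := by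
      rw [integral_sub (integrableOn_duhamelFun hβ _ _ _ _)
        (integrableOn_duhamelFun hβ _ _ _ _), ← duhamelOp_apply hβ hT, ← duhamelOp_apply hβ hT]
      have h1 := congrArg (fun x : U × strip 0 T →ᵇ ℝ => x p) hv
      have h2 := congrArg (fun x : U × strip 0 T →ᵇ ℝ => x p) hw
      simp only [BoundedContinuousFunction.sub_apply] at h1 h2
      rw [h1, h2]
      ring
    rw [abs_sub_comm, e]
    have hint : IntegrableOn (fun q : ℝ × ℝ => duhamelWeight β q * Real.exp (-(n * q.1)))
        (strip 0 T) := by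
      refine (integrableOn_duhamelWeight (T := T) hβ).mono' ?_ ?_
      · have := measurable_duhamelWeight (β := β)
        exact Measurable.aestronglyMeasurable (by fun_prop)
      · filter_upwards [ae_restrict_mem (isOpen_strip 0 T).measurableSet] with q hq
        have h := duhamelWeight_nonneg (β := β) le_rfl hq
        rw [Real.norm_eq_abs, abs_mul, abs_of_nonneg h, Real.abs_exp]
        refine mul_le_of_le_one_right h (Real.exp_le_one_iff.2 ?_)
        have := (mem_strip.1 hq).1
        have : (0 : ℝ) ≤ n * q.1 := by positivity
        linarith
    have hbound := norm_integral_le_of_norm_le (μ := volume.restrict (strip 0 T))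
      (f := fun q => duhamelFun β y (nemytskii f hf.continuous v) p.1 p.2 q
          - duhamelFun β y (nemytskii f hf.continuous w) p.1 p.2 q)
      (hint.mul_const (‖y‖ * L * D * Real.exp (n * p.2.1.1))) ?_
    · rw [Real.norm_eq_abs, integral_mul_const] at hbound
      refine hbound.trans ?_
      have : 0 ≤ D * Real.exp (n * p.2.1.1) := by positivity
      nlinarith
    · filter_upwards [ae_restrict_mem (isOpen_strip 0 T).measurableSet] with q hq
      have h0 := duhamelWeight_nonneg (β := β) le_rfl hq
      have h1 := hext (p.2.1.1 - q.1, p.2.1.2 - q.1 ^ β * q.2)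
      have h2 := y.norm_coe_le_norm q
      rw [Real.norm_eq_abs] at h2
      have h3 : Real.exp (n * (p.2.1.1 - q.1)) = Real.exp (-(n * q.1)) * Real.exp (n * p.2.1.1) := by
        rw [← Real.exp_add]; ring_nf
      rw [duhamelFun, duhamelFun, ← mul_sub, Real.norm_eq_abs, abs_mul, abs_mul, abs_of_nonneg h0]
      calc _ ≤ duhamelWeight β q * ‖y‖ * (L * (D * Real.exp (n * (p.2.1.1 - q.1)))) := by gcongr
        _ = _ := by rw [h3]; ring
  have iter : ∀ k : ℕ, ∀ p : U × strip 0 T,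
      |v p - w p| ≤ ‖v - w‖ / 2 ^ k * Real.exp (n * p.2.1.1) := by
    intro k
    induction k with
    | zero =>
      intro p
      have h1 := (v - w).norm_coe_le_norm p
      rw [BoundedContinuousFunction.sub_apply, Real.norm_eq_abs] at h1
      have hp := (mem_strip.1 p.2.2).1
      have h2 : 1 ≤ Real.exp (n * p.2.1.1) := Real.one_le_exp (by positivity)
      rw [pow_zero, div_one]
      exact h1.trans (le_mul_of_one_le_right (norm_nonneg _) h2)
    | succ k ih =>
      intro p
      have := step _ (by positivity) ih p
      rwa [div_div, ← pow_succ] at this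
  ext p
  have hlim : Tendsto (fun k : ℕ => ‖v - w‖ / 2 ^ k * Real.exp (n * p.2.1.1)) atTop (𝓝 0) := by
    have h1 : Tendsto (fun k : ℕ => ((2 : ℝ) ^ k)⁻¹) atTop (𝓝 0) :=
      (tendsto_pow_atTop_atTop_of_one_lt one_lt_two).inv_tendsto_atTop
    simpa [div_eq_mul_inv] using (h1.const_mul ‖v - w‖).mul_const (Real.exp (n * p.2.1.1))
  have h0 : |v p - w p| ≤ 0 := ge_of_tendsto' hlim fun k => iter k p
  exact sub_eq_zero.1 (abs_nonpos_iff.1 h0)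

/-- Existence of a bounded continuous solution of the Duhamel equation for small times. -/
theorem exists_duhamel_fixedPoint {X : Type*} [TopologicalSpace X] {f : ℝ → ℝ} (hf : Continuous f)
    {a : X →ᵇ ℝ} {B : (X →ᵇ ℝ) →L[ℝ] (X →ᵇ ℝ)} {R M L : ℝ} (hR : 0 ≤ R) (hL : 0 ≤ L)
    (hM : ∀ r, |r| ≤ R → |f r| ≤ M)
    (hlip : ∀ r s, |r| ≤ R → |s| ≤ R → |f s - f r| ≤ L * |s - r|)
    (h1 : ‖a‖ + ‖B‖ * M ≤ R) (h2 : ‖B‖ * L ≤ 1 / 2) :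
    ∃ v : X →ᵇ ℝ, ‖v‖ ≤ R ∧ v = a - B (nemytskii f hf v) := by
  have hM0 : 0 ≤ M := (abs_nonneg _).trans (hM 0 (by simpa using hR))
  -- Clamping the argument of `f` to `[-R, R]` gives a nonlinearity that is bounded and Lipschitz
  -- everywhere, so the contraction acts on the whole space.
  set κ : ℝ → ℝ := fun r => max (min r R) (-R) with hκ
  have hκc : Continuous κ := by fun_prop
  have hκR : ∀ r, |κ r| ≤ R := fun r =>
    abs_le.2 ⟨le_max_right _ _, max_le (min_le_right _ _) (by linarith)⟩
  have hκl : ∀ r s, |κ s - κ r| ≤ |s - r| := fun r s =>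
    (abs_max_sub_max_le_abs _ _ _).trans
      ((abs_min_sub_min_le_max s R r R).trans (by simp))
  set Φ : (X →ᵇ ℝ) → (X →ᵇ ℝ) := fun v => a - B (nemytskii (f ∘ κ) (hf.comp hκc) v) with hΦ
  have hcon : ContractingWith (1 / 2) Φ := by
    refine ⟨by norm_num, LipschitzWith.of_dist_le_mul fun v w => ?_⟩
    have hn : ‖nemytskii (f ∘ κ) (hf.comp hκc) w - nemytskii (f ∘ κ) (hf.comp hκc) v‖
        ≤ L * ‖v - w‖ := by
      refine (BoundedContinuousFunction.norm_le (by positivity)).2 fun p => ?_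
      have h3 := (w - v).norm_coe_le_norm p
      rw [BoundedContinuousFunction.sub_apply, Real.norm_eq_abs] at h3
      rw [norm_sub_rev v w]
      exact (hlip _ _ (hκR _) (hκR _)).trans (by gcongr; exact (hκl _ _).trans h3)
    rw [dist_eq_norm, dist_eq_norm]
    have : Φ v - Φ w = B (nemytskii (f ∘ κ) (hf.comp hκc) w
        - nemytskii (f ∘ κ) (hf.comp hκc) v) := by
      simp only [hΦ, map_sub]; abel
    rw [this]
    calc _ ≤ ‖B‖ * (L * ‖v - w‖) := (B.le_opNorm _).trans (by gcongr)
      _ = ‖B‖ * L * ‖v - w‖ := by ring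
      _ ≤ 1 / 2 * ‖v - w‖ := by gcongr
      _ = _ := by simp
  have hfix := hcon.fixedPoint_isFixedPt
  set v := ContractingWith.fixedPoint Φ hcon
  have hv : v = a - B (nemytskii (f ∘ κ) (hf.comp hκc) v) := hfix.symm
  have hvR : ‖v‖ ≤ R := by
    rw [hv]
    refine (norm_sub_le _ _).trans (le_trans ?_ h1)
    have : ‖nemytskii (f ∘ κ) (hf.comp hκc) v‖ ≤ M :=
      (BoundedContinuousFunction.norm_le hM0).2 fun p => hM _ (hκR _)
    exact add_le_add le_rfl ((B.le_opNorm _).trans (by gcongr))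
  refine ⟨v, hvR, ?_⟩
  -- The fixed point takes values in `[-R, R]`, where the clamping is inactive.
  have : nemytskii (f ∘ κ) (hf.comp hκc) v = nemytskii f hf v := by
    ext p
    have hp := abs_le.1 ((v.norm_coe_le_norm p).trans hvR)
    simp [hκ, hp.1, hp.2]
  rwa [this] at hv

end FixedPoint

/-! ### Return to the original variables -/

theorem convR_apply (g h : ℝ → ℝ) (x : ℝ) : convR g h x = ∫ y, g y * h (x - y) := rfl

section Physical

variable {γ : ℝ} {c : ℂ} (hγ : 1 < γ)
include hγ

theorem inv_gamma_pos : 0 < γ⁻¹ := inv_pos.2 (by linarith)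

theorem inv_gamma_lt_one : γ⁻¹ < 1 := inv_lt_one_of_one_lt₀ hγ

/-- The substitution `w = s^{1/γ}(z + h)` combined with the homogeneity of the kernel. -/
theorem integral_symbolKernel_scale {m : ℕ} {l s : ℝ} (hs : 0 < s) (h x : ℝ) (V : ℝ → ℝ) :
    ∫ z, symbolKernel γ c 0 m l (z + h) * V (x - s ^ γ⁻¹ * z)
      = (s ^ γ⁻¹) ^ m * ∫ w, symbolKernel γ c 0 m (l * s) w * V (x + s ^ γ⁻¹ * h - w) := by
  set r := s ^ γ⁻¹ with hr
  have hr0 : 0 < r := Real.rpow_pos_of_pos hs _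
  have hrγ : r ^ γ = s := by
    rw [hr, ← Real.rpow_mul hs.le, inv_mul_cancel₀ (by linarith), Real.rpow_one]
  have h1 := Measure.integral_comp_mul_left
    (fun w => symbolKernel γ c 0 m (l * s) w * V (x + r * h - w)) r
  rw [abs_of_pos (inv_pos.2 hr0), smul_eq_mul] at h1
  have h2 := integral_add_right_eq_self (μ := volume)
    (fun z => symbolKernel γ c 0 m (l * s) (r * z) * V (x + r * h - r * z)) h
  have h3 : ∀ z, symbolKernel γ c 0 m (l * s) (r * z)
      = (r ^ m)⁻¹ * r⁻¹ * symbolKernel γ c 0 m l z := by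
    intro z
    rw [mul_comm l s, ← hrγ, symbolKernel_scale hr0]
    congr 1
    rw [Nat.cast_zero, mul_zero, zero_add, Real.rpow_neg hr0.le, Real.rpow_add hr0,
      Real.rpow_natCast, Real.rpow_one, mul_inv]
  rw [← h2] at h1
  have h4 : ∫ w, symbolKernel γ c 0 m (l * s) w * V (x + r * h - w)
      = r * ∫ z, symbolKernel γ c 0 m (l * s) (r * (z + h)) * V (x + r * h - r * (z + h)) := by
    rw [h1, mul_inv_cancel_left₀ hr0.ne']
  rw [h4, ← mul_assoc, ← integral_const_mul]
  congr 1 with z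
  rw [h3]
  have e : x + r * h - r * (z + h) = x - r * z := by ring
  rw [e]
  field_simp

variable (hc : c.re < 0)
include hc

/-- The rescaled evolution operator at the parameter `(λ, μ)` in the original variables. -/
theorem integral_freeFun_paramKernel {p : ℝ × ℝ} (hp : p ∈ paramBall) {q : ℝ × ℝ} (hq0 : 0 < q.1)
    (hq1 : q.1 ≤ 1) (g : ℝ → ℝ) :
    ∫ z, freeFun γ⁻¹ (paramKernel γ c γ⁻¹ (0, 0, 0) p) g q z
      = convR (symbolKernel γ c 0 0 (p.1 * q.1)) g (q.2 + p.2 * q.1) := by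
  have h := integral_symbolKernel_scale (c := c) hγ (m := 0) (l := p.1) hq0
    (p.2 * clampPow γ⁻¹ q.1) q.2 g
  -- The factors `t^{1/γ}` and `t^{1 - 1/γ}` multiply to `t`: the self-similar shift `μθ(t)` is the
  -- translation by `μt`.
  have e : q.1 ^ γ⁻¹ * (p.2 * clampPow γ⁻¹ q.1) = p.2 * q.1 := by
    rw [clampPow_eq hq0.le hq1, mul_left_comm, ← Real.rpow_add hq0]
    simp
  rw [pow_zero, one_mul, e] at h
  rw [convR_apply, ← h]
  congr 1 with z
  have hz : (1 + z ^ 2) ≠ 0 := by positivity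
  rw [freeFun, paramKernel_apply hγ hc (inv_gamma_lt_one hγ) _ hp, paramKernelFun]
  simp only [pow_zero, mul_one]
  field_simp

/-- The rescaled Duhamel operator at the parameter `(λ, μ)` in the original variables. -/
theorem integral_duhamelFun_paramKernel {U : Type*} [TopologicalSpace U] {T : ℝ} (hT : T ≤ 1)
    {p : ℝ × ℝ} (hp : p ∈ paramBall) {q : ℝ × ℝ} (hq : q ∈ strip 0 T)
    (v : U × strip 0 T →ᵇ ℝ) (u : U) :
    ∫ r in strip 0 T, duhamelFun γ⁻¹ (p.1 • paramKernel γ c γ⁻¹ (0, 1, 0) p) v u q r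
      = ∫ s in (0 : ℝ)..q.1, p.1 * convR (symbolKernel γ c 0 1 (p.1 * s))
          (fun x => stripExt v u (q.1 - s, x)) (q.2 + p.2 * s) := by
  have hβ := inv_gamma_lt_one hγ
  have hint := integrableOn_duhamelFun hβ (p.1 • paramKernel γ c γ⁻¹ (0, 1, 0) p) v u q
  obtain ⟨hq0, hqT⟩ := mem_strip.1 hq
  rw [IntegrableOn, volume_restrict_strip] at hint
  -- The zero extension of `v` vanishes at nonpositive times, which cuts the time integral from `(0,
  -- T)` down to `(0, t)`.
  rw [volume_restrict_strip, integral_prod _ hint, intervalIntegral.integral_of_le hq0.le,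
    integral_Ioc_eq_integral_Ioo, setIntegral_eq_of_subset_of_forall_sdiff_eq_zero
      (measurableSet_Ioo (a := (0 : ℝ)) (b := T)) (Ioo_subset_Ioo_right hqT.le)]
  · refine setIntegral_congr_fun measurableSet_Ioo fun s hs => ?_
    have hs1 : s ≤ 1 := by linarith [hs.2]
    have h := integral_symbolKernel_scale (c := c) hγ (m := 1) (l := p.1) hs.1
      (p.2 * clampPow γ⁻¹ s) q.2 (fun x => stripExt v u (q.1 - s, x))
    have e : s ^ γ⁻¹ * (p.2 * clampPow γ⁻¹ s) = p.2 * s := by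
      rw [clampPow_eq hs.1.le hs1, mul_left_comm, ← Real.rpow_add hs.1]
      simp
    have hpos := Real.rpow_pos_of_pos hs.1 γ⁻¹
    rw [pow_one, e] at h
    have h' : convR (symbolKernel γ c 0 1 (p.1 * s)) (fun x => stripExt v u (q.1 - s, x))
        (q.2 + p.2 * s) = (s ^ γ⁻¹)⁻¹ * ∫ z, symbolKernel γ c 0 1 p.1 (z + p.2 * clampPow γ⁻¹ s)
          * stripExt v u (q.1 - s, q.2 - s ^ γ⁻¹ * z) := by
      rw [convR_apply, h, inv_mul_cancel_left₀ hpos.ne']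
    rw [h', ← mul_assoc, ← integral_const_mul]
    congr 1 with z
    have hz : (1 + z ^ 2) ≠ 0 := by positivity
    simp only [duhamelFun, duhamelWeight, BoundedContinuousFunction.smul_apply, smul_eq_mul,
      paramKernel_apply hγ hc hβ _ hp, paramKernelFun, pow_zero, mul_one]
    rw [Real.rpow_neg hs.1.le]
    field_simp
  · intro s hs
    have hs' : q.1 ≤ s := by
      by_contra hlt
      exact hs.2 ⟨hs.1.1, not_le.1 hlt⟩
    refine integral_eq_zero_of_ae (Eventually.of_forall fun z => ?_)
    simp only [Pi.zero_apply]
    rw [duhamelFun, stripExt_of_notMem, mul_zero]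
    intro hmem
    have := (mem_strip.1 hmem).1
    simp only at this
    linarith

end Physical

/-! ### Dilated and sheared solutions, and the resulting smoothness -/

section Rescale

variable {U : Type*} [TopologicalSpace U] [DiscreteTopology U]

/-- Since `λ ≤ 2`, a solution up to time `2T` has rescalings defined up to time `T`. -/
theorem rescale_mem_strip {T : ℝ} {p : ℝ × ℝ} (hp : p ∈ paramBall) {q : ℝ × ℝ}
    (hq : q ∈ strip 0 T) : (p.1 * q.1, q.2 + p.2 * q.1) ∈ strip 0 (2 * T) := by
  obtain ⟨⟨h1, h2⟩, -⟩ := mem_paramBall hp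
  obtain ⟨h3, h4⟩ := mem_strip.1 hq
  exact mem_strip.2 ⟨by simp only; nlinarith, by simp only; nlinarith⟩

/-- The reparametrisation `(t, x) ↦ v(λ t, x + μ t)` of a function `v` on the strip. -/
def rescale {T : ℝ} (v : U × strip 0 (2 * T) →ᵇ ℝ) (p : ℝ × ℝ) : U × strip 0 T →ᵇ ℝ :=
  bcfOf fun z => stripExt v z.1 (p.1 * z.2.1.1, z.2.1.2 + p.2 * z.2.1.1)

theorem rescale_apply {T : ℝ} (v : U × strip 0 (2 * T) →ᵇ ℝ) {p : ℝ × ℝ} (hp : p ∈ paramBall)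
    (z : U × strip 0 T) :
    rescale v p z = stripExt v z.1 (p.1 * z.2.1.1, z.2.1.2 + p.2 * z.2.1.1) := by
  refine bcfOf_apply (continuous_prod_of_discrete_left.2 fun u => ?_) (C := ‖v‖)
    (fun z => abs_stripExt_le v z.1 _) z
  refine (continuousOn_stripExt v u).comp_continuous (by fun_prop) fun q => ?_
  exact rescale_mem_strip hp q.2

theorem stripExt_nemytskii_rescale {T : ℝ} {f : ℝ → ℝ} (hf : Continuous f)
    (v : U × strip 0 (2 * T) →ᵇ ℝ) {p : ℝ × ℝ} (hp : p ∈ paramBall) (u : U) {q : ℝ × ℝ}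
    (hq : q.1 < T) :
    stripExt (nemytskii f hf (rescale v p)) u q
      = stripExt (nemytskii f hf v) u (p.1 * q.1, q.2 + p.2 * q.1) := by
  by_cases h : 0 < q.1
  · have hq' : q ∈ strip 0 T := mem_strip.2 ⟨h, hq⟩
    rw [stripExt_of_mem _ _ hq', stripExt_of_mem _ _ (rescale_mem_strip hp hq'),
      nemytskii_apply, nemytskii_apply, rescale_apply v hp,
      stripExt_of_mem _ _ (rescale_mem_strip hp hq')]
  · rw [stripExt_of_notMem, stripExt_of_notMem]
    · intro hmem
      have h1 := (mem_strip.1 hmem).1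
      simp only at h1
      nlinarith [(mem_paramBall hp).1.1]
    · exact fun hmem => h (mem_strip.1 hmem).1

end Rescale

section Equation

variable {γ : ℝ} {c : ℂ} {U : Type*} [TopologicalSpace U] [DiscreteTopology U] {d : U → ℝ → ℝ}
  {R : ℝ} {f : ℝ → ℝ}

/-- The Duhamel equation for `v` at the parameter `(λ, μ)`, with data `d` and flux `f`. -/
def IsDuhamelSolution (γ : ℝ) (c : ℂ) (d : U → ℝ → ℝ) (f : ℝ → ℝ) {T : ℝ} (p : ℝ × ℝ)
    (v : U × strip 0 T → ℝ) : Prop :=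
  ∀ u, ∀ q ∈ strip 0 T, stripExt v u q
    = convR (symbolKernel γ c 0 0 (p.1 * q.1)) (d u) (q.2 + p.2 * q.1)
      - ∫ s in (0 : ℝ)..q.1, p.1 * convR (symbolKernel γ c 0 1 (p.1 * s))
          (fun x => stripExt (fun z => f (v z)) u (q.1 - s, x)) (q.2 + p.2 * s)

theorem freeOp_sub_duhamelOp_apply (hγ : 1 < γ) (hc : c.re < 0) (hd : ∀ u, Measurable (d u))
    (hdR : ∀ u x, |d u x| ≤ R) (hR : 0 ≤ R) {T : ℝ} (hT0 : 0 ≤ T) (hT : T ≤ 1)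
    {p : ℝ × ℝ} (hp : p ∈ paramBall) (w : U × strip 0 T →ᵇ ℝ) (z : U × strip 0 T) :
    (freeOp (inv_gamma_pos hγ) hT hd hdR hR (paramKernel γ c γ⁻¹ (0, 0, 0) p)
        - duhamelOp U (inv_gamma_lt_one hγ) hT0 (p.1 • paramKernel γ c γ⁻¹ (0, 1, 0) p) w) z
      = convR (symbolKernel γ c 0 0 (p.1 * z.2.1.1)) (d z.1) (z.2.1.2 + p.2 * z.2.1.1)
      - ∫ s in (0 : ℝ)..z.2.1.1, p.1 * convR (symbolKernel γ c 0 1 (p.1 * s))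
          (fun x => stripExt w z.1 (z.2.1.1 - s, x)) (z.2.1.2 + p.2 * s) := by
  have hz := mem_strip.1 z.2.2
  rw [BoundedContinuousFunction.sub_apply, freeOp_apply, duhamelOp_apply,
    integral_freeFun_paramKernel hγ hc hp hz.1 (by linarith),
    integral_duhamelFun_paramKernel hγ hc hT hp z.2.2]

theorem isDuhamelSolution_iff (hγ : 1 < γ) (hc : c.re < 0) (hd : ∀ u, Measurable (d u))
    (hdR : ∀ u x, |d u x| ≤ R) (hR : 0 ≤ R) (hf : Continuous f) {T : ℝ} (hT0 : 0 ≤ T) (hT : T ≤ 1)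
    {p : ℝ × ℝ} (hp : p ∈ paramBall) (v : U × strip 0 T →ᵇ ℝ) :
    IsDuhamelSolution γ c d f p v ↔
      v = freeOp (inv_gamma_pos hγ) hT hd hdR hR (paramKernel γ c γ⁻¹ (0, 0, 0) p)
        - duhamelOp U (inv_gamma_lt_one hγ) hT0 (p.1 • paramKernel γ c γ⁻¹ (0, 1, 0) p)
          (nemytskii f hf v) := by
  have key := freeOp_sub_duhamelOp_apply hγ hc hd hdR hR hT0 hT hp (nemytskii f hf v)
  constructor
  · intro h
    ext z
    rw [key z, ← stripExt_of_mem v z.1 z.2.2, h z.1 z.2 z.2.2]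
    rfl
  · intro h u q hq
    have := congrArg (fun w : U × strip 0 T →ᵇ ℝ => w (u, ⟨q, hq⟩)) h
    rw [key] at this
    rw [stripExt_of_mem _ _ hq, this]
    rfl

theorem base_mem_paramBall : ((1, 0) : ℝ × ℝ) ∈ paramBall := Metric.mem_ball_self (by norm_num)

/-- The dilation comes from the substitution `s ↦ λs` in the time integral, whose Jacobian is the
factor `λ` in the equation. The shear is compatible with Duhamel's formula because `μt = μ(t - s) +
μs`. -/
theorem IsDuhamelSolution.rescale {T : ℝ} (hf : Continuous f) {v : U × strip 0 (2 * T) →ᵇ ℝ}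
    (hv : IsDuhamelSolution γ c d f (1, 0) v) {p : ℝ × ℝ} (hp : p ∈ paramBall) :
    IsDuhamelSolution γ c d f p (rescale v p) := by
  intro u q hq
  have hmem := rescale_mem_strip hp hq
  have hq' := mem_strip.1 hq
  have h := hv u _ hmem
  rw [stripExt_of_mem _ _ hq, rescale_apply v hp, h]
  simp only [one_mul, zero_mul, add_zero]
  congr 1
  rw [intervalIntegral.integral_const_mul]
  have hsub := intervalIntegral.smul_integral_comp_mul_left (a := (0 : ℝ)) (b := q.1)
    (fun s => convR (symbolKernel γ c 0 1 s)
      (fun x => stripExt (fun z => f (v z)) u (p.1 * q.1 - s, x)) (q.2 + p.2 * q.1)) p.1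
  rw [mul_zero, smul_eq_mul] at hsub
  rw [← hsub]
  congr 1
  refine intervalIntegral.integral_congr fun s hs => ?_
  rw [uIcc_of_le hq'.1.le] at hs
  simp only [convR_apply]
  congr 1 with w
  have e := stripExt_nemytskii_rescale hf v hp u (q := (q.1 - s, q.2 + p.2 * s - w))
    (by simp only; linarith [hs.1])
  have e1 : ∀ r, stripExt (fun z => f (_root_.rescale v p z)) u r
    = stripExt (nemytskii f hf (_root_.rescale v p)) u r := fun r => rfl
  have e2 : ∀ r, stripExt (fun z => f (v z)) u r = stripExt (nemytskii f hf v) u r := fun r => rfl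
  rw [e1, e2, e]
  congr 2
  simp only [Prod.mk.injEq]
  constructor <;> ring

/-- The linearised equation at the rescaled solution is a perturbation of the identity by a Duhamel
operator times `f'(v)`, and `hsmall` bounds this by less than `1`. -/
theorem contDiffAt_rescale (hγ : 1 < γ) (hc : c.re < 0) (hd : ∀ u, Measurable (d u))
    (hdR : ∀ u x, |d u x| ≤ R) (hR : 0 ≤ R) (hf : ContDiff ℝ ∞ f) {T : ℝ} (hT0 : 0 ≤ T)
    (hT : T ≤ 1) {v : U × strip 0 (2 * T) →ᵇ ℝ} (hv : IsDuhamelSolution γ c d f (1, 0) v)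
    {L : ℝ} (hL : ∀ r, |r| ≤ ‖v‖ → |deriv f r| ≤ L)
    (hsmall : ‖duhamelOp U (T := T) (inv_gamma_lt_one hγ) hT0 (paramKernel γ c γ⁻¹ (0, 1, 0) (1, 0))‖
      * L < 1) :
    ContDiffAt ℝ ∞ (rescale (T := T) v) (1, 0) := by
  have hβ := inv_gamma_lt_one hγ
  have hnhds : paramBall ∈ 𝓝 ((1, 0) : ℝ × ℝ) := Metric.ball_mem_nhds _ (by norm_num)
  have hK := fun i => (contDiffOn_paramKernel (β := γ⁻¹) hγ hc hβ i).contDiffAt hnhds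
  have hL0 : 0 ≤ L := (abs_nonneg _).trans (hL 0 (by simp))
  refine contDiffAt_of_fixedPoint (N := nemytskii f hf.continuous)
    (a := fun p => freeOp (inv_gamma_pos hγ) hT hd hdR hR (paramKernel γ c γ⁻¹ (0, 0, 0) p))
    (b := fun p => duhamelOp U hβ hT0 (p.1 • paramKernel γ c γ⁻¹ (0, 1, 0) p))
    ?_ ?_ (contDiff_nemytskii hf) ?_ ?_ ?_
  · exact (ContinuousLinearMap.isBoundedLinearMap _).contDiff.contDiffAt.comp _ (hK _)
  · exact (ContinuousLinearMap.isBoundedLinearMap _).contDiff.contDiffAt.comp _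
      (contDiffAt_fst.smul (hK _))
  · have hfd : fderiv ℝ (nemytskii f hf.continuous) (rescale (T := T) v (1, 0))
        = ContinuousLinearMap.mul ℝ (U × strip 0 T →ᵇ ℝ) (nemytskii (deriv f)
          (contDiff_infty_iff_deriv.1 hf).2.continuous (rescale (T := T) v (1, 0))) :=
      HasFDerivAt.fderiv (hasFDerivAt_nemytskii hf _)
    rw [hfd, one_smul]
    refine lt_of_le_of_lt (ContinuousLinearMap.opNorm_comp_le _ _) (lt_of_le_of_lt ?_ hsmall)
    gcongr
    refine (ContinuousLinearMap.opNorm_mul_apply_le ℝ _ _).trans ?_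
    refine (BoundedContinuousFunction.norm_le hL0).2 fun z => hL _ ?_
    rw [rescale_apply v base_mem_paramBall]
    exact abs_stripExt_le v _ _
  · filter_upwards [hnhds] with p hp
    exact (isDuhamelSolution_iff hγ hc hd hdR hR hf.continuous hT0 hT hp _).1
      (hv.rescale hf.continuous hp)
  · filter_upwards [hnhds] with p hp w hw
    exact duhamel_fixedPoint_unique hβ hT0 hf hw
      ((isDuhamelSolution_iff hγ hc hd hdR hR hf.continuous hT0 hT hp _).1
        (hv.rescale hf.continuous hp))

/-- Moving the point `r` near `q` amounts to freezing `q` and moving the parameters to `λ = r.1 /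
q.1`, `μ = (r.2 - q.2) / q.1`. -/
theorem stripExt_eventuallyEq {T : ℝ} (v : U × strip 0 (2 * T) →ᵇ ℝ) (u : U) {q : ℝ × ℝ}
    (hq : q ∈ strip 0 T) :
    stripExt v u =ᶠ[𝓝 q] fun r => rescale v (q.1⁻¹ • (r + (-(0, q.2)))) (u, ⟨q, hq⟩) := by
  have hq0 : q.1 ≠ 0 := (mem_strip.1 hq).1.ne'
  have hcont : Continuous fun r : ℝ × ℝ => q.1⁻¹ • (r + (-((0 : ℝ), q.2))) := by fun_prop
  have hbase : q.1⁻¹ • (q + (-((0 : ℝ), q.2))) = (1, 0) := by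
    ext <;> simp [hq0]
  have hnhds : paramBall ∈ 𝓝 (q.1⁻¹ • (q + (-((0 : ℝ), q.2)))) := by
    rw [hbase]; exact Metric.ball_mem_nhds _ (by norm_num)
  filter_upwards [hcont.continuousAt.preimage_mem_nhds hnhds] with r hr
  rw [rescale_apply v hr]
  congr 1
  ext
  · simp [hq0, mul_comm]
  · simp only [Prod.smul_snd, Prod.snd_add, Prod.snd_neg, smul_eq_mul]
    field_simp
    ring

/-- Parameter derivatives at `(1, 0)` become derivatives at `q`. The affine change of variables has
linear part `q.1⁻¹`, hence the factor `(q.1⁻¹)^n`. Evaluation at a point has norm at most `1`, so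
the constant depends neither on the datum nor on `q`. -/
theorem contDiffAt_stripExt {T : ℝ} {v : U × strip 0 (2 * T) →ᵇ ℝ}
    (h : ContDiffAt ℝ ∞ (rescale (T := T) v) (1, 0)) (u : U) {q : ℝ × ℝ} (hq : q ∈ strip 0 T) :
    ContDiffAt ℝ ∞ (stripExt v u) q ∧
      ∀ n : ℕ, ‖iteratedFDeriv ℝ n (stripExt v u) q‖
        ≤ ‖iteratedFDeriv ℝ n (rescale (T := T) v) (1, 0)‖ * (q.1⁻¹) ^ n := by
  have hq0 : 0 < q.1 := (mem_strip.1 hq).1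
  have hbase : q.1⁻¹ • (q + (-((0 : ℝ), q.2))) = (1, 0) := by
    ext <;> simp [hq0.ne']
  have hev := stripExt_eventuallyEq v u hq
  set E := BoundedContinuousFunction.evalCLM ℝ (β := ℝ) (u, (⟨q, hq⟩ : strip 0 T)) with hE
  have hEn : ‖E‖ ≤ 1 := ContinuousLinearMap.opNorm_le_bound _ zero_le_one fun w => by
    rw [one_mul]; exact w.norm_coe_le_norm _
  set e : (ℝ × ℝ) ≃L[ℝ] (ℝ × ℝ) :=
    ContinuousLinearEquiv.smulLeft (Units.mk0 q.1⁻¹ (inv_ne_zero hq0.ne')) with he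
  have hee : ∀ r, e r = q.1⁻¹ • r := fun r => rfl
  have hEc : ContDiffAt ℝ ∞ (E ∘ rescale (T := T) v) (1, 0) :=
    (ContinuousLinearMap.isBoundedLinearMap E).contDiff.contDiffAt.comp _ h
  have hfun : (fun r => rescale v (q.1⁻¹ • (r + (-(0, q.2)))) (u, ⟨q, hq⟩))
      = fun r => ((E ∘ rescale (T := T) v) ∘ e) (r + (-(0, q.2))) := rfl
  rw [hfun] at hev
  constructor
  · refine ContDiffAt.congr_of_eventuallyEq ?_ hev
    have h2 : ContDiffAt ℝ ∞ (fun r : ℝ × ℝ => e (r + (-(0, q.2)))) q := by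
      have : ContDiff ℝ ∞ (fun r : ℝ × ℝ => e (r + (-(0, q.2)))) := by
        simp only [hee]; fun_prop
      exact this.contDiffAt
    refine ContDiffAt.comp q (g := E ∘ rescale (T := T) v) ?_ h2
    rw [hee, hbase]
    exact hEc
  · intro n
    rw [hev.iteratedFDeriv ℝ n |>.eq_of_nhds, iteratedFDeriv_comp_add_right]
    have h1 := e.iteratedFDerivWithin_comp_right (E ∘ rescale (T := T) v) uniqueDiffOn_univ
      (mem_univ (e (q + (-(0, q.2))))) n
    rw [preimage_univ, iteratedFDerivWithin_univ, iteratedFDerivWithin_univ] at h1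
    rw [h1]
    refine (ContinuousMultilinearMap.norm_compContinuousLinearMap_le _ _).trans ?_
    rw [hee, hbase, Finset.prod_const, Finset.card_fin]
    have h2 : ‖(e : (ℝ × ℝ) →L[ℝ] (ℝ × ℝ))‖ ≤ q.1⁻¹ :=
      ContinuousLinearMap.opNorm_le_bound _ (by positivity) fun r => by
        rw [ContinuousLinearEquiv.coe_coe, hee, norm_smul, Real.norm_eq_abs,
          abs_of_nonneg (by positivity)]
    have h3 := E.norm_iteratedFDeriv_comp_left (n := n) h (by exact_mod_cast le_top)
    have h4 : ‖iteratedFDeriv ℝ n (E ∘ rescale (T := T) v) (1, 0)‖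
        ≤ ‖iteratedFDeriv ℝ n (rescale (T := T) v) (1, 0)‖ :=
      h3.trans (mul_le_of_le_one_left (norm_nonneg _) hEn)
    gcongr

end Equation

/-! ### Convolutions and differentiation under the integral -/

section Convolution

theorem integrable_mul_of_abs_le {Ω : Type*} [MeasurableSpace Ω] {μ : Measure Ω} {k g : Ω → ℝ}
    (hk : Integrable k μ) (hg : AEStronglyMeasurable g μ) {M : ℝ} (hM : ∀ᵐ a ∂μ, |g a| ≤ M) :
    Integrable (fun a => k a * g a) μ :=
  hk.mul_bdd hg hM

theorem hasDerivAt_integral_mul {Ω : Type*} [MeasurableSpace Ω] {μ : Measure Ω} {k : Ω → ℝ}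
    (hk : Integrable k μ) {H H' : Ω → ℝ → ℝ}
    (hH : ∀ x, AEStronglyMeasurable (fun a => H a x) μ)
    (hH' : ∀ x, AEStronglyMeasurable (fun a => H' a x) μ) {M M' : ℝ}
    (hM : ∀ᵐ a ∂μ, ∀ x, |H a x| ≤ M) (hM' : ∀ᵐ a ∂μ, ∀ x, |H' a x| ≤ M')
    (hd : ∀ᵐ a ∂μ, ∀ x, HasDerivAt (H a) (H' a x) x) (x : ℝ) :
    HasDerivAt (fun x => ∫ a, k a * H a x ∂μ) (∫ a, k a * H' a x ∂μ) x := by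
  refine (hasDerivAt_integral_of_dominated_loc_of_deriv_le (F := fun x a => k a * H a x)
    (F' := fun x a => k a * H' a x) (bound := fun a => |k a| * M') univ_mem
    (Eventually.of_forall fun x => hk.aestronglyMeasurable.mul (hH x))
    (integrable_mul_of_abs_le hk (hH x) (hM.mono fun a h => h x))
    (hk.aestronglyMeasurable.mul (hH' x)) ?_ (hk.abs.mul_const _) ?_).2
  · filter_upwards [hM'] with a h x _
    rw [Real.norm_eq_abs, abs_mul]
    have := h x
    gcongr
  · filter_upwards [hd] with a h x _
    exact (h x).const_mul _

theorem iteratedDeriv_integral_mul {Ω : Type*} [MeasurableSpace Ω] {μ : Measure Ω} {k : Ω → ℝ}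
    (hk : Integrable k μ) {H : Ω → ℝ → ℝ} (hs : ∀ᵐ a ∂μ, ContDiff ℝ ∞ (H a))
    (hH : ∀ m x, AEStronglyMeasurable (fun a => iteratedDeriv m (H a) x) μ)
    (hM : ∀ m, ∃ M, ∀ᵐ a ∂μ, ∀ x, |iteratedDeriv m (H a) x| ≤ M) (m : ℕ) (x : ℝ) :
    iteratedDeriv m (fun x => ∫ a, k a * H a x ∂μ) x = ∫ a, k a * iteratedDeriv m (H a) x ∂μ := by
  induction m generalizing x with
  | zero => simp
  | succ m ih =>
    obtain ⟨M, hM₁⟩ := hM m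
    obtain ⟨M', hM₂⟩ := hM (m + 1)
    rw [iteratedDeriv_succ, funext ih]
    refine (hasDerivAt_integral_mul hk (hH m) (hH (m + 1)) hM₁ hM₂ ?_ x).deriv
    filter_upwards [hs] with a h x
    rw [iteratedDeriv_succ]
    exact (h.differentiable_iteratedDeriv m (by exact_mod_cast WithTop.coe_lt_top m) x).hasDerivAt

theorem measurable_convR {k g : ℝ → ℝ} (hk : Measurable k) (hg : Measurable g) :
    Measurable (convR k g) := by
  have h : StronglyMeasurable (Function.uncurry fun x y => k y * g (x - y)) :=
    Measurable.stronglyMeasurable (by unfold Function.uncurry; fun_prop)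
  exact h.integral_prod_right.measurable

theorem abs_convR_le {k g : ℝ → ℝ} (hk : Integrable k) {M : ℝ} (hM : ∀ x, |g x| ≤ M) (x : ℝ) :
    |convR k g x| ≤ (∫ y, |k y|) * M := by
  rw [convR_apply, ← integral_mul_const]
  refine norm_integral_le_of_norm_le (f := fun y => k y * g (x - y)) (hk.abs.mul_const M)
    (Eventually.of_forall fun y => ?_)
  rw [Real.norm_eq_abs, abs_mul]
  have := hM (x - y)
  gcongr

theorem convR_comm (k g : ℝ → ℝ) : convR k g = convR g k := by
  ext x
  rw [convR_apply, convR_apply, ← integral_sub_left_eq_self _ volume x]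
  simp [mul_comm]

theorem convR_sub {k g h : ℝ → ℝ} (hk : Integrable k) (hg : Measurable g) (hh : Measurable h)
    {M M' : ℝ} (hM : ∀ x, |g x| ≤ M) (hM' : ∀ x, |h x| ≤ M') (x : ℝ) :
    convR k (fun y => g y - h y) x = convR k g x - convR k h x := by
  simp only [convR_apply]
  rw [← integral_sub (integrable_mul_of_abs_le hk
      (Measurable.aestronglyMeasurable (by fun_prop))
      (Eventually.of_forall fun y => hM (x - y)))
    (integrable_mul_of_abs_le hk (Measurable.aestronglyMeasurable (by fun_prop))
      (Eventually.of_forall fun y => hM' (x - y)))]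
  simp only [mul_sub]

theorem convR_assoc {k₁ k₂ g : ℝ → ℝ} (hk₁ : Integrable k₁) (hk₂ : Integrable k₂)
    (hk₂m : Measurable k₂) (hg : Measurable g) {M : ℝ} (hM : ∀ x, |g x| ≤ M) (x : ℝ) :
    convR (convR k₁ k₂) g x = convR k₁ (convR k₂ g) x := by
  have hgk : ∀ x, ConvolutionExistsAt (fun x => ‖k₂ x‖) (fun x => ‖g x‖) x
      (ContinuousLinearMap.mul ℝ ℝ) volume := fun x =>
    integrable_mul_of_abs_le hk₂.norm (g := fun y => ‖g (x - y)‖)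
      (Measurable.aestronglyMeasurable (by fun_prop)) (M := M)
      (Eventually.of_forall fun y => by simpa using hM (x - y))
  refine convolution_assoc _ _ _ _ (fun a b c => by simp [mul_assoc]) hk₁.aestronglyMeasurable
    hk₂.aestronglyMeasurable hg.aestronglyMeasurable
    (hk₁.ae_convolution_exists _ hk₂) (Eventually.of_forall hgk) ?_
  have hn : Measurable (fun x => ‖k₂ x‖) := hk₂m.norm
  have hc : Measurable (convR (fun x => ‖k₂ x‖) (fun x => ‖g x‖)) := measurable_convR hn hg.norm
  exact integrable_mul_of_abs_le hk₁.norm (g := fun y => convR (fun x => ‖k₂ x‖) (fun x => ‖g x‖)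
      (x - y)) (Measurable.aestronglyMeasurable (by fun_prop))
      (Eventually.of_forall fun y => abs_convR_le hk₂.norm (M := M) (by simpa using hM) (x - y))

end Convolution

/-! ### Fourier representation and semigroup law of the kernel -/

section Symmetric

open ComplexConjugate

theorem integrable_and_integral_of_conj_symm {g : ℝ → ℂ}
    (hsymm : ∀ ξ, 0 < ξ → g (-ξ) = conj (g ξ)) (hint : IntegrableOn g (Ioi 0)) :
    Integrable g ∧ ∫ ξ, g ξ = ((2 * (∫ ξ in Ioi 0, g ξ).re : ℝ) : ℂ) := by
  have hneg : IntegrableOn (fun ξ => g (-ξ)) (Ioi 0) := by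
    have : IntegrableOn (fun ξ => conj (g ξ)) (Ioi 0) :=
      (Complex.conjCLE : ℂ →L[ℝ] ℂ).integrable_comp hint
    exact this.congr_fun (fun ξ hξ => (hsymm ξ hξ).symm) measurableSet_Ioi
  have hIio : IntegrableOn g (Iio 0) := by
    have h := (Measure.measurePreserving_neg (volume : Measure ℝ)).integrableOn_comp_preimage
      (Homeomorph.neg ℝ).measurableEmbedding (f := g) (s := Iio 0)
    rw [← h]
    simpa [Function.comp_def] using hneg
  have hIic : IntegrableOn g (Iic 0) := by
    rw [integrableOn_Iic_iff_integrableOn_Iio]; exact hIio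
  refine ⟨?_, ?_⟩
  · rw [← integrableOn_univ, ← Iic_union_Ioi (a := (0 : ℝ))]
    exact hIic.union hint
  · rw [← intervalIntegral.integral_Iic_add_Ioi hIic hint]
    have h1 := integral_comp_neg_Ioi (0 : ℝ) g
    rw [neg_zero] at h1
    rw [← h1, setIntegral_congr_fun measurableSet_Ioi (fun ξ hξ => hsymm ξ hξ), integral_conj,
      add_comm, Complex.add_conj]

end Symmetric

section Semigroup

variable {γ : ℝ} {c : ℂ} (hγ : 1 < γ) (hc : c.re < 0)

/-- The Fourier multiplier `e^{t ψ(2πv)}` of the semigroup, in the normalisation of the Mathlib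
Fourier transform. -/
def semigroupSymbol (γ : ℝ) (c : ℂ) (t v : ℝ) : ℂ :=
  Complex.exp (((t * |2 * Real.pi * v| ^ γ : ℝ) : ℂ)
    * (if 0 ≤ v then c else (starRingEnd ℂ) c))

theorem semigroupSymbol_add (s t v : ℝ) :
    semigroupSymbol γ c s v * semigroupSymbol γ c t v = semigroupSymbol γ c (s + t) v := by
  simp only [semigroupSymbol]
  rw [← Complex.exp_add]
  congr 1
  push_cast
  ring

include hγ in
theorem continuous_semigroupSymbol (t : ℝ) : Continuous (semigroupSymbol γ c t) := by
  unfold semigroupSymbol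
  refine Complex.continuous_exp.comp ?_
  have h1 : Continuous fun v : ℝ => ((t * |2 * Real.pi * v| ^ γ : ℝ) : ℂ) := by
    have := Real.continuous_rpow_const (show 0 ≤ γ by linarith)
    fun_prop
  have h2 : (fun v : ℝ => ((t * |2 * Real.pi * v| ^ γ : ℝ) : ℂ)
      * (if 0 ≤ v then c else (starRingEnd ℂ) c))
      = fun v : ℝ => if 0 ≤ v then ((t * |2 * Real.pi * v| ^ γ : ℝ) : ℂ) * c
        else ((t * |2 * Real.pi * v| ^ γ : ℝ) : ℂ) * (starRingEnd ℂ) c := by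
    ext v; split_ifs <;> rfl
  rw [h2]
  refine Continuous.if_le (by fun_prop) (by fun_prop) continuous_const continuous_id ?_
  intro v hv
  rw [← hv]
  simp [Real.zero_rpow (show γ ≠ 0 by linarith)]

include hγ hc

theorem integrable_and_integral_semigroupSymbol {t : ℝ} (ht : 0 < t) (x : ℝ) :
    Integrable (fun v : ℝ => Complex.exp (((2 * Real.pi * v * x : ℝ) : ℂ) * Complex.I)
      * semigroupSymbol γ c t v) ∧
    ∫ v : ℝ, Complex.exp (((2 * Real.pi * v * x : ℝ) : ℂ) * Complex.I) * semigroupSymbol γ c t v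
      = symbolKernel γ c 0 0 t x := by
  have hpi : 0 < 2 * Real.pi := by positivity
  have hF : ∀ v ∈ Ioi (0 : ℝ), halfFun γ c 0 t x (2 * Real.pi * v)
      = Complex.exp (((2 * Real.pi * v * x : ℝ) : ℂ) * Complex.I) * semigroupSymbol γ c t v := by
    intro v hv
    have hv' : (0 : ℝ) < v := hv
    have hv2 : 0 < 2 * Real.pi * v := by positivity
    rw [halfFun, semigroupSymbol, if_pos hv'.le, abs_of_pos hv2, Real.rpow_zero, Complex.ofReal_one,
      one_mul, Complex.exp_add]
  have hint : IntegrableOn (fun v : ℝ => Complex.exp (((2 * Real.pi * v * x : ℝ) : ℂ) * Complex.I)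
      * semigroupSymbol γ c t v) (Ioi 0) := by
    have h1 := (integrableOn_Ioi_comp_mul_left_iff (halfFun γ c 0 t x) 0 hpi).2
      (by rw [mul_zero]; exact integrableOn_halfFun hγ hc (by norm_num) ht)
    exact h1.congr_fun hF measurableSet_Ioi
  have hsymm : ∀ v : ℝ, 0 < v →
      Complex.exp (((2 * Real.pi * -v * x : ℝ) : ℂ) * Complex.I) * semigroupSymbol γ c t (-v)
      = (starRingEnd ℂ) (Complex.exp (((2 * Real.pi * v * x : ℝ) : ℂ) * Complex.I)
        * semigroupSymbol γ c t v) := by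
    intro v hv
    rw [map_mul, ← Complex.exp_conj, semigroupSymbol, semigroupSymbol, ← Complex.exp_conj,
      if_pos hv.le, if_neg (by linarith)]
    simp only [map_mul, Complex.conj_ofReal, Complex.conj_I]
    congr 2
    · push_cast; ring
    · rw [mul_neg, abs_neg]
  obtain ⟨h1, h2⟩ := integrable_and_integral_of_conj_symm hsymm hint
  refine ⟨h1, ?_⟩
  rw [h2, ← setIntegral_congr_fun measurableSet_Ioi hF,
    integral_comp_mul_left_Ioi (halfFun γ c 0 t x) 0 hpi, mul_zero]
  simp only [symbolKernel, halfInt, pow_zero, one_mul, Nat.cast_zero, mul_zero, add_zero]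
  rw [Complex.real_smul, Complex.re_ofReal_mul]
  congr 1
  field_simp

theorem fourierInv_semigroupSymbol {t : ℝ} (ht : 0 < t) :
    𝓕⁻ (semigroupSymbol γ c t) = fun x => (symbolKernel γ c 0 0 t x : ℂ) := by
  ext x
  rw [Real.fourierInv_eq', ← (integrable_and_integral_semigroupSymbol hγ hc ht x).2]
  congr 1 with v
  simp only [smul_eq_mul]
  congr 3
  simp
  ring_nf

theorem integrable_symbolKernel_one (j m : ℕ) : Integrable (symbolKernel γ c j m 1) := by
  obtain ⟨C, -, hC⟩ := exists_symbolKernel_le hγ hc j m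
  refine (integrable_inv_one_add_sq.mul_const C).mono' ?_ (Eventually.of_forall fun x => ?_)
  · exact Continuous.aestronglyMeasurable (continuous_iff_continuousAt.2 fun x =>
      (hasDerivAt_symbolKernel hγ hc one_pos x).continuousAt)
  · have := hC 1 ⟨by norm_num, by norm_num⟩ x
    rw [inv_mul_eq_div, le_div_iff₀ (by positivity), mul_comm]
    exact this

theorem continuous_symbolKernel {j m : ℕ} {t : ℝ} (ht : 0 < t) :
    Continuous (symbolKernel γ c j m t) :=
  continuous_iff_continuousAt.2 fun x => (hasDerivAt_symbolKernel hγ hc ht x).continuousAt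

theorem exists_abs_symbolKernel_le (j m : ℕ) {t : ℝ} (ht : 0 < t) :
    ∃ M, ∀ x, |symbolKernel γ c j m t x| ≤ M := by
  have hb : -1 < γ * j + m := by
    have : 0 ≤ γ * j + m := by positivity
    linarith
  refine ⟨(1 / Real.pi) * (‖c‖ ^ j * halfMajorant γ c (γ * j + m) t), fun x => ?_⟩
  have h1 := Complex.abs_re_le_norm (c ^ j * Complex.I ^ m * halfInt γ c (γ * j + m) t x)
  rw [norm_mul, norm_mul, norm_pow, norm_pow, Complex.norm_I, one_pow, mul_one] at h1
  have h2 := norm_halfInt_le hγ hc (x := x) hb ht le_rfl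
  rw [symbolKernel, abs_mul, abs_of_nonneg (by positivity)]
  gcongr
  exact h1.trans (by gcongr)

omit hc in
theorem symbolKernel_eq_scale {m : ℕ} {t : ℝ} (ht : 0 < t) (x : ℝ) :
    symbolKernel γ c 0 m t x
      = (t ^ (-γ⁻¹)) ^ (m + 1) * symbolKernel γ c 0 m 1 (t ^ (-γ⁻¹) * x) := by
  have hr0 : 0 < t ^ γ⁻¹ := Real.rpow_pos_of_pos ht _
  have hrγ : (t ^ γ⁻¹) ^ γ * 1 = t := by
    rw [← Real.rpow_mul ht.le, inv_mul_cancel₀ (by linarith), Real.rpow_one, mul_one]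
  have h := symbolKernel_scale (c := c) (γ := γ) (j := 0) (m := m) (l := 1)
    (x := t ^ (-γ⁻¹) * x) hr0
  rw [hrγ, Real.rpow_neg ht.le, mul_inv_cancel_left₀ hr0.ne'] at h
  rw [h, Real.rpow_neg ht.le, Nat.cast_zero, mul_zero, zero_add, Real.rpow_neg hr0.le, inv_pow]
  congr 2
  exact_mod_cast Real.rpow_natCast (t ^ γ⁻¹) (m + 1)

theorem integrable_symbolKernel {m : ℕ} {t : ℝ} (ht : 0 < t) :
    Integrable (symbolKernel γ c 0 m t) := by
  have hr0 : 0 < t ^ (-γ⁻¹) := Real.rpow_pos_of_pos ht _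
  rw [funext (symbolKernel_eq_scale hγ ht)]
  exact ((integrable_symbolKernel_one hγ hc 0 m).comp_mul_left' hr0.ne').const_mul _

omit hc in
theorem integral_abs_symbolKernel {m : ℕ} {t : ℝ} (ht : 0 < t) :
    ∫ x, |symbolKernel γ c 0 m t x|
      = (t ^ (-γ⁻¹)) ^ m * ∫ x, |symbolKernel γ c 0 m 1 x| := by
  have hr0 : 0 < t ^ (-γ⁻¹) := Real.rpow_pos_of_pos ht _
  have h := Measure.integral_comp_mul_left (fun x => |symbolKernel γ c 0 m 1 x|) (t ^ (-γ⁻¹))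
  rw [abs_of_pos (inv_pos.2 hr0), smul_eq_mul] at h
  simp only [symbolKernel_eq_scale hγ ht, abs_mul]
  rw [integral_const_mul, h, abs_of_pos (by positivity), pow_succ]
  field_simp

/-- Fourier inversion applied to the symbol: it is continuous and integrable, and its transform is
the reflected kernel, integrable by the quadratic decay. -/
theorem fourier_symbolKernel {t : ℝ} (ht : 0 < t) :
    𝓕 (fun x => (symbolKernel γ c 0 0 t x : ℂ)) = semigroupSymbol γ c t := by
  have h := fourierInv_semigroupSymbol hγ hc ht
  rw [← h]
  refine Continuous.fourier_fourierInv_eq (continuous_semigroupSymbol hγ t) ?_ ?_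
  · simpa using (integrable_and_integral_semigroupSymbol hγ hc ht 0).1
  · have h3 : 𝓕 (semigroupSymbol γ c t) = fun x => ((symbolKernel γ c 0 0 t (-x) : ℝ) : ℂ) := by
      ext x
      rw [← neg_neg x, ← Real.fourierInv_eq_fourier_neg, h, neg_neg]
    rw [h3]
    exact Integrable.ofReal (𝕜 := ℂ) (integrable_symbolKernel hγ hc ht).comp_neg

/-- The semigroup property of the kernel. -/
theorem convR_symbolKernel {s t : ℝ} (hs : 0 < s) (ht : 0 < t) :
    convR (symbolKernel γ c 0 0 s) (symbolKernel γ c 0 0 t) = symbolKernel γ c 0 0 (s + t) := by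
  have hst : 0 < s + t := by linarith
  set ks : ℝ → ℂ := fun x => (symbolKernel γ c 0 0 s x : ℂ) with hks
  set kt : ℝ → ℂ := fun x => (symbolKernel γ c 0 0 t x : ℂ) with hkt
  have is : Integrable ks := (integrable_symbolKernel hγ hc (m := 0) hs).ofReal (𝕜 := ℂ)
  have it : Integrable kt := (integrable_symbolKernel hγ hc (m := 0) ht).ofReal (𝕜 := ℂ)
  have ct : Continuous kt := Complex.continuous_ofReal.comp (continuous_symbolKernel hγ hc ht)
  have hconv : ∀ x, convolution ks kt (ContinuousLinearMap.mul ℂ ℂ) volume x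
      = ((convR (symbolKernel γ c 0 0 s) (symbolKernel γ c 0 0 t) x : ℝ) : ℂ) := by
    intro x
    rw [convR_apply, ← integral_complex_ofReal, convolution_mul]
    simp [hks, hkt]
  have hF : 𝓕 (convolution ks kt (ContinuousLinearMap.mul ℂ ℂ) volume)
      = semigroupSymbol γ c (s + t) := by
    ext v
    rw [Real.fourier_mul_convolution_eq is it, fourier_symbolKernel hγ hc hs,
      fourier_symbolKernel hγ hc ht, semigroupSymbol_add]
  obtain ⟨M, hM⟩ := exists_abs_symbolKernel_le hγ hc 0 0 ht
  have hcont : Continuous (convolution ks kt (ContinuousLinearMap.mul ℂ ℂ) volume) := by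
    refine BddAbove.continuous_convolution_right_of_integrable _ ?_ is ct
    exact ⟨M, by rintro _ ⟨x, rfl⟩; simpa [hkt] using hM x⟩
  -- The convolution is continuous and has an integrable transform, so inversion recovers it at
  -- every point.
  have hinv := Continuous.fourierInv_fourier_eq hcont (is.integrable_convolution _ it) (by
    rw [hF]; simpa using (integrable_and_integral_semigroupSymbol hγ hc hst 0).1)
  rw [hF, fourierInv_semigroupSymbol hγ hc hst] at hinv
  ext x
  have := congrFun hinv x
  rw [hconv] at this
  exact_mod_cast this.symm

/-- The semigroup law differentiated in `x`, with the derivative placed on one factor under the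
integral. -/
theorem convR_symbolKernel_deriv {s t : ℝ} (hs : 0 < s) (ht : 0 < t) :
    convR (symbolKernel γ c 0 1 s) (symbolKernel γ c 0 0 t) = symbolKernel γ c 0 1 (s + t) := by
  rw [convR_comm]
  ext x
  obtain ⟨M, hM⟩ := exists_abs_symbolKernel_le hγ hc 0 0 hs
  obtain ⟨M', hM'⟩ := exists_abs_symbolKernel_le hγ hc 0 1 hs
  have c0 := continuous_symbolKernel hγ hc (j := 0) (m := 0) hs
  have c1 := continuous_symbolKernel hγ hc (j := 0) (m := 1) hs
  have h := hasDerivAt_integral_mul (integrable_symbolKernel hγ hc (m := 0) ht)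
    (H := fun y x => symbolKernel γ c 0 0 s (x - y))
    (H' := fun y x => symbolKernel γ c 0 1 s (x - y))
    (fun x => Continuous.aestronglyMeasurable (by fun_prop))
    (fun x => Continuous.aestronglyMeasurable (by fun_prop))
    (Eventually.of_forall fun y x => hM _) (Eventually.of_forall fun y x => hM' _)
    (Eventually.of_forall fun y x =>
      (hasDerivAt_symbolKernel hγ hc hs (x - y)).comp_sub_const x y) x
  have h2 := hasDerivAt_symbolKernel hγ hc (j := 0) (m := 0) (show 0 < t + s by linarith) x
  rw [← convR_symbolKernel hγ hc ht hs] at h2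
  rw [add_comm s t, convR_apply]
  exact h.unique h2

end Semigroup

/-! ### Spatial derivatives of functions on the strip -/

section Slices

variable {T : ℝ} {F : ℝ × ℝ → ℝ}

theorem contDiff_slice (hF : ContDiffOn ℝ ∞ F (strip 0 T)) {t : ℝ} (ht : t ∈ Ioo 0 T) :
    ContDiff ℝ ∞ (fun x => F (t, x)) := by
  rw [contDiff_iff_contDiffAt]
  intro x
  have hmem : (t, x) ∈ strip 0 T := mem_strip.2 ht
  exact ContDiffAt.comp x (hF.contDiffAt ((isOpen_strip 0 T).mem_nhds hmem))
    (contDiffAt_const.prodMk contDiffAt_id)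

theorem iteratedDeriv_slice (hF : ContDiffOn ℝ ∞ F (strip 0 T)) {q : ℝ × ℝ}
    (hq : q ∈ strip 0 T) (m : ℕ) :
    iteratedDeriv m (fun x => F (q.1, x)) q.2 = iteratedFDeriv ℝ m F q (fun _ => (0, 1)) := by
  set s : Set (ℝ × ℝ) := (fun r : ℝ × ℝ => r + (q.1, 0)) ⁻¹' strip 0 T with hs
  have hsh : Continuous fun r : ℝ × ℝ => r + (q.1, 0) := by fun_prop
  have hso : IsOpen s := (isOpen_strip 0 T).preimage hsh
  have hcd : ContDiffOn ℝ ∞ (fun r : ℝ × ℝ => F (r + (q.1, 0))) s :=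
    hF.comp (contDiff_id.add contDiff_const).contDiffOn (fun r hr => hr)
  have hpre : (ContinuousLinearMap.inr ℝ ℝ ℝ) ⁻¹' s = univ := by
    ext x
    have := mem_strip.1 hq
    simp [hs, mem_strip, this]
  have hx : ContinuousLinearMap.inr ℝ ℝ ℝ q.2 ∈ s := by
    have : q.2 ∈ (ContinuousLinearMap.inr ℝ ℝ ℝ) ⁻¹' s := by rw [hpre]; exact mem_univ _
    exact this
  have h := (ContinuousLinearMap.inr ℝ ℝ ℝ).iteratedFDerivWithin_comp_right hcd hso.uniqueDiffOn
    (by rw [hpre]; exact uniqueDiffOn_univ) hx (i := m) (by exact_mod_cast le_top)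
  rw [hpre, iteratedFDerivWithin_univ, iteratedFDerivWithin_of_isOpen m hso hx] at h
  have e : (fun x => F (q.1, x))
      = (fun r : ℝ × ℝ => F (r + (q.1, 0))) ∘ ContinuousLinearMap.inr ℝ ℝ ℝ := by
    ext x; simp
  rw [iteratedDeriv_eq_iteratedFDeriv, e, h, iteratedFDeriv_comp_add_right]
  simp

theorem abs_iteratedDeriv_slice_le (hF : ContDiffOn ℝ ∞ F (strip 0 T)) {q : ℝ × ℝ}
    (hq : q ∈ strip 0 T) (m : ℕ) :
    |iteratedDeriv m (fun x => F (q.1, x)) q.2| ≤ ‖iteratedFDeriv ℝ m F q‖ := by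
  rw [iteratedDeriv_slice hF hq]
  refine ((iteratedFDeriv ℝ m F q).le_opNorm fun _ => ((0 : ℝ), (1 : ℝ))).trans ?_
  simp

theorem continuousOn_iteratedDeriv_slice (hF : ContDiffOn ℝ ∞ F (strip 0 T)) (m : ℕ) :
    ContinuousOn (fun q : ℝ × ℝ => iteratedDeriv m (fun x => F (q.1, x)) q.2) (strip 0 T) := by
  have h := hF.continuousOn_iteratedFDerivWithin (m := m) (by exact_mod_cast le_top)
    (isOpen_strip 0 T).uniqueDiffOn
  have h2 : ContinuousOn (iteratedFDeriv ℝ m F) (strip 0 T) :=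
    h.congr fun q hq => (iteratedFDerivWithin_of_isOpen m (isOpen_strip 0 T) hq).symm
  have h3 : ContinuousOn (fun q => iteratedFDeriv ℝ m F q (fun _ => ((0 : ℝ), (1 : ℝ))))
      (strip 0 T) := by
    exact (ContinuousMultilinearMap.apply ℝ (fun _ : Fin m => ℝ × ℝ) ℝ
      (fun _ => ((0 : ℝ), (1 : ℝ)))).continuous.comp_continuousOn h2
  exact h3.congr fun q hq => iteratedDeriv_slice hF hq m

end Slices

theorem contDiff_integral_mul {Ω : Type*} [MeasurableSpace Ω] {μ : Measure Ω} {k : Ω → ℝ}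
    (hk : Integrable k μ) {H : Ω → ℝ → ℝ} (hs : ∀ᵐ a ∂μ, ContDiff ℝ ∞ (H a))
    (hH : ∀ m x, AEStronglyMeasurable (fun a => iteratedDeriv m (H a) x) μ)
    (hM : ∀ m, ∃ M, ∀ᵐ a ∂μ, ∀ x, |iteratedDeriv m (H a) x| ≤ M) :
    ContDiff ℝ ∞ (fun x => ∫ a, k a * H a x ∂μ) := by
  refine contDiff_of_differentiable_iteratedDeriv fun m _ x => ?_
  obtain ⟨M, hM₁⟩ := hM m
  obtain ⟨M', hM₂⟩ := hM (m + 1)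
  rw [funext (iteratedDeriv_integral_mul hk hs hH hM m)]
  refine (hasDerivAt_integral_mul hk (hH m) (hH (m + 1)) hM₁ hM₂ ?_ x).differentiableAt
  filter_upwards [hs] with a h x
  rw [iteratedDeriv_succ]
  exact (h.differentiable_iteratedDeriv m (by exact_mod_cast WithTop.coe_lt_top m) x).hasDerivAt

/-! ### Restarting Duhamel's formula at a positive time -/

section DuhamelIntegral

variable {γ : ℝ} {c : ℂ} (hγ : 1 < γ) (hc : c.re < 0)
include hγ hc

/-- By scaling, the `L¹` norm in space at time `t - s` is a constant times `(t - s)^{-1/γ}`, whose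
exponent is greater than `-1`. -/
theorem integrableOn_symbolKernel_sub (t : ℝ) :
    IntegrableOn (fun q : ℝ × ℝ => symbolKernel γ c 0 1 (t - q.1) q.2) (strip 0 t) := by
  have hmeas : AEStronglyMeasurable (fun q : ℝ × ℝ => symbolKernel γ c 0 1 (t - q.1) q.2)
      (volume.restrict (strip 0 t)) := by
    refine ContinuousOn.aestronglyMeasurable ?_ (isOpen_strip 0 t).measurableSet
    exact (continuousOn_symbolKernel hγ hc (j := 0) (m := 1)).comp
      (f := fun q : ℝ × ℝ => (t - q.1, q.2)) (by fun_prop)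
      fun q hq => ⟨sub_pos.2 (mem_strip.1 hq).2, mem_univ _⟩
  rw [IntegrableOn]
  rw [volume_restrict_strip] at hmeas ⊢
  rw [integrable_prod_iff hmeas]
  constructor
  · filter_upwards [ae_restrict_mem measurableSet_Ioo] with s hs
    exact integrable_symbolKernel hγ hc (sub_pos.2 hs.2)
  · have h1 : IntegrableOn (fun s : ℝ => (t - s) ^ (-γ⁻¹)) (Ioo 0 t) := by
      rcases le_or_gt t 0 with ht | ht
      · simp [Ioo_eq_empty_of_le ht]
      · have h := (intervalIntegral.intervalIntegrable_rpow' (a := 0) (b := t) (r := -γ⁻¹)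
          (by linarith [inv_gamma_lt_one hγ])).comp_sub_left t
        rw [sub_zero, sub_self] at h
        rw [← integrableOn_Ioc_iff_integrableOn_Ioo,
          ← intervalIntegrable_iff_integrableOn_Ioc_of_le ht.le]
        exact h.symm
    refine (h1.mul_const (∫ x, |symbolKernel γ c 0 1 1 x|)).congr ?_
    filter_upwards [ae_restrict_mem measurableSet_Ioo] with s hs
    simp only [Real.norm_eq_abs]
    rw [integral_abs_symbolKernel hγ (sub_pos.2 hs.2), pow_one]

variable {F : ℝ × ℝ → ℝ} {M : ℝ}

theorem integrableOn_symbolKernel_sub_mul (hF : Measurable F) (hM : ∀ q, |F q| ≤ M) (t x : ℝ) :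
    IntegrableOn (fun q : ℝ × ℝ => symbolKernel γ c 0 1 (t - q.1) q.2 * F (q.1, x - q.2))
      (strip 0 t) :=
  integrable_mul_of_abs_le (integrableOn_symbolKernel_sub hγ hc t)
    (Measurable.aestronglyMeasurable (by fun_prop)) (Eventually.of_forall fun q => hM _)

theorem intervalIntegrable_convR_symbolKernel (hF : Measurable F) (hM : ∀ q, |F q| ≤ M) {t : ℝ}
    (ht : 0 ≤ t) (x : ℝ) : IntervalIntegrable
      (fun s => convR (symbolKernel γ c 0 1 (t - s)) (fun y => F (s, y)) x) volume 0 t := by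
  have h := integrableOn_symbolKernel_sub_mul hγ hc hF hM t x
  rw [IntegrableOn, volume_restrict_strip] at h
  rw [intervalIntegrable_iff_integrableOn_Ioc_of_le ht, integrableOn_Ioc_iff_integrableOn_Ioo]
  exact h.integral_prod_left

theorem intervalIntegral_convR_symbolKernel (hF : Measurable F) (hM : ∀ q, |F q| ≤ M) {t : ℝ}
    (ht : 0 ≤ t) (x : ℝ) :
    ∫ s in (0 : ℝ)..t, convR (symbolKernel γ c 0 1 (t - s)) (fun y => F (s, y)) x
      = ∫ q in strip 0 t, symbolKernel γ c 0 1 (t - q.1) q.2 * F (q.1, x - q.2) := by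
  have h := integrableOn_symbolKernel_sub_mul hγ hc hF hM t x
  rw [IntegrableOn, volume_restrict_strip] at h
  rw [volume_restrict_strip, integral_prod _ h, intervalIntegral.integral_of_le ht,
    integral_Ioc_eq_integral_Ioo]
  rfl

omit hγ hc in
theorem measurable_convR_slice {k : ℝ → ℝ} (hk : Measurable k) (hF : Measurable F) :
    Measurable (fun q : ℝ × ℝ => convR k (fun y => F (q.1, y)) q.2) := by
  have h : StronglyMeasurable (Function.uncurry
      fun (q : ℝ × ℝ) y => k y * F (q.1, q.2 - y)) :=
    Measurable.stronglyMeasurable (by unfold Function.uncurry; fun_prop)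
  exact h.integral_prod_right.measurable

/-- The semigroup law turns the kernel at `t₀ - s` into the one at `t₀ + t - s`; Fubini moves the
outer convolution inside the time integral. -/
theorem convR_intervalIntegral (hF : Measurable F) (hM : ∀ q, |F q| ≤ M) {t₀ t : ℝ}
    (ht₀ : 0 ≤ t₀) (ht : 0 < t) (x : ℝ) :
    convR (symbolKernel γ c 0 0 t)
      (fun y => ∫ s in (0 : ℝ)..t₀, convR (symbolKernel γ c 0 1 (t₀ - s)) (fun y => F (s, y)) y) x
    = ∫ s in (0 : ℝ)..t₀, convR (symbolKernel γ c 0 1 (t₀ + t - s)) (fun y => F (s, y)) x := by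
  have hK := integrable_symbolKernel hγ hc (m := 0) ht
  have hKm := (continuous_symbolKernel hγ hc (j := 0) (m := 0) ht).measurable
  have hFm := measurable_convR_slice hKm hF
  have hFb : ∀ q : ℝ × ℝ, |convR (symbolKernel γ c 0 0 t) (fun y => F (q.1, y)) q.2|
      ≤ (∫ y, |symbolKernel γ c 0 0 t y|) * M := fun q => abs_convR_le hK (fun y => hM _) _
  have e1 : ∫ s in (0 : ℝ)..t₀, convR (symbolKernel γ c 0 1 (t₀ + t - s)) (fun y => F (s, y)) x
      = ∫ s in (0 : ℝ)..t₀, convR (symbolKernel γ c 0 1 (t₀ - s))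
        (fun z => convR (symbolKernel γ c 0 0 t) (fun y => F (s, y)) z) x := by
    rw [intervalIntegral.integral_of_le ht₀, intervalIntegral.integral_of_le ht₀,
      integral_Ioc_eq_integral_Ioo, integral_Ioc_eq_integral_Ioo]
    refine setIntegral_congr_fun measurableSet_Ioo fun s hs => ?_
    have hs' : 0 < t₀ - s := sub_pos.2 hs.2
    have h2 := convR_assoc (integrable_symbolKernel hγ hc (m := 1) hs') hK hKm
      (g := fun y => F (s, y)) (by fun_prop) (fun y => hM _) x
    rw [convR_symbolKernel_deriv hγ hc hs' ht] at h2
    rw [show t₀ + t - s = t₀ - s + t by ring]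
    exact h2
  rw [e1, intervalIntegral_convR_symbolKernel hγ hc
    (F := fun q => convR (symbolKernel γ c 0 0 t) (fun y => F (q.1, y)) q.2) hFm hFb ht₀]
  have e2 := funext fun y => intervalIntegral_convR_symbolKernel hγ hc hF hM ht₀ y
  rw [e2]
  simp only [convR_apply, ← integral_const_mul]
  rw [integral_integral_swap]
  · congr 1 with q
    congr 1 with y
    rw [sub_right_comm]
    ring
  · have hprod := hK.mul_prod (integrableOn_symbolKernel_sub hγ hc t₀)
    have := integrable_mul_of_abs_le hprod (g := fun r : ℝ × ℝ × ℝ => F (r.2.1, x - r.1 - r.2.2))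
      (Measurable.aestronglyMeasurable (by fun_prop)) (Eventually.of_forall fun q => hM _)
    refine this.congr (Eventually.of_forall fun r => ?_)
    simp only [Function.uncurry]
    ring

/-- Duhamel's formula may be restarted at a positive time. -/
theorem duhamel_restart {T : ℝ} {v : ℝ × ℝ → ℝ} {g : ℝ → ℝ} {R N : ℝ} (hg : Measurable g)
    (hgR : ∀ x, |g x| ≤ R) (hv : Measurable v) (hvN : ∀ q, |v q| ≤ N) (hF : Measurable F)
    (hM : ∀ q, |F q| ≤ M)
    (hD : ∀ t ∈ Ioo 0 T, ∀ x, v (t, x) = convR (symbolKernel γ c 0 0 t) g x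
      - ∫ s in (0 : ℝ)..t, convR (symbolKernel γ c 0 1 (t - s)) (fun y => F (s, y)) x)
    {t₀ t : ℝ} (ht₀ : 0 < t₀) (ht : 0 < t) (htT : t₀ + t < T) (x : ℝ) :
    v (t₀ + t, x) = convR (symbolKernel γ c 0 0 t) (fun y => v (t₀, y)) x
      - ∫ s in (0 : ℝ)..t, convR (symbolKernel γ c 0 1 (t - s)) (fun y => F (t₀ + s, y)) x := by
  have hK := integrable_symbolKernel hγ hc (m := 0) ht
  have hK₀ := integrable_symbolKernel hγ hc (m := 0) ht₀
  have hK₀m := (continuous_symbolKernel hγ hc (j := 0) (m := 0) ht₀).measurable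
  set A := convR (symbolKernel γ c 0 0 t₀) g with hA
  have hAm : Measurable A := measurable_convR hK₀m hg
  have hAb := abs_convR_le hK₀ hgR
  have h1 := hD (t₀ + t) ⟨by linarith, htT⟩ x
  -- Duhamel's formula at `t₀` expresses the history integral as free evolution minus `v(t₀)`.
  -- Applying the kernel at time `t` gives the part over `(0, t₀)` of the integral up to `t₀ + t`.
  have e0 : (fun y => ∫ s in (0 : ℝ)..t₀,
      convR (symbolKernel γ c 0 1 (t₀ - s)) (fun y => F (s, y)) y) = fun y => A y - v (t₀, y) := by
    ext y
    rw [hD t₀ ⟨ht₀, by linarith⟩ y]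
    ring
  have h2 := convR_intervalIntegral hγ hc hF hM ht₀.le ht x
  rw [e0, convR_sub hK hAm (by fun_prop) hAb (fun y => hvN _), hA,
    ← convR_assoc hK hK₀ hK₀m hg hgR, convR_symbolKernel hγ hc ht ht₀, add_comm t t₀] at h2
  have h3 := intervalIntegrable_convR_symbolKernel hγ hc hF hM (show 0 ≤ t₀ + t by linarith) x
  have h4 : IntervalIntegrable (fun s => convR (symbolKernel γ c 0 1 (t₀ + t - s))
      (fun y => F (s, y)) x) volume 0 t₀ :=
    h3.mono_set (by rw [uIcc_of_le ht₀.le, uIcc_of_le (by linarith)]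
                    exact Icc_subset_Icc_right (by linarith))
  have h5 : IntervalIntegrable (fun s => convR (symbolKernel γ c 0 1 (t₀ + t - s))
      (fun y => F (s, y)) x) volume t₀ (t₀ + t) :=
    h3.mono_set (by rw [uIcc_of_le (by linarith), uIcc_of_le (by linarith)]
                    exact Icc_subset_Icc_left ht₀.le)
  have h6 := intervalIntegral.integral_add_adjacent_intervals h4 h5
  have h7 := intervalIntegral.integral_comp_add_left (a := (0 : ℝ)) (b := t)
    (fun s => convR (symbolKernel γ c 0 1 (t₀ + t - s)) (fun y => F (s, y)) x) t₀
  rw [add_zero] at h7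
  have h8 : ∀ s, t₀ + t - (t₀ + s) = t - s := fun s => by ring
  simp only [h8] at h7
  rw [h7]
  linarith

/-- After the restart only times from `t₀` on occur, where all derivatives of `v` and `F` are
bounded. They can therefore fall on these functions, leaving integrable kernels untouched. -/
theorem iteratedDeriv_duhamel_restart {T : ℝ} {v : ℝ × ℝ → ℝ} (hF : Measurable F)
    (hM : ∀ q, |F q| ≤ M)
    (hvs : ContDiffOn ℝ ∞ v (strip 0 T)) (hFs : ContDiffOn ℝ ∞ F (strip 0 T)) {t₀ t : ℝ}
    (ht₀ : 0 < t₀) (ht : 0 < t) (htT : t₀ + t < T)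
    (hvb : ∀ m, ∃ B, ∀ q ∈ strip 0 T, t₀ ≤ q.1 → ‖iteratedFDeriv ℝ m v q‖ ≤ B)
    (hFb : ∀ m, ∃ B, ∀ q ∈ strip 0 T, t₀ ≤ q.1 → ‖iteratedFDeriv ℝ m F q‖ ≤ B)
    (hD : ∀ x, v (t₀ + t, x) = convR (symbolKernel γ c 0 0 t) (fun y => v (t₀, y)) x
      - ∫ s in (0 : ℝ)..t, convR (symbolKernel γ c 0 1 (t - s)) (fun y => F (t₀ + s, y)) x)
    (m : ℕ) (x : ℝ) :
    iteratedDeriv m (fun x => v (t₀ + t, x)) x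
      = convR (symbolKernel γ c 0 0 t) (iteratedDeriv m (fun y => v (t₀, y))) x
      - ∫ s in (0 : ℝ)..t, convR (symbolKernel γ c 0 1 (t - s))
          (iteratedDeriv m (fun y => F (t₀ + s, y))) x := by
  have ht₀T : t₀ ∈ Ioo 0 T := ⟨ht₀, by linarith⟩
  have hK := integrable_symbolKernel hγ hc (m := 0) ht
  have hK' := integrableOn_symbolKernel_sub hγ hc t
  have hFsh : Measurable (fun q : ℝ × ℝ => F (t₀ + q.1, q.2)) := by fun_prop
  have hstrip : ∀ q ∈ strip 0 t, ∀ y, (t₀ + q.1, y) ∈ strip 0 T := fun q hq y => by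
    have := mem_strip.1 hq
    exact mem_strip.2 ⟨by simp only; linarith, by simp only; linarith⟩
  have hvc := contDiff_slice hvs ht₀T
  have hsub : ∀ (g : ℝ → ℝ) (m : ℕ) (y : ℝ), iteratedDeriv m (fun x => g (x - y))
      = fun x => iteratedDeriv m g (x - y) := fun g m y => iteratedDeriv_comp_sub_const m g y
  have hFc : ∀ q ∈ strip 0 t, ContDiff ℝ ∞ (fun x => F (t₀ + q.1, x - q.2)) := fun q hq => by
    have h1 := contDiff_slice hFs (t := t₀ + q.1) (mem_strip.1 (hstrip q hq 0))
    exact h1.comp (contDiff_id.sub contDiff_const)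
  have hFmeas : ∀ m x, AEStronglyMeasurable
      (fun q : ℝ × ℝ => iteratedDeriv m (fun y => F (t₀ + q.1, y)) (x - q.2))
      (volume.restrict (strip 0 t)) := fun m x => by
    refine ContinuousOn.aestronglyMeasurable ?_ (isOpen_strip 0 t).measurableSet
    exact (continuousOn_iteratedDeriv_slice hFs m).comp
      (f := fun q : ℝ × ℝ => (t₀ + q.1, x - q.2)) (by fun_prop) fun q hq => hstrip q hq _
  have hFbd : ∀ m, ∃ B, ∀ q ∈ strip 0 t, ∀ x,
      |iteratedDeriv m (fun y => F (t₀ + q.1, y)) (x - q.2)| ≤ B := fun m => by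
    obtain ⟨B, hB⟩ := hFb m
    refine ⟨B, fun q hq x => ?_⟩
    have hmem := hstrip q hq (x - q.2)
    refine (abs_iteratedDeriv_slice_le hFs hmem m).trans (hB _ hmem ?_)
    simp only
    linarith [(mem_strip.1 hq).1]
  have a1 : ∀ᵐ y : ℝ, ContDiff ℝ ∞ (fun x => v (t₀, x - y)) :=
    Eventually.of_forall fun y => hvc.comp (contDiff_id.sub contDiff_const)
  have a2 : ∀ m x, AEStronglyMeasurable
      (fun y => iteratedDeriv m (fun x => v (t₀, x - y)) x) volume := fun m x => by
    simp only [hsub (fun y => v (t₀, y))]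
    have := hvc.continuous_iteratedDeriv m (by exact_mod_cast le_top)
    exact Continuous.aestronglyMeasurable (by fun_prop)
  have a3 : ∀ m, ∃ B, ∀ᵐ y : ℝ, ∀ x, |iteratedDeriv m (fun x => v (t₀, x - y)) x| ≤ B :=
    fun m => by
    obtain ⟨B, hB⟩ := hvb m
    refine ⟨B, Eventually.of_forall fun y x => ?_⟩
    rw [hsub (fun y => v (t₀, y))]
    have hmem : (t₀, x - y) ∈ strip 0 T := mem_strip.2 ht₀T
    exact (abs_iteratedDeriv_slice_le hvs hmem m).trans (hB _ hmem le_rfl)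
  have b1 : ∀ᵐ q ∂(volume.restrict (strip 0 t)),
      ContDiff ℝ ∞ (fun x => F (t₀ + q.1, x - q.2)) := by
    filter_upwards [ae_restrict_mem (isOpen_strip 0 t).measurableSet] with q hq using hFc q hq
  have b2 : ∀ m x, AEStronglyMeasurable
      (fun q : ℝ × ℝ => iteratedDeriv m (fun x => F (t₀ + q.1, x - q.2)) x)
      (volume.restrict (strip 0 t)) := fun m x => by
    refine (hFmeas m x).congr (Eventually.of_forall fun q => ?_)
    simp only [hsub (fun y => F (t₀ + q.1, y))]
  have b3 : ∀ m, ∃ B, ∀ᵐ q ∂(volume.restrict (strip 0 t)),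
      ∀ x, |iteratedDeriv m (fun x => F (t₀ + q.1, x - q.2)) x| ≤ B := fun m => by
    obtain ⟨B, hB⟩ := hFbd m
    refine ⟨B, ?_⟩
    filter_upwards [ae_restrict_mem (isOpen_strip 0 t).measurableSet] with q hq x
    rw [hsub (fun y => F (t₀ + q.1, y))]
    exact hB q hq x
  have hfun : (fun x => v (t₀ + t, x))
      = (fun x => ∫ y, symbolKernel γ c 0 0 t y * v (t₀, x - y))
        - fun x => ∫ q in strip 0 t,
          symbolKernel γ c 0 1 (t - q.1) q.2 * F (t₀ + q.1, x - q.2) := by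
    ext x
    rw [hD x, Pi.sub_apply, intervalIntegral_convR_symbolKernel hγ hc
      (F := fun q => F (t₀ + q.1, q.2)) hFsh (fun q => hM _) ht.le x]
    rfl
  rw [hfun, iteratedDeriv_sub
    ((contDiff_integral_mul hK a1 a2 a3).contDiffAt.of_le (by exact_mod_cast le_top))
    ((contDiff_integral_mul hK' b1 b2 b3).contDiffAt.of_le (by exact_mod_cast le_top)),
    iteratedDeriv_integral_mul hK a1 a2 a3, iteratedDeriv_integral_mul hK' b1 b2 b3]
  congr 1
  · simp only [hsub (fun y => v (t₀, y)), convR_apply]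
  · simp only [fun q : ℝ × ℝ => hsub (fun y => F (t₀ + q.1, y)) m q.2]
    obtain ⟨B, hB⟩ := hFbd m
    have hint : IntegrableOn (fun q : ℝ × ℝ => symbolKernel γ c 0 1 (t - q.1) q.2
        * iteratedDeriv m (fun y => F (t₀ + q.1, y)) (x - q.2)) (strip 0 t) := by
      refine integrable_mul_of_abs_le hK' (hFmeas m x) (M := B) ?_
      filter_upwards [ae_restrict_mem (isOpen_strip 0 t).measurableSet] with q hq using hB q hq x
    rw [IntegrableOn, volume_restrict_strip] at hint
    rw [volume_restrict_strip, integral_prod _ hint, intervalIntegral.integral_of_le ht.le,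
      integral_Ioc_eq_integral_Ioo]
    rfl

end DuhamelIntegral

/-! ### Identification with the kernel of the equation -/

section MildKernel

variable {α : ℝ}

/-- The value `i^{α+1}` of the principal branch. -/
def mildPhase (α : ℝ) : ℂ := Complex.exp (((1 + α) * (Real.pi / 2) : ℝ) * Complex.I)

/-- The angle `(1 + α)π/2` lies strictly between `π/2` and `π`, which makes the semigroup decay at
high frequency. -/
theorem re_mildPhase_neg (hα : α ∈ Ioo (0 : ℝ) 1) : (mildPhase α).re < 0 := by
  rw [mildPhase, Complex.exp_ofReal_mul_I_re]
  have := Real.pi_pos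
  exact Real.cos_neg_of_pi_div_two_lt_of_lt (by nlinarith [hα.1]) (by nlinarith [hα.2])

theorem I_mul_cpow {ξ : ℝ} (hξ : 0 < ξ) :
    (Complex.I * ξ) ^ ((α : ℂ) + 1) = ((ξ ^ (1 + α) : ℝ) : ℂ) * mildPhase α := by
  have h0 : (ξ : ℂ) * Complex.I ≠ 0 := by simp [hξ.ne']
  rw [mul_comm, Complex.cpow_def_of_ne_zero h0, Complex.log_ofReal_mul hξ Complex.I_ne_zero,
    Complex.log_I, mildPhase, Real.rpow_def_of_pos hξ, Complex.ofReal_exp, ← Complex.exp_add]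
  congr 1
  push_cast
  ring

theorem mildKernel_eq_symbolKernel (hα : α ∈ Ioo (0 : ℝ) 1) {t : ℝ} (ht : 0 < t) :
    mildKernel α t = symbolKernel (1 + α) (mildPhase α) 0 0 t := by
  ext x
  have hγ : 1 < 1 + α := by linarith [hα.1]
  set g : ℝ → ℂ := fun ξ => Complex.exp (Complex.I * ξ * x) *
      Complex.exp (t * (Complex.I * ξ) ^ ((α : ℂ) + 1)) with hg
  have hpos : ∀ ξ ∈ Ioi (0 : ℝ), halfFun (1 + α) (mildPhase α) 0 t x ξ = g ξ := by
    intro ξ hξ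
    simp only [hg, halfFun]
    rw [I_mul_cpow hξ, ← Complex.exp_add, Real.rpow_zero, Complex.ofReal_one, one_mul]
    congr 1
    push_cast
    ring
  have hsymm : ∀ ξ : ℝ, 0 < ξ → g (-ξ) = (starRingEnd ℂ) (g ξ) := by
    intro ξ hξ
    -- The argument of `iξ` is `π/2`, off the branch cut, so the power commutes with conjugation.
    have harg : (Complex.I * (ξ : ℂ)).arg ≠ Real.pi := by
      rw [mul_comm, Complex.arg_real_mul _ hξ, Complex.arg_I]
      linarith [Real.pi_pos]
    have h := Complex.conj_cpow (Complex.I * ξ) ((α : ℂ) + 1) harg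
    simp only [map_mul, map_add, map_one, Complex.conj_I, Complex.conj_ofReal] at h
    simp only [hg, map_mul, ← Complex.exp_conj, Complex.conj_I, Complex.conj_ofReal, ← h]
    push_cast
    simp only [mul_neg, neg_mul]
  have hint : IntegrableOn g (Ioi 0) :=
    (integrableOn_halfFun hγ (re_mildPhase_neg hα) (by norm_num) ht).congr_fun hpos
      measurableSet_Ioi
  have h := (integrable_and_integral_of_conj_symm hsymm hint).2
  rw [mildKernel, h, Complex.ofReal_re, ← setIntegral_congr_fun measurableSet_Ioi hpos]
  simp only [symbolKernel, halfInt, pow_zero, one_mul, Nat.cast_zero, mul_zero, add_zero]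
  field_simp

theorem deriv_mildKernel (hα : α ∈ Ioo (0 : ℝ) 1) {t : ℝ} (ht : 0 < t) :
    deriv (mildKernel α t) = symbolKernel (1 + α) (mildPhase α) 0 1 t := by
  ext x
  rw [mildKernel_eq_symbolKernel hα ht]
  exact (hasDerivAt_symbolKernel (by linarith [hα.1]) (re_mildPhase_neg hα) ht x).deriv

theorem intervalIntegral_congr_Ioo {g h : ℝ → ℝ} {t : ℝ} (ht : 0 ≤ t)
    (hgh : ∀ s ∈ Ioo 0 t, g s = h s) : ∫ s in (0 : ℝ)..t, g s = ∫ s in (0 : ℝ)..t, h s := by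
  rw [intervalIntegral.integral_of_le ht, intervalIntegral.integral_of_le ht,
    integral_Ioc_eq_integral_Ioo, integral_Ioc_eq_integral_Ioo]
  exact setIntegral_congr_fun measurableSet_Ioo hgh

/-- The kernels are identified only at positive times, so the integrands are compared on the open
interval `s < t`. -/
theorem duhamel_mildKernel (hα : α ∈ Ioo (0 : ℝ) 1) {t : ℝ} (ht : 0 < t) (g : ℝ → ℝ)
    {G H : ℝ → ℝ → ℝ} (hGH : ∀ s ∈ Ioo 0 t, G s = H s) (x : ℝ) :
    convR (mildKernel α t) g x - ∫ s in (0 : ℝ)..t, convR (deriv (mildKernel α (t - s))) (G s) x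
      = convR (symbolKernel (1 + α) (mildPhase α) 0 0 t) g x
      - ∫ s in (0 : ℝ)..t, convR (symbolKernel (1 + α) (mildPhase α) 0 1 (t - s)) (H s) x := by
  rw [mildKernel_eq_symbolKernel hα ht]
  congr 1
  refine intervalIntegral_congr_Ioo ht.le fun s hs => ?_
  rw [deriv_mildKernel hα (sub_pos.2 hs.2), hGH s hs]

end MildKernel

/-! ### Representatives of the data, local existence and uniqueness -/

theorem convR_congr_ae {k g h : ℝ → ℝ} (hgh : g =ᵐ[volume] h) (x : ℝ) :
    convR k g x = convR k h x := by
  rw [convR_apply, convR_apply]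
  refine integral_congr_ae ?_
  filter_upwards [(quasiMeasurePreserving_sub_left volume x).ae_eq_comp hgh] with y hy
  rw [show g (x - y) = h (x - y) from hy]

/-- The measurable functions bounded by `R` everywhere. -/
def BoundedDatum (R : ℝ) : Type := {g : ℝ → ℝ // Measurable g ∧ ∀ x, |g x| ≤ R}

instance (R : ℝ) : TopologicalSpace (BoundedDatum R) := ⊥

instance (R : ℝ) : DiscreteTopology (BoundedDatum R) := ⟨rfl⟩

theorem exists_boundedDatum_ae_eq {R : ℝ} (hR : 0 ≤ R) {u₀ : ℝ → ℝ} (hu : MemLp u₀ ⊤ volume)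
    (hn : eLpNorm u₀ ⊤ volume ≤ ENNReal.ofReal R) :
    ∃ g : BoundedDatum R, u₀ =ᵐ[volume] g.1 := by
  have hb : ∀ᵐ x, |u₀ x| ≤ R := by
    rw [eLpNorm_exponent_top] at hn
    filter_upwards [enorm_ae_le_eLpNormEssSup u₀ volume] with x hx
    have := hx.trans hn
    rw [← ofReal_norm, ENNReal.ofReal_le_ofReal_iff hR] at this
    exact this
  refine ⟨⟨fun x => max (-R) (min R (hu.1.mk u₀ x)), ?_, fun x => ?_⟩, ?_⟩
  · exact measurable_const.max (measurable_const.min hu.1.stronglyMeasurable_mk.measurable)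
  · exact abs_le.2 ⟨le_max_left _ _, max_le (by linarith) (min_le_left _ _)⟩
  · filter_upwards [hb, hu.1.ae_eq_mk] with x hx hxe
    rw [← hxe, min_eq_right (abs_le.1 hx).2, max_eq_right (abs_le.1 hx).1]

section Existence

variable {γ : ℝ} {c : ℂ} {U : Type*} [TopologicalSpace U] [DiscreteTopology U] {d : U → ℝ → ℝ}
  {R : ℝ} {f : ℝ → ℝ}

/-- The data enter the smallness conditions only through `R`, which is why one `T` serves the entire
family. -/
theorem exists_isDuhamelSolution (hγ : 1 < γ) (hc : c.re < 0) (hd : ∀ u, Measurable (d u))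
    (hdR : ∀ u x, |d u x| ≤ R) (hR : 0 ≤ R) (hf : ContDiff ℝ ∞ f) :
    ∃ T, 0 < T ∧ 2 * T ≤ 1 ∧ ∃ v : U × strip 0 (2 * T) →ᵇ ℝ,
      IsDuhamelSolution γ c d f (1, 0) v ∧ ContDiffAt ℝ ∞ (rescale (T := T) v) (1, 0) := by
  have hβ := inv_gamma_lt_one hγ
  have hβ' : 0 < 1 - γ⁻¹ := by linarith
  set k₀ := paramKernel γ c γ⁻¹ (0, 0, 0) (1, 0) with hk₀
  set k₁ := paramKernel γ c γ⁻¹ (0, 1, 0) (1, 0) with hk₁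
  -- The first summand bounds the free evolution; the extra `1` leaves room for the Duhamel term.
  set N := Real.pi * R * ‖k₀‖ + 1 with hN
  have hN0 : 0 ≤ N := by positivity
  obtain ⟨M, hM0, hM⟩ := exists_abs_le_of_continuous hf.continuous N
  obtain ⟨L, hL0, hL, hlip⟩ := exists_lipschitz_of_contDiff hf N
  obtain ⟨T, hT0, hT1, hTs⟩ : ∃ T : ℝ, 0 < T ∧ 2 * T ≤ 1 ∧
      (2 * T) ^ (1 - γ⁻¹) / (1 - γ⁻¹) * Real.pi * ‖k₁‖ * (M + L) ≤ 1 / 2 := by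
    have hcont : Continuous fun T : ℝ =>
        (2 * T) ^ (1 - γ⁻¹) / (1 - γ⁻¹) * Real.pi * ‖k₁‖ * (M + L) := by
      have := (Real.continuous_rpow_const hβ'.le).comp (continuous_const_mul (2 : ℝ))
      simp only [Function.comp_def] at this
      fun_prop
    -- The exponent `1 - γ⁻¹` is positive, so the bound on the Duhamel operator tends to zero with
    -- `T`.
    have h1 : ∀ᶠ T : ℝ in 𝓝 0,
        (2 * T) ^ (1 - γ⁻¹) / (1 - γ⁻¹) * Real.pi * ‖k₁‖ * (M + L) < 1 / 2 := by
      refine hcont.continuousAt.eventually_lt continuousAt_const ?_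
      rw [mul_zero, Real.zero_rpow hβ'.ne']
      norm_num
    have h2 : ∀ᶠ T : ℝ in 𝓝 0, T < 1 / 2 := gt_mem_nhds (by norm_num)
    obtain ⟨T, ⟨h1, h2⟩, h3⟩ := ((h1.and h2).filter_mono nhdsWithin_le_nhds |>.and
      (self_mem_nhdsWithin (s := Ioi (0 : ℝ)))).exists
    exact ⟨T, h3, by linarith, h1.le⟩
  have h2T : 0 ≤ 2 * T := by linarith
  have hB := norm_duhamelOp_le (U := U) hβ h2T k₁
  have hB' := norm_duhamelOp_le (U := U) hβ hT0.le k₁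
  have hmono : T ^ (1 - γ⁻¹) ≤ (2 * T) ^ (1 - γ⁻¹) :=
    Real.rpow_le_rpow hT0.le (by linarith) hβ'.le
  set η := (2 * T) ^ (1 - γ⁻¹) / (1 - γ⁻¹) * Real.pi * ‖k₁‖ with hη
  have hη' : T ^ (1 - γ⁻¹) / (1 - γ⁻¹) * Real.pi * ‖k₁‖ ≤ η := by rw [hη]; gcongr
  have hη0 : 0 ≤ η := by positivity
  have hηM : η * M ≤ 1 := by nlinarith [mul_nonneg hη0 hL0]
  have hηL : η * L ≤ 1 / 2 := by nlinarith [mul_nonneg hη0 hM0]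
  have hfree := norm_freeOp_apply_le (inv_gamma_pos hγ) hT1 hd hdR hR k₀
  obtain ⟨v, hvN, hv⟩ := exists_duhamel_fixedPoint hf.continuous
    (a := freeOp (inv_gamma_pos hγ) hT1 hd hdR hR k₀) (B := duhamelOp U hβ h2T k₁)
    hN0 hL0 hM hlip
    (by have := mul_le_mul_of_nonneg_right hB hM0
        linarith)
    ((mul_le_mul_of_nonneg_right hB hL0).trans hηL)
  have hsol : IsDuhamelSolution γ c d f (1, 0) v :=
    (isDuhamelSolution_iff hγ hc hd hdR hR hf.continuous h2T hT1 base_mem_paramBall v).2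
      (by rw [one_smul]; exact hv)
  refine ⟨T, hT0, hT1, v, hsol, contDiffAt_rescale hγ hc hd hdR hR hf hT0.le (by linarith) hsol
    (fun r hr => hL r (hr.trans hvN)) ?_⟩
  have := mul_le_mul_of_nonneg_right (hB'.trans hη') hL0
  linarith

omit [DiscreteTopology U] in
theorem stripExt_nemytskii_of_mem {T : ℝ} (hf : Continuous f) (v : U × strip 0 T →ᵇ ℝ) (u : U)
    {q : ℝ × ℝ} (hq : q ∈ strip 0 T) :
    stripExt (nemytskii f hf v) u q = f (stripExt v u q) := by
  rw [stripExt_of_mem _ _ hq, stripExt_of_mem _ _ hq, nemytskii_apply]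

/-- Superposition commutes with rescaling, so `f(v)` inherits smoothness in the parameters and the
same kind of derivative bounds as `v`. -/
theorem contDiffAt_rescale_nemytskii {T : ℝ} (hf : ContDiff ℝ ∞ f)
    {v : U × strip 0 (2 * T) →ᵇ ℝ} (h : ContDiffAt ℝ ∞ (rescale (T := T) v) (1, 0)) :
    ContDiffAt ℝ ∞ (rescale (T := T) (nemytskii f hf.continuous v)) (1, 0) := by
  refine ((contDiff_nemytskii hf).contDiffAt.comp _ h).congr_of_eventuallyEq ?_
  filter_upwards [Metric.isOpen_ball.mem_nhds base_mem_paramBall] with p hp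
  ext z
  rw [Function.comp_apply, nemytskii_apply, rescale_apply _ hp, rescale_apply _ hp,
    stripExt_nemytskii_of_mem _ _ _ (rescale_mem_strip hp z.2.2)]

theorem norm_iteratedFDeriv_stripExt_le {T : ℝ} {v : U × strip 0 (2 * T) →ᵇ ℝ}
    (h : ContDiffAt ℝ ∞ (rescale (T := T) v) (1, 0)) (u : U) {q : ℝ × ℝ} (hq : q ∈ strip 0 T)
    {t₀ : ℝ} (ht₀ : 0 < t₀) (htq : t₀ ≤ q.1) (n : ℕ) :
    ‖iteratedFDeriv ℝ n (stripExt v u) q‖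
      ≤ ‖iteratedFDeriv ℝ n (rescale (T := T) v) (1, 0)‖ * |t₀⁻¹| ^ n := by
  refine ((contDiffAt_stripExt h u hq).2 n).trans ?_
  have h1 : q.1⁻¹ ≤ |t₀⁻¹| := (inv_anti₀ ht₀ htq).trans (le_abs_self _)
  have h2 : 0 ≤ q.1⁻¹ := inv_nonneg.2 (ht₀.le.trans htq)
  gcongr

theorem intervalIntegral_comp_self_sub (g : ℝ → ℝ → ℝ) (t : ℝ) :
    ∫ s in (0 : ℝ)..t, g s (t - s) = ∫ s in (0 : ℝ)..t, g (t - s) s := by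
  have h := intervalIntegral.integral_comp_sub_left (a := (0 : ℝ)) (b := t)
    (fun s => g s (t - s)) t
  rw [sub_self, sub_zero] at h
  rw [← h]
  simp only [sub_sub_cancel]

omit [DiscreteTopology U] in
theorem IsDuhamelSolution.duhamel_formula {T : ℝ} (hf : Continuous f) {v : U × strip 0 T →ᵇ ℝ}
    (hv : IsDuhamelSolution γ c d f (1, 0) v) (u : U) {t : ℝ} (ht : t ∈ Ioo 0 T) (x : ℝ) :
    stripExt v u (t, x) = convR (symbolKernel γ c 0 0 t) (d u) x
      - ∫ s in (0 : ℝ)..t, convR (symbolKernel γ c 0 1 (t - s))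
          (fun y => stripExt (nemytskii f hf v) u (s, y)) x := by
  have h := hv u (t, x) (mem_strip.2 ht)
  simp only [one_mul, zero_mul, add_zero] at h
  rw [h, ← intervalIntegral_comp_self_sub fun s r => convR (symbolKernel γ c 0 1 s)
    (fun y => stripExt (nemytskii f hf v) u (r, y)) x]
  rfl

/-- Both sides of the equation are continuous on the open strip, so equality almost everywhere is
equality everywhere. A single datum corresponds to `U = Unit`. -/
theorem bcfOf_eq_of_ae_duhamel (hγ : 1 < γ) (hc : c.re < 0) {g : ℝ → ℝ} (hg : Measurable g)
    (hgR : ∀ x, |g x| ≤ R) (hR : 0 ≤ R) (hf : Continuous f) {T : ℝ} (hT0 : 0 ≤ T) (hT : T ≤ 1)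
    {w : ℝ × ℝ → ℝ} (hw : ContinuousOn w (strip 0 T)) {M : ℝ} (hM : ∀ q ∈ strip 0 T, |w q| ≤ M)
    (hD : ∀ᵐ q ∂(volume.restrict (strip 0 T)), w q = convR (symbolKernel γ c 0 0 q.1) g q.2
      - ∫ s in (0 : ℝ)..q.1, convR (symbolKernel γ c 0 1 (q.1 - s)) (fun y => f (w (s, y))) q.2) :
    bcfOf (fun z : Unit × strip 0 T => w z.2)
      = freeOp (inv_gamma_pos hγ) hT (d := fun _ : Unit => g) (fun _ => hg) (fun _ => hgR) hR
          (paramKernel γ c γ⁻¹ (0, 0, 0) (1, 0))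
        - duhamelOp Unit (inv_gamma_lt_one hγ) hT0 (paramKernel γ c γ⁻¹ (0, 1, 0) (1, 0))
          (nemytskii f hf (bcfOf fun z : Unit × strip 0 T => w z.2)) := by
  have hwc : Continuous fun z : Unit × strip 0 T => w z.2 :=
    (continuousOn_iff_continuous_domRestrict.1 hw).comp continuous_snd
  have hwb : ∀ z, bcfOf (fun z : Unit × strip 0 T => w z.2) z = w z.2 :=
    bcfOf_apply hwc fun z => hM _ z.2.2
  set b := bcfOf fun z : Unit × strip 0 T => w z.2 with hb
  set r := freeOp (inv_gamma_pos hγ) hT (d := fun _ : Unit => g) (fun _ => hg) (fun _ => hgR) hR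
          (paramKernel γ c γ⁻¹ (0, 0, 0) (1, 0))
        - duhamelOp Unit (inv_gamma_lt_one hγ) hT0 (paramKernel γ c γ⁻¹ (0, 1, 0) (1, 0))
          (nemytskii f hf b) with hr
  have hbw : ∀ q ∈ strip 0 T, stripExt b () q = w q := fun q hq => by
    rw [stripExt_of_mem _ _ hq, hwb]
  have hae : stripExt b () =ᵐ[volume.restrict (strip 0 T)] stripExt r () := by
    filter_upwards [hD, ae_restrict_mem (isOpen_strip 0 T).measurableSet] with q hq hqs
    have hqs' := mem_strip.1 hqs
    have key := freeOp_sub_duhamelOp_apply hγ hc (d := fun _ : Unit => g) (fun _ => hg)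
      (fun _ => hgR) hR hT0 hT base_mem_paramBall (nemytskii f hf b) ((), ⟨q, hqs⟩)
    rw [one_smul] at key
    simp only [one_mul, zero_mul, add_zero] at key
    rw [hbw q hqs, hq, stripExt_of_mem _ _ hqs, hr, key,
      intervalIntegral_comp_self_sub fun s r => convR (symbolKernel γ c 0 1 s)
        (fun y => stripExt (nemytskii f hf b) () (r, y)) q.2]
    congr 1
    refine intervalIntegral_congr_Ioo hqs'.1.le fun s hs => ?_
    congr 1
    ext y
    have hmem : (s, y) ∈ strip 0 T := mem_strip.2 ⟨hs.1, hs.2.trans hqs'.2⟩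
    rw [stripExt_nemytskii_of_mem _ _ _ hmem, hbw _ hmem]
  have hEq := Measure.eqOn_open_of_ae_eq hae (isOpen_strip 0 T) (continuousOn_stripExt b ())
    (continuousOn_stripExt r ())
  ext ⟨u, q⟩
  have := hEq q.2
  rwa [stripExt_of_mem _ _ q.2, stripExt_of_mem _ _ q.2] at this

theorem eqOn_of_ae_duhamel (hγ : 1 < γ) (hc : c.re < 0) {g : ℝ → ℝ} (hg : Measurable g)
    (hgR : ∀ x, |g x| ≤ R) (hR : 0 ≤ R) (hf : ContDiff ℝ ∞ f) {T : ℝ} (hT0 : 0 ≤ T) (hT : T ≤ 1)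
    {w₁ w₂ : ℝ × ℝ → ℝ} (hw₁ : ContinuousOn w₁ (strip 0 T)) (hw₂ : ContinuousOn w₂ (strip 0 T))
    {M₁ M₂ : ℝ} (hM₁ : ∀ q ∈ strip 0 T, |w₁ q| ≤ M₁) (hM₂ : ∀ q ∈ strip 0 T, |w₂ q| ≤ M₂)
    (hD₁ : ∀ᵐ q ∂(volume.restrict (strip 0 T)), w₁ q = convR (symbolKernel γ c 0 0 q.1) g q.2
      - ∫ s in (0 : ℝ)..q.1, convR (symbolKernel γ c 0 1 (q.1 - s)) (fun y => f (w₁ (s, y))) q.2)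
    (hD₂ : ∀ᵐ q ∂(volume.restrict (strip 0 T)), w₂ q = convR (symbolKernel γ c 0 0 q.1) g q.2
      - ∫ s in (0 : ℝ)..q.1, convR (symbolKernel γ c 0 1 (q.1 - s)) (fun y => f (w₂ (s, y))) q.2) :
    EqOn w₁ w₂ (strip 0 T) := by
  intro q hq
  have h := duhamel_fixedPoint_unique (inv_gamma_lt_one hγ) hT0 hf
    (bcfOf_eq_of_ae_duhamel hγ hc hg hgR hR hf.continuous hT0 hT hw₁ hM₁ hD₁)
    (bcfOf_eq_of_ae_duhamel hγ hc hg hgR hR hf.continuous hT0 hT hw₂ hM₂ hD₂)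
  have hc₁ : Continuous fun z : Unit × strip 0 T => w₁ z.2 :=
    (continuousOn_iff_continuous_domRestrict.1 hw₁).comp continuous_snd
  have hc₂ : Continuous fun z : Unit × strip 0 T => w₂ z.2 :=
    (continuousOn_iff_continuous_domRestrict.1 hw₂).comp continuous_snd
  have := congrArg (fun b : Unit × strip 0 T →ᵇ ℝ => b ((), ⟨q, hq⟩)) h
  rwa [bcfOf_apply hc₁ (fun z => hM₁ _ z.2.2), bcfOf_apply hc₂ (fun z => hM₂ _ z.2.2)] at this

end Existence

end

/-! ### The theorem, from one solution for all data -/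

theorem mainTheorem6 (α : ℝ) (hα : α ∈ Ioo (0 : ℝ) 1) (f : ℝ → ℝ) (hf : ContDiff ℝ ∞ f)
    (R₀ : ℝ) (hR₀ : 0 ≤ R₀) :
    ∃ T : ℝ, 0 < T ∧ ∃ C : ℕ → ℝ → ℝ, (∀ m t₀, 0 < C m t₀) ∧
      ∀ u₀ : ℝ → ℝ, MemLp u₀ ⊤ volume → eLpNorm u₀ ⊤ volume = ENNReal.ofReal R₀ →
        ∃ u : ℝ → ℝ → ℝ,
          (IsSmoothBounded T u ∧ IsMildSolution α f u₀ T u) ∧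
          (∀ v : ℝ → ℝ → ℝ, IsSmoothBounded T v → IsMildSolution α f u₀ T v →
            ∀ t ∈ Ioo 0 T, ∀ x : ℝ, v t x = u t x) ∧
          (∀ t ∈ Ioo 0 T, ∀ x : ℝ, |u t x| ≤ C 0 0) ∧
          (∀ m : ℕ, ∀ t₀ ∈ Ioo 0 T, ∀ t ∈ Ioo t₀ T, ∀ x : ℝ,
            |iteratedDeriv m (u t) x| ≤ C m t₀) ∧
          (∀ m : ℕ, ∀ t₀ ∈ Ioo 0 T, ∀ t ∈ Ioo 0 (T - t₀), ∀ x : ℝ,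
            iteratedDeriv m (u (t₀ + t)) x =
              convR (mildKernel α t) (iteratedDeriv m (u t₀)) x
                - ∫ s in (0 : ℝ)..t, convR (deriv (mildKernel α (t - s)))
                    (iteratedDeriv m (fun y => f (u (t₀ + s) y))) x) := by
  have hγ : 1 < 1 + α := by linarith [hα.1]
  have hc := re_mildPhase_neg hα
  obtain ⟨T, hT0, hT1, v, hv, hvs⟩ := exists_isDuhamelSolution (U := BoundedDatum R₀) hγ hc
    (d := fun g => g.1) (fun g => g.2.1) (fun g => g.2.2) hR₀ hf
  have hFs := contDiffAt_rescale_nemytskii hf hvs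
  set F := nemytskii f hf.continuous v with hF
  -- The first term is the derivative bound of the joint solution, with an absolute value to keep it
  -- nonnegative for every real `t₀`. The summand `‖v‖` makes `C 0 0` bound `u` up to time zero, and
  -- `1` ensures positivity.
  refine ⟨T, hT0, fun m t₀ => ‖iteratedFDeriv ℝ m (rescale (T := T) v) (1, 0)‖ * |t₀⁻¹| ^ m
    + ‖v‖ + 1, fun m t₀ => by positivity, fun u₀ hu₀ hn => ?_⟩
  -- The datum is replaced by a representative bounded everywhere, that is, by a point of `U`;
  -- convolutions do not see the change.
  obtain ⟨g, hg⟩ := exists_boundedDatum_ae_eq hR₀ hu₀ hn.le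
  have hsub : strip 0 T ⊆ strip 0 (2 * T) := fun q hq => by
    have := mem_strip.1 hq
    exact mem_strip.2 ⟨this.1, by linarith⟩
  have hsm : ContDiffOn ℝ ∞ (stripExt v g) (strip 0 T) := fun q hq =>
    (contDiffAt_stripExt hvs g hq).1.contDiffWithinAt
  have hsF : ContDiffOn ℝ ∞ (stripExt F g) (strip 0 T) := fun q hq =>
    (contDiffAt_stripExt hFs g hq).1.contDiffWithinAt
  have hFv : ∀ q ∈ strip 0 T, stripExt F g q = f (stripExt v g q) := fun q hq =>
    stripExt_nemytskii_of_mem _ _ _ (hsub hq)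
  have hD : ∀ t ∈ Ioo 0 T, ∀ x, stripExt v g (t, x)
      = convR (symbolKernel (1 + α) (mildPhase α) 0 0 t) g.1 x
      - ∫ s in (0 : ℝ)..t, convR (symbolKernel (1 + α) (mildPhase α) 0 1 (t - s))
          (fun y => stripExt F g (s, y)) x := fun t ht x =>
    hv.duhamel_formula hf.continuous g ⟨ht.1, by linarith [ht.2]⟩ x
  have hmild : ∀ w : ℝ → ℝ → ℝ, IsMildSolution α f u₀ T w →
      ∀ᵐ q ∂(volume.restrict (strip 0 T)), Function.uncurry w q
        = convR (symbolKernel (1 + α) (mildPhase α) 0 0 q.1) g.1 q.2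
        - ∫ s in (0 : ℝ)..q.1, convR (symbolKernel (1 + α) (mildPhase α) 0 1 (q.1 - s))
            (fun y => f (Function.uncurry w (s, y))) q.2 := fun w hw => by
    filter_upwards [hw.2, ae_restrict_mem (isOpen_strip 0 T).measurableSet] with q hq hqs
    rw [Function.uncurry, hq, convR_congr_ae hg]
    exact duhamel_mildKernel hα (mem_strip.1 hqs).1 g.1 (fun _ _ => rfl) q.2
  have hsol : IsMildSolution α f u₀ T fun t x => stripExt v g (t, x) := by
    refine ⟨memLp_top_of_bound (measurable_stripExt v g).aestronglyMeasurable ‖v‖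
      (Filter.Eventually.of_forall fun q => abs_stripExt_le v g q), ?_⟩
    filter_upwards [ae_restrict_mem (isOpen_strip 0 T).measurableSet] with q hq
    have hq' := mem_strip.1 hq
    rw [convR_congr_ae hg, hD q.1 hq' q.2]
    refine (duhamel_mildKernel hα hq'.1 g.1 (fun s hs => ?_) q.2).symm
    ext y
    exact (hFv (s, y) (mem_strip.2 ⟨hs.1, hs.2.trans hq'.2⟩)).symm
  have hbd : IsSmoothBounded T fun t x => stripExt v g (t, x) := by
    refine ⟨hsm, ⟨‖v‖, fun q _ => abs_stripExt_le v g q⟩, fun t₀ ht₀ n =>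
      ⟨‖iteratedFDeriv ℝ n (rescale (T := T) v) (1, 0)‖ * |t₀⁻¹| ^ n, fun q hq => ?_⟩⟩
    have hq' := mem_strip.1 hq
    exact norm_iteratedFDeriv_stripExt_le hvs g (mem_strip.2 ⟨ht₀.1.trans hq'.1, hq'.2⟩) ht₀.1
      hq'.1.le n
  refine ⟨fun t x => stripExt v g (t, x), ⟨hbd, hsol⟩, fun w hw hwm t ht x => ?_,
    fun t ht x => ?_, fun m t₀ ht₀ t ht x => ?_, fun m t₀ ht₀ t ht x => ?_⟩
  · obtain ⟨M, hM⟩ := hw.2.1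
    exact eqOn_of_ae_duhamel hγ hc g.2.1 g.2.2 hR₀ hf hT0.le (by linarith) hw.1.continuousOn
      hsm.continuousOn hM (fun q _ => abs_stripExt_le v g q) (hmild w hwm) (hmild _ hsol)
      (mem_strip.2 ht : (t, x) ∈ strip 0 T)
  · have h1 := abs_stripExt_le v g (t, x)
    have h2 : 0 ≤ ‖iteratedFDeriv ℝ 0 (rescale (T := T) v) (1, 0)‖ * |(0 : ℝ)⁻¹| ^ 0 := by
      positivity
    linarith
  · have hmem : (t, x) ∈ strip 0 T := mem_strip.2 ⟨ht₀.1.trans ht.1, ht.2⟩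
    have h1 := abs_iteratedDeriv_slice_le hsm hmem m
    have h2 := norm_iteratedFDeriv_stripExt_le hvs g hmem ht₀.1 ht.1.le m
    have h3 := norm_nonneg v
    exact (h1.trans h2).trans (by linarith)
  · have htT : t₀ + t < T := by linarith [ht.2]
    have hr := duhamel_restart hγ hc g.2.1 g.2.2 (measurable_stripExt v g) (abs_stripExt_le v g)
      (measurable_stripExt F g) (abs_stripExt_le F g) hD ht₀.1 ht.1 htT
    have hi := iteratedDeriv_duhamel_restart hγ hc (measurable_stripExt F g) (abs_stripExt_le F g)
      hsm hsF ht₀.1 ht.1 htT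
      (fun m => ⟨_, fun q hq htq => norm_iteratedFDeriv_stripExt_le hvs g hq ht₀.1 htq m⟩)
      (fun m => ⟨_, fun q hq htq => norm_iteratedFDeriv_stripExt_le hFs g hq ht₀.1 htq m⟩) hr m x
    rw [hi]
    refine (duhamel_mildKernel hα ht.1 _ (fun s hs => ?_) x).symm
    congr 1
    ext y
    exact (hFv (t₀ + s, y) (mem_strip.2 ⟨by simp only; linarith [hs.1, ht₀.1],
      by simp only; linarith [hs.2]⟩)).symm
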